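/- **Theorem (Ruh–Vilms theorems for $\sigma_H,\sigma_H^2,\sigma_H^3$).** *Setting.* Let $\mathbb D P^2=\{([x],[\chi])\in\mathbb RP^2\times\mathbb RP_2:\langle x,\chi\rangle>0\}$ and $\mathcal C=\{(x,\chi)\in\mathbb R^3\times\mathbb R_3:\langle x,\chi\rangle=1\}$, with projection $\mathcal C\to \mathbb DP^2$, $(x,\chi)\mapsto([x],[\chi])$. A tangent vector of $\mathbb DP^2$ is represented by its horizontal lift at $(x,\chi)$, a pair $(Y,\Upsilon)$ with $\langle Y,\chi\rangle=\langle x,\Upsilon\rangle=0$. On horizontal vectors the para-Kähler metric is $g=\frac12(\langle Y,\Upsilon'\rangle+\langle Y',\Upsilon\rangle)$ and the symplectic form is $\omega=\frac12(\langle Y,\Upsilon'\rangle-\langle Y',\Upsilon\rangle)$. Let $H\in\{1,-1\}$, let $\mathbb D\subset\mathbb C$ be a simply connected domain, and let $f:\mathbb D\to\mathbb DP^2$ be a smooth immersion with a smooth lift $(x,\chi):\mathbb D\to\mathcal C$ whose induced metric is $2He^u|dz|^2$. Let $(\xi,\eta)$ be the horizontal part of $d(x,\chi)$, $h(X,Y)=\langle\xi(X),\eta(Y)\rangle$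 the pull-back of $g+\omega$, $c=1+i\,h_{12}/h_{11}$, and $\xi_z=\frac12(\xi(\partial_1)-i\xi(\partial_2))$. *Frame.* Let $$R=\begin{pmatrix}\frac1{\sqrt2}&\frac1{\sqrt2}&0\\ \frac i{\sqrt2}&-\frac i{\sqrt2}&0\\0&0&1\end{pmatrix},\qquad G^{\mathbb R}=R^{-1}\,\mathrm{SL}_3\mathbb R\,R .$$ The *normalized frame* is $\mathcal F=R^{-1}\big(c^{-1/2}e^{-u/2}\xi_z,\ \overline{c^{-1/2}e^{-u/2}\xi_z},\ x\big)$, where the lift is rescaled, $(x,\chi)\mapsto(\alpha x,\alpha^{-1}\chi)$, so that $\det\mathcal F=1$. *Primitive harmonicity.* Let $\epsilon=e^{i\pi/3}$, $$P=P_H^\epsilon=\begin{pmatrix}0&\epsilon^2&0\\ \epsilon^4&0&0\\0&0&-H\end{pmatrix},\qquad \sigma_H(X)=-PX^TP\quad(X\in\mathfrak{sl}_3\mathbb C),$$ an automorphism of order $6$. For $n=1,2,3$ let $\kappa=\sigma_H^n$, $k=6/n$, and let $\mathfrak g_m$ be the eigenspace of $\kappa$ in $\mathfrak{sl}_3\mathbb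 C$ for the eigenvalue $e^{2\pi i m/k}$. A smooth map $\mathcal F:\mathbb D\to G^{\mathbb R}$ is *primitive harmonic relative to $\kappa$* if $\mathcal F^{-1}d\mathcal F=\alpha_{-1}dz+\alpha_0'dz+\alpha_0''d\bar z+\alpha_1d\bar z$ with $\alpha_{\pm1}$ in $\mathfrak g_{\pm1}$ and $\alpha_0',\alpha_0''$ in $\mathfrak g_0$, and $\lambda^{-1}\alpha_{-1}dz+\alpha_0+\lambda\alpha_1d\bar z$ is integrable for all $\lambda\in\mathbb C^\times$. A map into a homogeneous space of $G^{\mathbb R}$ associated with $\kappa$ is *primitive harmonic* if it has a smooth frame $\mathbb D\to G^{\mathbb R}$ that is primitive harmonic relative to $\kappa$. *Target spaces.* $A\in G^{\mathbb R}$ acts on the para-complex space $\mathbb R^3\times\mathbb R_3$ and on its complexification by $(x,\chi)\mapsto(Bx,B^{-T}\chi)$, $B=RAR^{-1}$. Let $e_3$ also denote the point $(e_3,e_3)\in\mathcal C$, let $V_0=\{(y,\mathrm{diag}(-H,-H,1)y):y\in\mathbb R^3\}$ (a real Lagrangian subspace), and let $W_0$ be the flag $0\subset\langle (e_3,0),(0,e_3)\rangle\subset\langle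 (e_3,0),(0,e_3),(v,0),(0,v)\rangle\subset\mathbb C^3\times\mathbb C_3$ with $v=R\,(0,1,0)^T$. - $\mathrm{SLGr}$ (special Lagrangian Grassmannian) is the orbit of $V_0$; $FL_1^H=\{(w,V):w\in\mathcal C,\ w\in V,\ V\in\mathrm{SLGr}\}$. - $FL_2^H$ is the orbit of $(e_3,W_0)$ (special para-complex flags over points of $\mathcal C$), and $Fl_2^H$ is the orbit of $W_0$ (flag manifold). - $FL_3^H=\{UPU^T\}$, $\widetilde{Fl}_2^H=\{U(PP^T)U^{-1}\}$ and $\widetilde{\mathrm{SLGr}}=\{U(PP^TP)U^T\}$, where $U\in G^{\mathbb R}$. The *Gauss maps* of $f$ are $\mathcal G_1=\mathcal F\cdot(e_3,V_0)$, $\mathcal G_2=\mathcal F\cdot(e_3,W_0)$, $\mathcal G_3=\mathcal FP\mathcal F^T$, $\mathcal H_1=\mathcal F\cdot V_0$, $\mathcal H_2=\mathcal F\cdot W_0$, $\mathcal H_{3,1}=\mathcal F(PP^TP)\mathcal F^T$ and $\mathcal H_{3,2}=\mathcal F(PP^T)\mathcal F^{-1}$. *Claim.* The normalized frame is a smooth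 map $\mathbb D\to G^{\mathbb R}$, and the following hold. 1. For each $j=1,2,3$, $\mathcal G_j$ is a primitive harmonic map into $FL_j^H$ (relative to $\sigma_H$) if and only if $\mathcal F$ is primitive harmonic relative to $\sigma_H$, if and only if $f$ is minimal Lagrangian. 2. Each of $\mathcal H_2:\mathbb D\to Fl_2^H$ and $\mathcal H_{3,2}:\mathbb D\to\widetilde{Fl}_2^H$ is primitive harmonic (relative to $\sigma_H^2$) if and only if $\mathcal F$ is primitive harmonic relative to $\sigma_H^2$, if and only if $f$ is minimal. 3. Each of $\mathcal H_1:\mathbb D\to\mathrm{SLGr}$ and $\mathcal H_{3,1}:\mathbb D\to\widetilde{\mathrm{SLGr}}$ is primitive harmonic (relative to $\sigma_H^3$) if and only if $\mathcal F$ is primitive harmonic relative to $\sigma_H^3$, if and only if $f$ is minimal Lagrangian or flat homogeneous. Here *minimal* means vanishing mean curvature vector, *Lagrangian* means $f^*\omega=0$, and *flat homogeneous* means that the induced metric is flat and $f$ is an open part of an orbit of a connected Lie subgroup of $\mathrm{SL}_3\mathbb R$ acting by $([x],[\chi])\mapsto([Ax],[A^{-T}\chi])$. -/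

import Mathlib

open scoped ContDiff Matrix LinearAlgebra.Projectivization

noncomputable section

namespace RuhVilms

/-! ### The para-complex projective plane and lifts -/

/-- Column vectors of `ℝ³`; also used for covectors, the natural pairing being `x ⬝ᵥ χ`. -/
abbrev V3 := Fin 3 → ℝ

/-- Complex `3 × 3` matrices. -/
abbrev M3 := Matrix (Fin 3) (Fin 3) ℂ

/-- The para-complex projective plane: pairs `([x], [χ])` that have representatives with
`⟨x, χ⟩ > 0`. -/
def DP2 : Type :=
  {p : ℙ ℝ V3 × ℙ ℝ V3 // ∃ (x χ : V3) (hx : x ≠ 0) (hχ : χ ≠ 0),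
    p = (Projectivization.mk ℝ x hx, Projectivization.mk ℝ χ hχ) ∧ 0 < x ⬝ᵥ χ}

/-- The quadric `⟨x, χ⟩ = 1` in `ℝ³ × ℝ₃`, the total space of the fibration over `DP2`. -/
def CM : Set (V3 × V3) := {p | p.1 ⬝ᵥ p.2 = 1}

/-- `(x, χ)` is a smooth lift to the quadric of the map `f` on the domain `D`. -/
structure IsLift (D : Set ℂ) (f : ℂ → DP2) (x χ : ℂ → V3) : Prop where
  smooth_fst : ContDiffOn ℝ ∞ x D
  smooth_snd : ContDiffOn ℝ ∞ χ D
  mem_quadric : ∀ z ∈ D, (x z, χ z) ∈ CM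
  proj : ∀ z ∈ D, ∃ (hx : x z ≠ 0) (hχ : χ z ≠ 0),
    (f z).1 = (Projectivization.mk ℝ (x z) hx, Projectivization.mk ℝ (χ z) hχ)

/-! ### Geometry of `DP2`, computed on horizontal vectors

The projection of the quadric onto `DP2` is a pseudo-Riemannian submersion; its vertical line at
`(x, χ)` is spanned by `(x, -χ)`.  A tangent vector of `DP2` at `([x], [χ])` is represented by its
horizontal lift at `(x, χ)`.  Replacing `(x, χ)` by `(a x, a⁻¹ χ)` replaces the horizontal lift
`(Y, Υ)` by `(a Y, a⁻¹ Υ)`, so that none of the properties below depends on the lift. -/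

/-- `p` is horizontal at `(x, χ)`. -/
def IsHorizontal (x χ : V3) (p : V3 × V3) : Prop := p.1 ⬝ᵥ χ = 0 ∧ x ⬝ᵥ p.2 = 0

/-- Projection of `ℝ³ × ℝ₃` onto the horizontal space at `(x, χ)`. -/
def hor (x χ : V3) (p : V3 × V3) : V3 × V3 :=
  (p.1 - (p.1 ⬝ᵥ χ) • x, p.2 - (x ⬝ᵥ p.2) • χ)

/-- The metric of `DP2` on horizontal vectors. -/
def gDP (p q : V3 × V3) : ℝ := (p.1 ⬝ᵥ q.2 + q.1 ⬝ᵥ p.2) / 2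

/-- The symplectic form of `DP2` on horizontal vectors. -/
def omegaDP (p q : V3 × V3) : ℝ := (p.1 ⬝ᵥ q.2 - q.1 ⬝ᵥ p.2) / 2

/-- The differential of `f` in the direction `v`, as a horizontal vector: the pair
`(ξ(v), η(v))`. -/
def df (x χ : ℂ → V3) (v z : ℂ) : V3 × V3 :=
  hor (x z) (χ z) (fderiv ℝ x z v, fderiv ℝ χ z v)

/-- The vertical component `ψ(v)` of the differential of the lift. -/
def psi (x χ : ℂ → V3) (v z : ℂ) : ℝ := fderiv ℝ x z v ⬝ᵥ χ z

/-- The pull-back by `f` of `g + ω` on the constant vector fields `v`, `w`. -/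
def hForm (x χ : ℂ → V3) (v w z : ℂ) : ℝ := (df x χ v z).1 ⬝ᵥ (df x χ w z).2

/-- The Levi-Civita derivative of `DP2`, along `f` and in the direction `v`, of the vector field
`df(w)` (`v`, `w` constant).  It is the horizontal part of the flat derivative of the horizontal
field `(ξ(w), η(w))`, where the contribution `ψ(v) (ξ(w), -η(w))` of the vertical part of the
velocity of the lift is removed. -/
def nablaDP (x χ : ℂ → V3) (v w z : ℂ) : V3 × V3 :=
  hor (x z) (χ z)
    (fderiv ℝ (fun y => (df x χ w y).1) z v - psi x χ v z • (df x χ w z).1,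
     fderiv ℝ (fun y => (df x χ w y).2) z v + psi x χ v z • (df x χ w z).2)

/-- `f` is a liftable immersion of `D` whose induced metric is definite of sign `H`, and the
coordinate `z` of `D` is conformal for it: the induced metric is `2 H e^u |dz|²`. -/
def IsDefiniteImmersion (H : ℝ) (D : Set ℂ) (f : ℂ → DP2) : Prop :=
  ∃ x χ : ℂ → V3, IsLift D f x χ ∧ ∀ z ∈ D,
    0 < H * gDP (df x χ 1 z) (df x χ 1 z) ∧
    gDP (df x χ 1 z) (df x χ 1 z) = gDP (df x χ Complex.I z) (df x χ Complex.I z) ∧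
    gDP (df x χ 1 z) (df x χ Complex.I z) = 0

/-- The pull-back of the symplectic form vanishes. -/
def IsLagrangian (D : Set ℂ) (f : ℂ → DP2) : Prop :=
  ∃ x χ : ℂ → V3, IsLift D f x χ ∧ ∀ z ∈ D, ∀ v w : ℂ, omegaDP (df x χ v z) (df x χ w z) = 0

/-- The mean curvature vector vanishes: in the conformal coordinate the trace of the second
fundamental form is a multiple of the normal part of `∇₁ df(∂₁) + ∇₂ df(∂₂)`. -/
def IsMinimal (D : Set ℂ) (f : ℂ → DP2) : Prop :=
  ∃ x χ : ℂ → V3, IsLift D f x χ ∧ ∀ z ∈ D, ∀ n : V3 × V3, IsHorizontal (x z) (χ z) n →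
    (∀ v : ℂ, gDP n (df x χ v z) = 0) →
    gDP n (nablaDP x χ 1 1 z + nablaDP x χ Complex.I Complex.I z) = 0

/-- The conformal factor `e^u` of the induced metric `2 H e^u |dz|²`. -/
def expU (H : ℝ) (x χ : ℂ → V3) (z : ℂ) : ℝ := H * hForm x χ 1 1 z / 2

/-- The Gauss curvature of the induced metric vanishes: in the conformal coordinate this means
`∂₁∂₁ u + ∂₂∂₂ u = 0`. -/
def IsFlat (H : ℝ) (D : Set ℂ) (f : ℂ → DP2) : Prop :=
  ∃ x χ : ℂ → V3, IsLift D f x χ ∧ ∀ z ∈ D,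
    fderiv ℝ (fun y => fderiv ℝ (fun w => Real.log (expU H x χ w)) y 1) z 1 +
    fderiv ℝ (fun y => fderiv ℝ (fun w => Real.log (expU H x χ w)) y Complex.I) z Complex.I = 0

/-- `f` is homogeneous: an open part of an orbit of a connected Lie subgroup of `SL₃ℝ`, which
acts on `DP2` by the isometries `([x], [χ]) ↦ ([A x], [A⁻ᵀ χ])`.  This is expressed through the
Lie algebra `𝔞` of the subgroup: everywhere the tangent plane of `f` is the tangent space of the
orbit, that is, the space of values of the fundamental vector fields `(X x, -Xᵀ χ)`, `X ∈ 𝔞`. -/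
def IsHomogeneous (D : Set ℂ) (f : ℂ → DP2) : Prop :=
  ∃ x χ : ℂ → V3, IsLift D f x χ ∧
    ∃ 𝔞 : Submodule ℝ (Matrix (Fin 3) (Fin 3) ℝ), (∀ X ∈ 𝔞, X.trace = 0) ∧
      (∀ X ∈ 𝔞, ∀ Y ∈ 𝔞, X * Y - Y * X ∈ 𝔞) ∧
      ∀ z ∈ D, Set.range (fun v : ℂ => df x χ v z) =
        (fun X : Matrix (Fin 3) (Fin 3) ℝ => hor (x z) (χ z) (X *ᵥ x z, -(Xᵀ *ᵥ χ z))) ''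
          {X | X ∈ 𝔞}

/-! ### The real form, the automorphism, the normalized frame -/

/-- The matrix that intertwines the real form `SLR` with the standard `SL₃ℝ`. -/
def R : M3 :=
  !![1 / (Real.sqrt 2 : ℂ), 1 / (Real.sqrt 2 : ℂ), 0;
     Complex.I / (Real.sqrt 2 : ℂ), -Complex.I / (Real.sqrt 2 : ℂ), 0;
     0, 0, 1]

/-- The real form of `SL₃ℂ` isomorphic to `SL₃ℝ`: matrices `A` of determinant one for which
`R A R⁻¹` is real. -/
def SLR : Set M3 := {A | A.det = 1 ∧ ∀ i j, ((R * A * R⁻¹) i j).im = 0}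

/-- `ε = e^{iπ/3}`. -/
def eps : ℂ := Complex.exp (Complex.I * (Real.pi : ℂ) / 3)

/-- The matrix `P_H^ε`. -/
def P (H : ℝ) : M3 :=
  !![0, eps ^ 2, 0;
     eps ^ 4, 0, 0;
     0, 0, -(H : ℂ)]

/-- The automorphism `σ_H` of order six of the Lie algebra `𝔰𝔩₃ℂ`. -/
def sigma (H : ℝ) (X : M3) : M3 := -(P H * Xᵀ * P H)

/-- The eigenspace `𝔤_m` in `𝔰𝔩₃ℂ`, for the eigenvalue `ζ ^ m`, of an automorphism `κ`. -/
def gSpace (κ : M3 → M3) (ζ : ℂ) (m : ℤ) : Set M3 := {X | X.trace = 0 ∧ κ X = ζ ^ m • X}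

/-- Entrywise `∂_z` of a matrix-valued function. -/
def dz (A : ℂ → M3) (z : ℂ) : M3 := Matrix.of fun i j =>
  (fderiv ℝ (fun y => A y i j) z 1 - Complex.I * fderiv ℝ (fun y => A y i j) z Complex.I) / 2

/-- Entrywise `∂_{z̄}` of a matrix-valued function. -/
def dzbar (A : ℂ → M3) (z : ℂ) : M3 := Matrix.of fun i j =>
  (fderiv ℝ (fun y => A y i j) z 1 + Complex.I * fderiv ℝ (fun y => A y i j) z Complex.I) / 2

/-- A smooth map `D → SLR`. -/
def IsFrame (D : Set ℂ) (F : ℂ → M3) : Prop :=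
  (∀ i j, ContDiffOn ℝ ∞ (fun z => F z i j) D) ∧ ∀ z ∈ D, F z ∈ SLR

/-- `F` is primitive harmonic relative to the automorphism `κ` whose order `k` is the order of the
root of unity `ζ = e^{2πi/k}`: `F⁻¹ dF = α₋₁ dz + (α₀' dz + α₀'' dz̄) + α₁ dz̄` with `αₘ ∈ 𝔤ₘ`, and
`λ⁻¹ α₋₁ dz + α₀ + λ α₁ dz̄` is integrable for all `λ ∈ ℂˣ`. -/
def IsPrimitiveHarmonic (κ : M3 → M3) (ζ : ℂ) (D : Set ℂ) (F : ℂ → M3) : Prop :=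
  ∃ am a0' a0'' ap : ℂ → M3,
    (∀ z ∈ D, am z ∈ gSpace κ ζ (-1) ∧ a0' z ∈ gSpace κ ζ 0 ∧ a0'' z ∈ gSpace κ ζ 0 ∧
      ap z ∈ gSpace κ ζ 1 ∧
      (F z)⁻¹ * dz F z = am z + a0' z ∧ (F z)⁻¹ * dzbar F z = a0'' z + ap z) ∧
    ∀ l : ℂ, l ≠ 0 → ∀ z ∈ D,
      dz (fun y => a0'' y + l • ap y) z - dzbar (fun y => l⁻¹ • am y + a0' y) z +
        ((l⁻¹ • am z + a0' z) * (a0'' z + l • ap z) -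
          (a0'' z + l • ap z) * (l⁻¹ • am z + a0' z)) = 0

/-- `F` is primitive harmonic relative to `σ_H ^ n` (of order `6 / n`, for `n = 1, 2, 3`). -/
def IsPrimitiveHarmonicSigma (H : ℝ) (n : ℕ) (D : Set ℂ) (F : ℂ → M3) : Prop :=
  IsPrimitiveHarmonic ((sigma H)^[n]) (eps ^ n) D F

/-- `h : D → N` is a primitive harmonic map relative to `σ_H ^ n` into the homogeneous space `N`
with the canonical projection `π : SLR → N` (an orbit map): it has a primitive harmonic frame. -/
def IsPrimitiveHarmonicMap {α : Type} (H : ℝ) (n : ℕ) (N : Set α) (π : M3 → α)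
    (D : Set ℂ) (h : ℂ → α) : Prop :=
  (∀ z ∈ D, h z ∈ N) ∧
    ∃ G : ℂ → M3, IsFrame D G ∧ (∀ z ∈ D, π (G z) = h z) ∧ IsPrimitiveHarmonicSigma H n D G

/-- The complex function `c = 1 + i b / a`, where `h₁₁ = a`, `h₁₂ = b`. -/
def cFun (x χ : ℂ → V3) (z : ℂ) : ℂ :=
  1 + Complex.I * ((hForm x χ 1 Complex.I z / hForm x χ 1 1 z : ℝ) : ℂ)

/-- The first frame vector `c^{-1/2} e^{-u/2} ξ_z` with `ξ_z = (ξ(∂₁) - i ξ(∂₂)) / 2`. -/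
def frameVec (H : ℝ) (x χ : ℂ → V3) (z : ℂ) (i : Fin 3) : ℂ :=
  cFun x χ z ^ (-(1 / 2) : ℂ) / (Real.sqrt (expU H x χ z) : ℂ) *
    ((((df x χ 1 z).1 i : ℂ) - Complex.I * ((df x χ Complex.I z).1 i : ℂ)) / 2)

/-- The moving frame with columns `c^{-1/2} e^{-u/2} ξ_z`, its complex conjugate, and `x`, moved
by the constant `R⁻¹` into the real form of `GL₃ℂ` belonging to `SLR`. -/
def movingFrame (H : ℝ) (x χ : ℂ → V3) (z : ℂ) : M3 :=
  R⁻¹ * Matrix.of fun i j =>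
    ![frameVec H x χ z i, (starRingEnd ℂ) (frameVec H x χ z i), (x z i : ℂ)] j

/-- The real cube root. -/
def cbrt (t : ℝ) : ℝ := Real.sign t * |t| ^ (1 / 3 : ℝ)

/-- The normalized frame: the moving frame of the rescaled lift `(δ^{-1/3} x, δ^{1/3} χ)`, where
`δ` is the (real) determinant of the moving frame of `(x, χ)`; its determinant is one. -/
def normalizedFrame (H : ℝ) (x χ : ℂ → V3) (z : ℂ) : M3 :=
  (((cbrt (movingFrame H x χ z).det.re)⁻¹ : ℝ) : ℂ) • movingFrame H x χ z

/-! ### The homogeneous spaces and the projections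

`SLR` acts on the para-complex vector space `ℝ³ × ℝ₃` (with para-imaginary unit acting by
`(x, χ) ↦ (x, -χ)`), and on its complexification `ℂ³ × ℂ₃`, by `(x, χ) ↦ (B x, B⁻ᵀ χ)` where
`B = R A R⁻¹`. -/

/-- The real matrix `R A R⁻¹` for `A` in `SLR`. -/
def realMat (A : M3) : Matrix (Fin 3) (Fin 3) ℝ := Matrix.of fun i j => ((R * A * R⁻¹) i j).re

/-- The action on the para-complex vector space. -/
def actR (A : M3) : (V3 × V3) →ₗ[ℝ] (V3 × V3) :=
  ((realMat A).mulVecLin).prodMap (((realMat A)⁻¹)ᵀ.mulVecLin)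

/-- The action on the complexified para-complex vector space. -/
def actC (A : M3) :
    ((Fin 3 → ℂ) × (Fin 3 → ℂ)) →ₗ[ℂ] ((Fin 3 → ℂ) × (Fin 3 → ℂ)) :=
  ((R * A * R⁻¹).mulVecLin).prodMap (((R * A * R⁻¹)⁻¹)ᵀ.mulVecLin)

/-- The base point `e₃` of the quadric. -/
def basePt : V3 × V3 := (Pi.single 2 1, Pi.single 2 1)

/-- The base Lagrangian subspace: the graph of `diag (-H, -H, 1)`.  It is `span {e₁, e₂, e₃}` if
`H = -1` and `span {i'e₁, i'e₂, e₃}` if `H = 1`, with `i'` the para-imaginary unit. -/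
def baseLagr (H : ℝ) : Submodule ℝ (V3 × V3) :=
  LinearMap.graph (Matrix.diagonal ![-H, -H, 1]).mulVecLin

/-- The special Lagrangian Grassmannian: the orbit of the base Lagrangian subspace.  (Elements of
`SLR` that preserve the base subspace preserve its orientation, so that oriented and unoriented
special Lagrangian subspaces are the same.) -/
def SLGr (H : ℝ) : Set (Submodule ℝ (V3 × V3)) := (fun A => (baseLagr H).map (actR A)) '' SLR

/-- Pairs of a point of the quadric and a special Lagrangian subspace through it. -/
def FL1 (H : ℝ) : Set ((V3 × V3) × Submodule ℝ (V3 × V3)) :=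
  {p | p.1 ∈ CM ∧ p.1 ∈ p.2 ∧ p.2 ∈ SLGr H}

/-- The projection of `SLR` onto `FL1`. -/
def pi1 (H : ℝ) (A : M3) : (V3 × V3) × Submodule ℝ (V3 × V3) :=
  (actR A basePt, (baseLagr H).map (actR A))

/-- Sequences of four subspaces of the complexified para-complex vector space. -/
abbrev Flag := Fin 4 → Submodule ℂ ((Fin 3 → ℂ) × (Fin 3 → ℂ))

/-- The vector `R e_j`, the `j`-th basis vector adapted to `SLR`: `R e_1` is the complex conjugate
of `R e_0`, and `R e_2 = e_2` (indices start at zero). -/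
def adapted (j : Fin 3) : Fin 3 → ℂ := R *ᵥ Pi.single j 1

/-- The para-complex line (over the complexified para-complex numbers) of a vector `v` of `ℂ³`. -/
def pcLine (v : Fin 3 → ℂ) : Submodule ℂ ((Fin 3 → ℂ) × (Fin 3 → ℂ)) :=
  Submodule.span ℂ {(v, 0), (0, v)}

/-- The base para-complex flag. -/
def baseFlag : Flag := ![⊥, pcLine (adapted 2), pcLine (adapted 2) ⊔ pcLine (adapted 1), ⊤]

/-- The projection of `SLR` onto the special para-complex flags over points of the quadric. -/
def pi2 (A : M3) : (V3 × V3) × Flag := (actR A basePt, fun j => (baseFlag j).map (actC A))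

/-- The homogeneous space of special regular para-complex flags over points of the quadric: the
pairs `(w, W)` where `W₁` is the para-complex line of `w` and `W₁ ⊂ W₂` is the flag of an oriented
orthogonal frame adapted to `SLR`, that is, the image of the base pair under an element of
`SLR`. -/
def FL2 : Set ((V3 × V3) × Flag) := pi2 '' SLR

/-- The homogeneous space of the regular para-complex flags that occur in `FL2`. -/
def Fl2 : Set Flag := (fun A => (pi2 A).2) '' SLR

/-- The projection of `SLR` onto `FL3`. -/
def pi3 (H : ℝ) (A : M3) : M3 := A * P H * Aᵀ

/-- The homogeneous space of the matrices `U P Uᵀ`. -/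
def FL3 (H : ℝ) : Set M3 := pi3 H '' SLR

/-- The projection of `FL3` onto `SLGrT`: it maps `U P Uᵀ` to `U (P Pᵀ P) Uᵀ`. -/
def projLagr (S : M3) : M3 := S * Sᵀ⁻¹ * S

/-- The projection of `FL3` onto `Fl2T`: it maps `U P Uᵀ` to `U (P Pᵀ) U⁻¹`. -/
def projFlag (S : M3) : M3 := S * Sᵀ⁻¹

/-- The orbit map of `SLGrT`. -/
def piLagrT (H : ℝ) (A : M3) : M3 := A * (P H * (P H)ᵀ * P H) * Aᵀ

/-- The orbit map of `Fl2T`. -/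
def piFlagT (H : ℝ) (A : M3) : M3 := A * (P H * (P H)ᵀ) * A⁻¹

/-- The matrix model of the special Lagrangian Grassmannian. -/
def SLGrT (H : ℝ) : Set M3 := piLagrT H '' SLR

/-- The matrix model of the flag manifold. -/
def Fl2T (H : ℝ) : Set M3 := piFlagT H '' SLR

end RuhVilms

end

noncomputable section

namespace RuhVilms

open scoped ComplexConjugate

/-! ### Wirtinger derivatives -/

/-! All statements become statements about five functions. For the lift of determinant one, put `M =
R 𝓕`. Its logarithmic derivative `M⁻¹ M_z` is the matrix `mcZ` in coefficients `p, q, A, B` and `t =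
c^{1/2} e^{u/2}`, and `M⁻¹ M_z̄` is the conjugate matrix with the first two basis vectors
interchanged. The Maurer–Cartan equation gives `StructureEqs`. Since `t² = c e^u` and `Re t > 0`,
the immersion is Lagrangian exactly when `t` is real. The trace of the second fundamental form has
frame coordinates proportional to `A t̄` and its conjugate, so the immersion is minimal exactly when
`A = 0` (`IsConformal.lagrangian_iff`, `IsConformal.minimal_iff`).

The Gauss maps reduce to frames. Two frames with the same image differ by a map into the stabilizer
of the base point, the stabilizer is fixed by the automorphism, and primitive harmonicity is
invariant under such gauges (`IsPrimitiveHarmonic.gauge`, `isPrimitiveHarmonicMap_iff`).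

For the orders six and three, the eigenvalues `ζ`, `ζ⁻¹`, `1` are distinct. The three components of
the curvature of the family lie in different eigenspaces and their sum is the Maurer–Cartan
expression, so the integrability is automatic and only the algebraic type of the form matters
(`isPrimitiveHarmonic_iff_decomposes`). The entry `A` sits in `𝔤₁`, which forces `A = 0`. For the
order six, `t` must be real as well, and `p + q = 0` then follows from the structure equations.

For the order two, `𝔤₁ = 𝔤₋₁` and the algebraic type is no condition; the content is the
integrability, which amounts to `SymmetricEqs` (`isFlatFamily_iff_symmetricEqs`). There `t` is real,
`A` is `3/2` times the conjugate of `p + q`, and `|p + q|² = k t²` for a constant `k`. If `k = 0`,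
then `A = 0` and the immersion is minimal Lagrangian. Otherwise `p + q` vanishes nowhere, which
makes the metric flat, and the explicit fields `symField` integrate to an abelian algebra of
infinitesimal isometries that is transitive on the surface.

Conversely, let a flat immersion be homogeneous. A fundamental vector field is given by a
holomorphic function, its infinitesimal rotation is constant, and brackets have rotation zero. So
the fields without rotation at a given point still realize all tangent vectors there
(`AdaptedFrame.exists_direction`). Inserting them in the equations of the frame and comparing the
coefficients of `v` and `v̄` gives `SymmetricEqs`. -/

/-- The operator `(∂₁ + θ ∂₂) / 2`; it is `∂_z` for `θ = -i` and `∂_{z̄}` for `θ = i`. -/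
def wd (θ : ℂ) (g : ℂ → ℂ) (z : ℂ) : ℂ := (fderiv ℝ g z 1 + θ * fderiv ℝ g z Complex.I) / 2

section scalar
variable {θ : ℂ} {g k : ℂ → ℂ} {z : ℂ}

lemma wd_congr (h : g =ᶠ[nhds z] k) : wd θ g z = wd θ k z := by
  unfold wd; rw [h.fderiv_eq]

lemma wd_congr_on {D : Set ℂ} (hD : IsOpen D) (h : ∀ y ∈ D, g y = k y) (hz : z ∈ D) :
    wd θ g z = wd θ k z :=
  wd_congr (Filter.eventuallyEq_of_mem (hD.mem_nhds hz) h)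

lemma wd_const (c : ℂ) : wd θ (fun _ => c) z = 0 := by simp [wd]

lemma wd_add (hg : DifferentiableAt ℝ g z) (hk : DifferentiableAt ℝ k z) :
    wd θ (fun y => g y + k y) z = wd θ g z + wd θ k z := by
  unfold wd
  rw [fderiv_fun_add hg hk]; simp; ring

lemma wd_sub (hg : DifferentiableAt ℝ g z) (hk : DifferentiableAt ℝ k z) :
    wd θ (fun y => g y - k y) z = wd θ g z - wd θ k z := by
  unfold wd
  rw [fderiv_fun_sub hg hk]; simp; ring

lemma wd_neg : wd θ (fun y => - g y) z = - wd θ g z := by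
  unfold wd
  rw [fderiv_fun_neg]; simp; ring

lemma wd_mul (hg : DifferentiableAt ℝ g z) (hk : DifferentiableAt ℝ k z) :
    wd θ (fun y => g y * k y) z = wd θ g z * k z + g z * wd θ k z := by
  unfold wd
  rw [fderiv_fun_mul hg hk]; simp; ring

lemma wd_const_mul (c : ℂ) (hk : DifferentiableAt ℝ k z) :
    wd θ (fun y => c * k y) z = c * wd θ k z := by
  rw [wd_mul (differentiableAt_const c) hk, wd_const]; ring

lemma wd_sum {ι : Type*} (s : Finset ι) {G : ι → ℂ → ℂ}
    (hG : ∀ i ∈ s, DifferentiableAt ℝ (G i) z) :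
    wd θ (fun y => ∑ i ∈ s, G i y) z = ∑ i ∈ s, wd θ (G i) z := by
  unfold wd
  rw [fderiv_fun_sum hG]
  simp [Finset.sum_add_distrib, Finset.mul_sum, Finset.sum_div, add_div]

lemma wd_conj (hg : DifferentiableAt ℝ g z) :
    wd θ (fun y => (starRingEnd ℂ) (g y)) z = (starRingEnd ℂ) (wd ((starRingEnd ℂ) θ) g z) := by
  have h : HasFDerivAt (fun y => (starRingEnd ℂ) (g y))
      ((Complex.conjCLE : ℂ →L[ℝ] ℂ).comp (fderiv ℝ g z)) z :=
    (Complex.conjCLE : ℂ →L[ℝ] ℂ).hasFDerivAt.comp z hg.hasFDerivAt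
  unfold wd
  rw [h.fderiv]; simp [map_ofNat]

/-- `g` is differentiable at `z` with Wirtinger derivative `d`. -/
def HasWd (θ : ℂ) (g : ℂ → ℂ) (d : ℂ) (z : ℂ) : Prop := DifferentiableAt ℝ g z ∧ wd θ g z = d

section HasWd
variable {d e : ℂ}

lemma hasWd (hg : DifferentiableAt ℝ g z) : HasWd θ g (wd θ g z) z := ⟨hg, rfl⟩

lemma HasWd.add (hg : HasWd θ g d z) (hk : HasWd θ k e z) :
    HasWd θ (fun y => g y + k y) (d + e) z :=
  ⟨hg.1.add hk.1, by rw [wd_add hg.1 hk.1, hg.2, hk.2]⟩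

lemma HasWd.sub (hg : HasWd θ g d z) (hk : HasWd θ k e z) :
    HasWd θ (fun y => g y - k y) (d - e) z :=
  ⟨hg.1.sub hk.1, by rw [wd_sub hg.1 hk.1, hg.2, hk.2]⟩

lemma HasWd.neg (hg : HasWd θ g d z) : HasWd θ (fun y => -g y) (-d) z :=
  ⟨hg.1.neg, by rw [wd_neg, hg.2]⟩

lemma HasWd.mul (hg : HasWd θ g d z) (hk : HasWd θ k e z) :
    HasWd θ (fun y => g y * k y) (d * k z + g z * e) z :=
  ⟨hg.1.mul hk.1, by rw [wd_mul hg.1 hk.1, hg.2, hk.2]⟩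

lemma HasWd.const_mul (c : ℂ) (hk : HasWd θ k e z) :
    HasWd θ (fun y => c * k y) (c * e) z :=
  ⟨hk.1.const_mul c, by rw [wd_const_mul c hk.1, hk.2]⟩

lemma HasWd.conj (hg : HasWd ((starRingEnd ℂ) θ) g d z) :
    HasWd θ (fun y => (starRingEnd ℂ) (g y)) ((starRingEnd ℂ) d) z :=
  ⟨Complex.conjCLE.differentiableAt.comp z hg.1, by rw [wd_conj hg.1, hg.2]⟩

end HasWd

/-- The two Wirtinger derivatives together carry the whole real differential; constancy arguments
below rest on this. -/
lemma fderiv_eq_wd (v : ℂ) :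
    fderiv ℝ g z v = wd (-Complex.I) g z * v + wd Complex.I g z * (starRingEnd ℂ) v := by
  have h : v = v.re • (1 : ℂ) + v.im • Complex.I := by
    simp [Complex.re_add_im]
  have h2 : fderiv ℝ g z v
      = v.re • fderiv ℝ g z 1 + v.im • fderiv ℝ g z Complex.I := by
    conv_lhs => rw [h]
    rw [map_add, map_smul, map_smul]
  rw [h2]
  unfold wd
  have h3 : (starRingEnd ℂ) v = v.re - v.im * Complex.I := by
    apply Complex.ext <;> simp
  have h4 : v = v.re + v.im * Complex.I := (Complex.re_add_im v).symm
  rw [h3]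
  nth_rewrite 3 [h4]
  simp only [Complex.real_smul]
  linear_combination (v.im * fderiv ℝ g z Complex.I) * Complex.I_mul_I

lemma fderiv_eq_zero_of_wd (h1 : wd (-Complex.I) g z = 0) (h2 : wd Complex.I g z = 0) :
    fderiv ℝ g z = 0 := by
  ext
  all_goals simp [fderiv_eq_wd, h1, h2]

end scalar

section smooth
variable {D : Set ℂ} {g k : ℂ → ℂ} {z : ℂ}

lemma diffAt_of_smooth (hD : IsOpen D) {E : Type*} [NormedAddCommGroup E] [NormedSpace ℝ E]
    {g : ℂ → E} (hg : ContDiffOn ℝ ∞ g D) (hz : z ∈ D) :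
    DifferentiableAt ℝ g z :=
  (hg.contDiffAt (hD.mem_nhds hz)).differentiableAt (by simp)

lemma smooth_fderiv (hD : IsOpen D) {E : Type*} [NormedAddCommGroup E] [NormedSpace ℝ E]
    {g : ℂ → E} (hg : ContDiffOn ℝ ∞ g D) (v : ℂ) :
    ContDiffOn ℝ ∞ (fun y => fderiv ℝ g y v) D :=
  (hg.fderiv_of_isOpen hD (m := ∞) (by simp)).clm_apply contDiffOn_const

lemma smooth_wd (hD : IsOpen D) (hg : ContDiffOn ℝ ∞ g D) (θ : ℂ) :
    ContDiffOn ℝ ∞ (wd θ g) D := by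
  unfold wd
  exact ((smooth_fderiv hD hg 1).add (contDiffOn_const.mul (smooth_fderiv hD hg _))).div_const 2

lemma smooth_conj (hg : ContDiffOn ℝ ∞ g D) :
    ContDiffOn ℝ ∞ (fun y => (starRingEnd ℂ) (g y)) D :=
  Complex.conjCLE.contDiff.comp_contDiffOn hg

lemma fderiv_fderiv_comm (hD : IsOpen D) {E : Type*} [NormedAddCommGroup E] [NormedSpace ℝ E]
    {g : ℂ → E} (hg : ContDiffOn ℝ ∞ g D) (hz : z ∈ D) (v w : ℂ) :
    fderiv ℝ (fun y => fderiv ℝ g y v) z w = fderiv ℝ (fun y => fderiv ℝ g y w) z v := by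
  have hs : IsSymmSndFDerivAt ℝ g z :=
    (hg.contDiffAt (hD.mem_nhds hz)).isSymmSndFDerivAt (by simp; exact WithTop.coe_le_coe.mpr le_top)
  have hd : DifferentiableAt ℝ (fderiv ℝ g) z :=
    diffAt_of_smooth hD (hg.fderiv_of_isOpen hD (m := ∞) (by simp)) hz
  have key : ∀ v w : ℂ, fderiv ℝ (fun y => fderiv ℝ g y v) z w = fderiv ℝ (fderiv ℝ g) z w v := by
    intro v w
    rw [fderiv_clm_apply hd (differentiableAt_const v)]
    simp
  rw [key, key, hs.eq]

/-- The operators have constant coefficients, so only the symmetry of the second real derivative is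
needed. -/
lemma wd_comm (hD : IsOpen D) (hg : ContDiffOn ℝ ∞ g D) (hz : z ∈ D) (θ θ' : ℂ) :
    wd θ (wd θ' g) z = wd θ' (wd θ g) z := by
  have h1 := diffAt_of_smooth hD (smooth_fderiv hD hg 1) hz
  have hI := diffAt_of_smooth hD (smooth_fderiv hD hg Complex.I) hz
  have key : ∀ θ θ' : ℂ, wd θ (wd θ' g) z
      = (wd θ (fun y => fderiv ℝ g y 1) z + θ' * wd θ (fun y => fderiv ℝ g y Complex.I) z) / 2 := by
    intro θ θ'
    have : wd θ' g = fun y => (1 / 2 : ℂ) * (fderiv ℝ g y 1 + θ' * fderiv ℝ g y Complex.I) := by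
      funext y; unfold wd; ring
    rw [this, wd_const_mul (k := fun y => fderiv ℝ g y 1 + θ' * fderiv ℝ g y Complex.I) _
        (h1.add (hI.const_mul θ')), wd_add h1 (hI.const_mul θ'),
      wd_const_mul _ hI]
    ring
  rw [key, key]
  unfold wd
  rw [fderiv_fderiv_comm hD hg hz 1 Complex.I]
  ring

end smooth

/-! ### Wirtinger derivatives of matrices -/

/-- The entrywise Wirtinger derivative. -/
def mwd (θ : ℂ) (A : ℂ → M3) (z : ℂ) : M3 := Matrix.of fun i j => wd θ (fun y => A y i j) z

lemma mwd_apply (θ : ℂ) (A : ℂ → M3) (z : ℂ) (i j : Fin 3) :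
    mwd θ A z i j = wd θ (fun y => A y i j) z := rfl

lemma dz_eq (A : ℂ → M3) (z : ℂ) : dz A z = mwd (-Complex.I) A z := by
  ext i j; simp [dz, mwd, wd, sub_eq_add_neg]

lemma dzbar_eq (A : ℂ → M3) (z : ℂ) : dzbar A z = mwd Complex.I A z := by
  ext i j; simp [dzbar, mwd, wd]

/-- Entrywise smoothness. -/
def MSmooth (D : Set ℂ) (A : ℂ → M3) : Prop := ∀ i j, ContDiffOn ℝ ∞ (fun z => A z i j) D

section matrix
variable {D : Set ℂ} {A B : ℂ → M3} {z : ℂ} {θ : ℂ}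

lemma MSmooth.const (C : M3) : MSmooth D (fun _ => C) := fun _ _ => contDiffOn_const

lemma MSmooth.add (hA : MSmooth D A) (hB : MSmooth D B) : MSmooth D (fun y => A y + B y) :=
  fun i j => (hA i j).add (hB i j)

lemma MSmooth.sub (hA : MSmooth D A) (hB : MSmooth D B) : MSmooth D (fun y => A y - B y) :=
  fun i j => (hA i j).sub (hB i j)

lemma MSmooth.smul (c : ℂ) (hA : MSmooth D A) : MSmooth D (fun y => c • A y) :=
  fun i j => contDiffOn_const.mul (hA i j)

lemma MSmooth.transpose (hA : MSmooth D A) : MSmooth D (fun y => (A y)ᵀ) :=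
  fun i j => hA j i

lemma MSmooth.mul (hA : MSmooth D A) (hB : MSmooth D B) : MSmooth D (fun y => A y * B y) := by
  intro i j
  simp only [Matrix.mul_apply]
  exact ContDiffOn.sum fun k _ => (hA i k).mul (hB k j)

lemma MSmooth.congr (hA : MSmooth D A) (h : ∀ y ∈ D, B y = A y) : MSmooth D B :=
  fun i j => (hA i j).congr fun y hy => by rw [h y hy]

lemma MSmooth.mwd (hD : IsOpen D) (hA : MSmooth D A) (θ : ℂ) : MSmooth D (mwd θ A) :=
  fun i j => smooth_wd hD (hA i j) θ

lemma MSmooth.diffAt (hD : IsOpen D) (hA : MSmooth D A) (hz : z ∈ D) (i j : Fin 3) :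
    DifferentiableAt ℝ (fun y => A y i j) z := diffAt_of_smooth hD (hA i j) hz

lemma mwd_congr_on (hD : IsOpen D) (h : ∀ y ∈ D, A y = B y) (hz : z ∈ D) :
    mwd θ A z = mwd θ B z := by
  ext i j
  exact wd_congr_on hD (fun y hy => by rw [h y hy]) hz

lemma mwd_const (C : M3) : mwd θ (fun _ => C) z = 0 := by
  ext i j; simp [mwd_apply, wd_const]

lemma mwd_add (hD : IsOpen D) (hA : MSmooth D A) (hB : MSmooth D B) (hz : z ∈ D) :
    mwd θ (fun y => A y + B y) z = mwd θ A z + mwd θ B z := by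
  ext i j; exact wd_add (hA.diffAt hD hz i j) (hB.diffAt hD hz i j)

lemma mwd_smul (hD : IsOpen D) (c : ℂ) (hA : MSmooth D A) (hz : z ∈ D) :
    mwd θ (fun y => c • A y) z = c • mwd θ A z := by
  ext i j; exact wd_const_mul c (hA.diffAt hD hz i j)

lemma mwd_mul (hD : IsOpen D) (hA : MSmooth D A) (hB : MSmooth D B) (hz : z ∈ D) :
    mwd θ (fun y => A y * B y) z = mwd θ A z * B z + A z * mwd θ B z := by
  ext i j
  simp only [mwd_apply, Matrix.mul_apply, Matrix.add_apply]
  rw [wd_sum (G := fun k y => A y i k * B y k j) _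
      fun k _ => (hA.diffAt hD hz i k).mul (hB.diffAt hD hz k j),
    ← Finset.sum_add_distrib]
  exact Finset.sum_congr rfl fun k _ => wd_mul (hA.diffAt hD hz i k) (hB.diffAt hD hz k j)

lemma mwd_const_mul (hD : IsOpen D) (C : M3) (hB : MSmooth D B) (hz : z ∈ D) :
    mwd θ (fun y => C * B y) z = C * mwd θ B z := by
  rw [mwd_mul hD (MSmooth.const C) hB hz, mwd_const]; simp

lemma mwd_mul_const (hD : IsOpen D) (C : M3) (hB : MSmooth D B) (hz : z ∈ D) :
    mwd θ (fun y => B y * C) z = mwd θ B z * C := by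
  rw [mwd_mul hD hB (MSmooth.const C) hz, mwd_const]; simp

lemma mwd_comm (hD : IsOpen D) (hA : MSmooth D A) (hz : z ∈ D) (θ θ' : ℂ) :
    mwd θ (mwd θ' A) z = mwd θ' (mwd θ A) z := by
  ext i j; exact wd_comm hD (hA i j) hz θ θ'

lemma MSmooth.det (hA : MSmooth D A) : ContDiffOn ℝ ∞ (fun y => (A y).det) D := by
  simp only [Matrix.det_apply]
  exact ContDiffOn.sum fun σ _ =>
    (contDiffOn_prod fun i _ => hA (σ i) i).const_smul ((Equiv.Perm.sign σ : ℤ))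

lemma MSmooth.adjugate (hA : MSmooth D A) : MSmooth D (fun y => (A y).adjugate) := by
  intro i j
  simp only [Matrix.adjugate_apply]
  refine MSmooth.det (A := fun y => (A y).updateRow j (Pi.single i 1)) fun a b => ?_
  by_cases h : a = j
  · subst h; simpa using contDiffOn_const
  · simpa [Matrix.updateRow_ne h] using hA a b

lemma MSmooth.inv (hA : MSmooth D A) (h0 : ∀ y ∈ D, (A y).det ≠ 0) :
    MSmooth D (fun y => (A y)⁻¹) := by
  intro i j
  have h := (hA.det.inv h0).mul (hA.adjugate i j)
  refine h.congr fun y _ => ?_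
  simp [Matrix.inv_def]

lemma mwd_inv (hD : IsOpen D) (hA : MSmooth D A) (h0 : ∀ y ∈ D, (A y).det ≠ 0) (hz : z ∈ D) :
    mwd θ (fun y => (A y)⁻¹) z = -((A z)⁻¹ * mwd θ A z * (A z)⁻¹) := by
  have h1 : mwd θ (fun y => (A y)⁻¹ * A y) z = 0 := by
    rw [mwd_congr_on hD (B := fun _ => 1) (fun y hy => Matrix.nonsing_inv_mul _
      (isUnit_iff_ne_zero.mpr (h0 y hy))) hz, mwd_const]
  rw [mwd_mul hD (hA.inv h0) hA hz] at h1
  have h2 : A z * (A z)⁻¹ = 1 := Matrix.mul_nonsing_inv _ (isUnit_iff_ne_zero.mpr (h0 z hz))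
  calc _ = (mwd θ (fun y => (A y)⁻¹) z * A z + (A z)⁻¹ * mwd θ A z) * (A z)⁻¹
        - (A z)⁻¹ * mwd θ A z * (A z)⁻¹ := by
        rw [add_mul, mul_assoc, h2]; simp
    _ = _ := by rw [h1]; simp

/-- Jacobi's formula for a matrix function of constant determinant. -/
lemma trace_inv_mul_mwd (hD : IsOpen D) (hA : MSmooth D A) {c : ℂ}
    (h : ∀ y ∈ D, (A y).det = c) (hz : z ∈ D) : ((A z)⁻¹ * mwd θ A z).trace = 0 := by
  have h1 : wd θ (fun y => (A y).det) z = 0 := by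
    rw [wd_congr_on hD (k := fun _ => c) h hz, wd_const]
  have hd : ∀ i j, HasWd θ (fun y => A y i j) (mwd θ A z i j) z :=
    fun i j => ⟨hA.diffAt hD hz i j, rfl⟩
  have h3 : ∀ i j k l m n, HasWd θ (fun y => A y i j * A y k l * A y m n) _ z :=
    fun i j k l m n => ((hd i j).mul (hd k l)).mul (hd m n)
  -- The product rule for the six signed monomials, in the order of `Matrix.det_fin_three`.
  have h4 := ((((((h3 0 0 1 1 2 2).sub (h3 0 0 1 2 2 1)).sub (h3 0 1 1 0 2 2)).add
    (h3 0 1 1 2 2 0)).add (h3 0 2 1 0 2 1)).sub (h3 0 2 1 1 2 0)).2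
  simp only [Matrix.det_fin_three] at h1
  rw [h4] at h1
  have h2 : ((A z).adjugate * mwd θ A z).trace = 0 := by
    rw [← h1]
    simp only [Matrix.trace_fin_three, Matrix.mul_apply, Fin.sum_univ_three,
      Matrix.adjugate_fin_three]
    simp
    ring
  rw [Matrix.inv_def, Matrix.smul_mul, Matrix.trace_smul, h2, smul_zero]

end matrix

/-- The compatibility condition of a smooth frame. -/
lemma maurer_cartan {D : Set ℂ} (hD : IsOpen D) {A : ℂ → M3} (hA : MSmooth D A)
    (h0 : ∀ y ∈ D, (A y).det ≠ 0) {z : ℂ} (hz : z ∈ D) (θ θ' : ℂ) :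
    mwd θ (fun y => (A y)⁻¹ * mwd θ' A y) z - mwd θ' (fun y => (A y)⁻¹ * mwd θ A y) z +
      ((A z)⁻¹ * mwd θ A z * ((A z)⁻¹ * mwd θ' A z)
        - (A z)⁻¹ * mwd θ' A z * ((A z)⁻¹ * mwd θ A z)) = 0 := by
  rw [mwd_mul hD (hA.inv h0) (hA.mwd hD θ') hz, mwd_mul hD (hA.inv h0) (hA.mwd hD θ) hz,
    mwd_inv hD hA h0 hz, mwd_inv hD hA h0 hz, mwd_comm hD hA hz θ θ']
  noncomm_ring

/-! ### Independence of the lift -/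

/-- `(x', χ') = (α x, α⁻¹ χ)` for a smooth nowhere vanishing function `α`. -/
structure Rescaled (D : Set ℂ) (α : ℂ → ℝ) (x χ x' χ' : ℂ → V3) : Prop where
  smooth : ContDiffOn ℝ ∞ α D
  ne_zero : ∀ z ∈ D, α z ≠ 0
  fst : ∀ z ∈ D, x' z = α z • x z
  snd : ∀ z ∈ D, χ' z = (α z)⁻¹ • χ z

lemma smooth_dot {D : Set ℂ} {x y : ℂ → V3} (hx : ContDiffOn ℝ ∞ x D) (hy : ContDiffOn ℝ ∞ y D) :
    ContDiffOn ℝ ∞ (fun z => x z ⬝ᵥ y z) D := by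
  simp only [dotProduct]
  exact ContDiffOn.sum fun i _ => (contDiffOn_pi.mp hx i).mul (contDiffOn_pi.mp hy i)

/-- Representatives of the same points are proportional, and both pairings equal one, so the two
factors are inverse to each other. Writing the factor as the pairing of `x'` with `χ` shows that it
is smooth. -/
lemma rescaled_of_isLift {D : Set ℂ} {f : ℂ → DP2} {x χ x' χ' : ℂ → V3}
    (h : IsLift D f x χ) (h' : IsLift D f x' χ') : ∃ α, Rescaled D α x χ x' χ' := by
  have key : ∀ z ∈ D, x' z ⬝ᵥ χ z ≠ 0 ∧ x' z = (x' z ⬝ᵥ χ z) • x z ∧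
      χ' z = (x' z ⬝ᵥ χ z)⁻¹ • χ z := by
    intro z hz
    obtain ⟨hx, hχ, e⟩ := h.proj z hz
    obtain ⟨hx', hχ', e'⟩ := h'.proj z hz
    rw [e, Prod.mk.injEq, Projectivization.mk_eq_mk_iff', Projectivization.mk_eq_mk_iff'] at e'
    obtain ⟨⟨a, ha⟩, ⟨b, hb⟩⟩ := e'
    have q : x z ⬝ᵥ χ z = 1 := h.mem_quadric z hz
    have q' : x' z ⬝ᵥ χ' z = 1 := h'.mem_quadric z hz
    have hab : a * b = 1 := by
      rw [← ha, ← hb, smul_dotProduct, dotProduct_smul, q'] at q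
      simpa using q
    have ha0 : a ≠ 0 := left_ne_zero_of_mul_eq_one hab
    have hb0 : b ≠ 0 := right_ne_zero_of_mul_eq_one hab
    have h1 : x' z = b • x z := by
      rw [← ha, smul_smul, mul_comm, hab, one_smul]
    have h2 : χ' z = b⁻¹ • χ z := by
      rw [← hb, smul_smul, inv_mul_cancel₀ hb0, one_smul]
    have h3 : x' z ⬝ᵥ χ z = b := by rw [h1, smul_dotProduct, q]; simp
    rw [h3]
    exact ⟨hb0, h1, h2⟩
  exact ⟨fun z => x' z ⬝ᵥ χ z, smooth_dot h'.smooth_fst h.smooth_snd,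
    fun z hz => (key z hz).1, fun z hz => (key z hz).2.1, fun z hz => (key z hz).2.2⟩

lemma Rescaled.isLift {D : Set ℂ} {f : ℂ → DP2} {α : ℂ → ℝ} {x χ x' χ' : ℂ → V3}
    (r : Rescaled D α x χ x' χ') (h : IsLift D f x χ) : IsLift D f x' χ' where
  smooth_fst := (r.smooth.smul h.smooth_fst).congr r.fst
  smooth_snd := ((r.smooth.inv r.ne_zero).smul h.smooth_snd).congr r.snd
  mem_quadric := fun z hz => by
    have q : x z ⬝ᵥ χ z = 1 := h.mem_quadric z hz
    have h0 := r.ne_zero z hz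
    change x' z ⬝ᵥ χ' z = 1
    rw [r.fst z hz, r.snd z hz, smul_dotProduct, dotProduct_smul, q]
    simp [h0]
  proj := fun z hz => by
    obtain ⟨hx, hχ, e⟩ := h.proj z hz
    have h0 := r.ne_zero z hz
    have hx' : x' z ≠ 0 := by rw [r.fst z hz]; exact smul_ne_zero h0 hx
    have hχ' : χ' z ≠ 0 := by rw [r.snd z hz]; exact smul_ne_zero (inv_ne_zero h0) hχ
    refine ⟨hx', hχ', ?_⟩
    rw [e, Prod.mk.injEq, Projectivization.mk_eq_mk_iff', Projectivization.mk_eq_mk_iff']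
    refine ⟨⟨(α z)⁻¹, ?_⟩, ⟨α z, ?_⟩⟩
    · rw [r.fst z hz, smul_smul, inv_mul_cancel₀ h0, one_smul]
    · rw [r.snd z hz, smul_smul, mul_inv_cancel₀ h0, one_smul]

section rescaled
variable {D : Set ℂ} {α : ℂ → ℝ} {x χ x' χ' : ℂ → V3}

lemma Rescaled.symm (r : Rescaled D α x χ x' χ') :
    Rescaled D (fun z => (α z)⁻¹) x' χ' x χ where
  smooth := r.smooth.inv r.ne_zero
  ne_zero := fun z hz => inv_ne_zero (r.ne_zero z hz)
  fst := fun z hz => by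
    rw [r.fst z hz, smul_smul, inv_mul_cancel₀ (r.ne_zero z hz), one_smul]
  snd := fun z hz => by
    rw [r.snd z hz, smul_smul, inv_inv, mul_inv_cancel₀ (r.ne_zero z hz), one_smul]

lemma fderiv_smul_eq {β : ℂ → ℝ} {y y' : ℂ → V3} (hD : IsOpen D)
    (hβ : ContDiffOn ℝ ∞ β D) (hy : ContDiffOn ℝ ∞ y D) (h : ∀ z ∈ D, y' z = β z • y z)
    {z : ℂ} (hz : z ∈ D) (v : ℂ) :
    fderiv ℝ y' z v = β z • fderiv ℝ y z v + fderiv ℝ β z v • y z := by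
  rw [(Filter.eventuallyEq_of_mem (hD.mem_nhds hz) h : y' =ᶠ[nhds z] fun z => β z • y z).fderiv_eq,
    fderiv_fun_smul (diffAt_of_smooth hD hβ hz) (diffAt_of_smooth hD hy hz)]
  simp

lemma fderiv_inv_eq (hD : IsOpen D) (hα : ContDiffOn ℝ ∞ α D) {z : ℂ} (hz : z ∈ D)
    (h0 : α z ≠ 0) (v : ℂ) :
    fderiv ℝ (fun y => (α y)⁻¹) z v = -((α z)⁻¹ * (α z)⁻¹ * fderiv ℝ α z v) := by
  have h := ((hasDerivAt_inv h0).comp_hasFDerivAt z (diffAt_of_smooth hD hα hz).hasFDerivAt).fderiv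
  have h2 : fderiv ℝ (fun y => (α y)⁻¹) z = -(α z ^ 2)⁻¹ • fderiv ℝ α z := h
  rw [h2]
  simp [sq]

/-- A smooth map into the quadric. -/
structure IsQuadricMap (D : Set ℂ) (x χ : ℂ → V3) : Prop where
  smooth_fst : ContDiffOn ℝ ∞ x D
  smooth_snd : ContDiffOn ℝ ∞ χ D
  dot_eq_one : ∀ z ∈ D, x z ⬝ᵥ χ z = 1

lemma IsLift.isQuadricMap {f : ℂ → DP2} (h : IsLift D f x χ) : IsQuadricMap D x χ :=
  ⟨h.smooth_fst, h.smooth_snd, h.mem_quadric⟩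

lemma fderiv_dot (hD : IsOpen D) {x χ : ℂ → V3} (hx : ContDiffOn ℝ ∞ x D)
    (hχ : ContDiffOn ℝ ∞ χ D) {z : ℂ} (hz : z ∈ D) (v : ℂ) :
    fderiv ℝ (fun y => x y ⬝ᵥ χ y) z v = fderiv ℝ x z v ⬝ᵥ χ z + x z ⬝ᵥ fderiv ℝ χ z v := by
  have h1 := hasFDerivAt_pi'.mp (diffAt_of_smooth hD hx hz).hasFDerivAt
  have h2 := hasFDerivAt_pi'.mp (diffAt_of_smooth hD hχ hz).hasFDerivAt
  have h3 : HasFDerivAt (fun y => x y ⬝ᵥ χ y) _ z :=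
    HasFDerivAt.fun_sum (u := Finset.univ) fun i _ => (h1 i).mul (h2 i)
  rw [h3.fderiv]
  simp [dotProduct, Fin.sum_univ_three]
  ring

lemma IsQuadricMap.fderiv_snd (hD : IsOpen D) (h : IsQuadricMap D x χ) {z : ℂ} (hz : z ∈ D)
    (v : ℂ) : x z ⬝ᵥ fderiv ℝ χ z v = -psi x χ v z := by
  have h1 : fderiv ℝ (fun y => x y ⬝ᵥ χ y) z v = 0 := by
    rw [(Filter.eventuallyEq_of_mem (hD.mem_nhds hz) h.dot_eq_one :
      (fun y => x y ⬝ᵥ χ y) =ᶠ[nhds z] fun _ => 1).fderiv_eq]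
    simp
  rw [fderiv_dot hD h.smooth_fst h.smooth_snd hz] at h1
  unfold psi; linarith

lemma IsQuadricMap.df_eq (hD : IsOpen D) (h : IsQuadricMap D x χ) {z : ℂ} (hz : z ∈ D)
    (v : ℂ) : df x χ v z =
      (fderiv ℝ x z v - psi x χ v z • x z, fderiv ℝ χ z v + psi x χ v z • χ z) := by
  unfold df hor
  simp only [h.fderiv_snd hD hz, ← sub_neg_eq_add, neg_smul]
  rfl

lemma IsQuadricMap.smooth_psi (hD : IsOpen D) (h : IsQuadricMap D x χ) (v : ℂ) :
    ContDiffOn ℝ ∞ (fun z => psi x χ v z) D :=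
  smooth_dot (smooth_fderiv hD h.smooth_fst v) h.smooth_snd

lemma IsQuadricMap.smooth_df_fst (hD : IsOpen D) (h : IsQuadricMap D x χ) (v : ℂ) :
    ContDiffOn ℝ ∞ (fun z => (df x χ v z).1) D :=
  ((smooth_fderiv hD h.smooth_fst v).sub ((h.smooth_psi hD v).smul h.smooth_fst)).congr
    fun z hz => by rw [h.df_eq hD hz]; rfl

lemma IsQuadricMap.smooth_df_snd (hD : IsOpen D) (h : IsQuadricMap D x χ) (v : ℂ) :
    ContDiffOn ℝ ∞ (fun z => (df x χ v z).2) D :=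
  ((smooth_fderiv hD h.smooth_snd v).add ((h.smooth_psi hD v).smul h.smooth_snd)).congr
    fun z hz => by rw [h.df_eq hD hz]; rfl

lemma IsQuadricMap.df_fst_dot (h : IsQuadricMap D x χ) {z : ℂ} (hz : z ∈ D) (v : ℂ) :
    (df x χ v z).1 ⬝ᵥ χ z = 0 := by
  simp [df, hor, sub_dotProduct, smul_dotProduct, h.dot_eq_one z hz]

lemma IsQuadricMap.dot_df_snd (h : IsQuadricMap D x χ) {z : ℂ} (hz : z ∈ D) (v : ℂ) :
    x z ⬝ᵥ (df x χ v z).2 = 0 := by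
  simp [df, hor, dotProduct_sub, dotProduct_smul, h.dot_eq_one z hz]

lemma Rescaled.isQuadricMap (r : Rescaled D α x χ x' χ') (h : IsQuadricMap D x χ) :
    IsQuadricMap D x' χ' where
  smooth_fst := (r.smooth.smul h.smooth_fst).congr r.fst
  smooth_snd := ((r.smooth.inv r.ne_zero).smul h.smooth_snd).congr r.snd
  dot_eq_one := fun z hz => by
    rw [r.fst z hz, r.snd z hz, smul_dotProduct, dotProduct_smul, h.dot_eq_one z hz]
    simp [r.ne_zero z hz]

lemma Rescaled.psi_eq (hD : IsOpen D) (r : Rescaled D α x χ x' χ') (h : IsQuadricMap D x χ)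
    {z : ℂ} (hz : z ∈ D) (v : ℂ) :
    psi x' χ' v z = psi x χ v z + (α z)⁻¹ * fderiv ℝ α z v := by
  have h0 := r.ne_zero z hz
  unfold psi
  rw [fderiv_smul_eq hD r.smooth h.smooth_fst r.fst hz, r.snd z hz]
  simp [h.dot_eq_one z hz]
  field_simp

/-- Differentiating the factor `α` adds a multiple of the vertical vector `(x, -χ)`; it shows up as
a shift of `psi` and is removed by the horizontal projection. -/
lemma Rescaled.df_eq (hD : IsOpen D) (r : Rescaled D α x χ x' χ') (h : IsQuadricMap D x χ)
    {z : ℂ} (hz : z ∈ D) (v : ℂ) :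
    df x' χ' v z = (α z • (df x χ v z).1, (α z)⁻¹ • (df x χ v z).2) := by
  have h0 := r.ne_zero z hz
  rw [(r.isQuadricMap h).df_eq hD hz, h.df_eq hD hz, r.psi_eq hD h hz,
    fderiv_smul_eq hD r.smooth h.smooth_fst r.fst hz,
    fderiv_smul_eq hD r.symm.smooth h.smooth_snd r.snd hz, fderiv_inv_eq hD r.smooth hz h0,
    r.fst z hz, r.snd z hz]
  ext i
  · simp; field_simp; ring
  · simp; field_simp; ring

lemma Rescaled.hor_eq (r : Rescaled D α x χ x' χ') {z : ℂ} (hz : z ∈ D) (p : V3 × V3) :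
    hor (x' z) (χ' z) (α z • p.1, (α z)⁻¹ • p.2)
      = (α z • (hor (x z) (χ z) p).1, (α z)⁻¹ • (hor (x z) (χ z) p).2) := by
  have h0 := r.ne_zero z hz
  unfold hor
  rw [r.fst z hz, r.snd z hz]
  ext i
  · simp; field_simp
  · simp; field_simp

lemma Rescaled.hForm_eq (hD : IsOpen D) (r : Rescaled D α x χ x' χ') (h : IsQuadricMap D x χ)
    {z : ℂ} (hz : z ∈ D) (v w : ℂ) : hForm x' χ' v w z = hForm x χ v w z := by
  have h0 := r.ne_zero z hz
  unfold hForm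
  rw [r.df_eq hD h hz, r.df_eq hD h hz]
  simp [h0]

lemma gDP_smul {a : ℝ} (h0 : a ≠ 0) (p q : V3 × V3) :
    gDP (a • p.1, a⁻¹ • p.2) (a • q.1, a⁻¹ • q.2) = gDP p q := by
  simp [gDP, h0]

lemma omegaDP_smul {a : ℝ} (h0 : a ≠ 0) (p q : V3 × V3) :
    omegaDP (a • p.1, a⁻¹ • p.2) (a • q.1, a⁻¹ • q.2) = omegaDP p q := by
  simp [omegaDP, h0]

/-- The derivative of `α` enters twice, through the derivative of the rescaled field and through the
shift of `psi`; the correction term in `nablaDP` is such that the two contributions cancel. -/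
lemma Rescaled.nablaDP_eq (hD : IsOpen D) (r : Rescaled D α x χ x' χ') (h : IsQuadricMap D x χ)
    {z : ℂ} (hz : z ∈ D) (v w : ℂ) :
    nablaDP x' χ' v w z = (α z • (nablaDP x χ v w z).1, (α z)⁻¹ • (nablaDP x χ v w z).2) := by
  have h0 := r.ne_zero z hz
  have e1 : ∀ y ∈ D, (df x' χ' w y).1 = α y • (df x χ w y).1 := fun y hy => by
    rw [r.df_eq hD h hy]
  have e2 : ∀ y ∈ D, (df x' χ' w y).2 = (α y)⁻¹ • (df x χ w y).2 := fun y hy => by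
    rw [r.df_eq hD h hy]
  unfold nablaDP
  rw [← r.hor_eq hz, fderiv_smul_eq hD r.smooth (h.smooth_df_fst hD w) e1 hz,
    fderiv_smul_eq hD r.symm.smooth (h.smooth_df_snd hD w) e2 hz, fderiv_inv_eq hD r.smooth hz h0,
    r.psi_eq hD h hz, e1 z hz, e2 z hz]
  congr 2
  · ext i; simp; field_simp; ring
  · ext i; simp; field_simp; ring

end rescaled

/-! ### The geometric properties in terms of a single lift -/

section lift
variable {D : Set ℂ} {f : ℂ → DP2} {x χ : ℂ → V3}

/-- The geometric properties only ask for some lift. Any two lifts are rescalings of each other,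
under which `gDP`, `omegaDP` and `hForm` are invariant; hence the properties can be tested on a
prescribed lift, here and in the next four lemmas. -/
lemma definite_of_isLift (hD : IsOpen D) {H : ℝ} (hl : IsLift D f x χ)
    (h : IsDefiniteImmersion H D f) : ∀ z ∈ D,
      0 < H * gDP (df x χ 1 z) (df x χ 1 z) ∧
      gDP (df x χ 1 z) (df x χ 1 z) = gDP (df x χ Complex.I z) (df x χ Complex.I z) ∧
      gDP (df x χ 1 z) (df x χ Complex.I z) = 0 := by
  obtain ⟨x', χ', hl', h'⟩ := h
  obtain ⟨α, r⟩ := rescaled_of_isLift hl' hl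
  intro z hz
  have h0 := r.ne_zero z hz
  have hd := r.df_eq hD hl'.isQuadricMap hz
  simp only [hd, gDP_smul h0]
  exact h' z hz

lemma isLagrangian_iff (hD : IsOpen D) (hl : IsLift D f x χ) : IsLagrangian D f ↔
    ∀ z ∈ D, ∀ v w : ℂ, omegaDP (df x χ v z) (df x χ w z) = 0 := by
  refine ⟨?_, fun h => ⟨x, χ, hl, h⟩⟩
  rintro ⟨x', χ', hl', h'⟩
  obtain ⟨α, r⟩ := rescaled_of_isLift hl' hl
  intro z hz v w
  rw [r.df_eq hD hl'.isQuadricMap hz, r.df_eq hD hl'.isQuadricMap hz,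
    omegaDP_smul (r.ne_zero z hz)]
  exact h' z hz v w

lemma isFlat_iff (hD : IsOpen D) {H : ℝ} (hl : IsLift D f x χ) : IsFlat H D f ↔
    ∀ z ∈ D,
    fderiv ℝ (fun y => fderiv ℝ (fun w => Real.log (expU H x χ w)) y 1) z 1 +
    fderiv ℝ (fun y => fderiv ℝ (fun w => Real.log (expU H x χ w)) y Complex.I) z Complex.I
      = 0 := by
  refine ⟨?_, fun h => ⟨x, χ, hl, h⟩⟩
  rintro ⟨x', χ', hl', h'⟩
  obtain ⟨α, r⟩ := rescaled_of_isLift hl' hl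
  intro z hz
  have e : ∀ y ∈ D, fderiv ℝ (fun w => Real.log (expU H x χ w)) y
      = fderiv ℝ (fun w => Real.log (expU H x' χ' w)) y := fun y hy => by
    refine Filter.EventuallyEq.fderiv_eq (Filter.eventuallyEq_of_mem (hD.mem_nhds hy) ?_)
    intro w hw
    simp only [expU, r.hForm_eq hD hl'.isQuadricMap hw]
  have e2 : ∀ v : ℂ, fderiv ℝ (fun y => fderiv ℝ (fun w => Real.log (expU H x χ w)) y v) z
      = fderiv ℝ (fun y => fderiv ℝ (fun w => Real.log (expU H x' χ' w)) y v) z := fun v =>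
    Filter.EventuallyEq.fderiv_eq (Filter.eventuallyEq_of_mem (hD.mem_nhds hz)
      fun y hy => by rw [e y hy])
  rw [e2, e2]
  exact h' z hz

lemma isMinimal_iff (hD : IsOpen D) (hl : IsLift D f x χ) : IsMinimal D f ↔
    ∀ z ∈ D, ∀ n : V3 × V3, IsHorizontal (x z) (χ z) n →
    (∀ v : ℂ, gDP n (df x χ v z) = 0) →
    gDP n (nablaDP x χ 1 1 z + nablaDP x χ Complex.I Complex.I z) = 0 := by
  refine ⟨?_, fun h => ⟨x, χ, hl, h⟩⟩
  rintro ⟨x', χ', hl', h'⟩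
  obtain ⟨α, r⟩ := rescaled_of_isLift hl' hl
  intro z hz n hn hv
  have h0 := r.ne_zero z hz
  have q := hl'.isQuadricMap
  have hn' : n = (α z • ((α z)⁻¹ • n.1, α z • n.2).1, (α z)⁻¹ • ((α z)⁻¹ • n.1, α z • n.2).2) := by
    ext i <;> simp [h0]
  -- The normal vector is carried to the other lift by the inverse rescaling, under which
  -- horizontality and normality persist.
  have hm := h' z hz ((α z)⁻¹ • n.1, α z • n.2) ?_ ?_
  · rw [r.nablaDP_eq hD q hz, r.nablaDP_eq hD q hz, hn', Prod.mk_add_mk, ← smul_add, ← smul_add,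
      ← Prod.fst_add, ← Prod.snd_add, gDP_smul h0]
    exact hm
  · unfold IsHorizontal at hn ⊢
    rw [r.fst z hz, r.snd z hz] at hn
    simpa [h0] using hn
  · intro v
    have := hv v
    rw [r.df_eq hD q hz, hn', gDP_smul h0] at this
    exact this

lemma isHomogeneous_iff (hD : IsOpen D) (hl : IsLift D f x χ) : IsHomogeneous D f ↔
    ∃ 𝔞 : Submodule ℝ (Matrix (Fin 3) (Fin 3) ℝ), (∀ X ∈ 𝔞, X.trace = 0) ∧
      (∀ X ∈ 𝔞, ∀ Y ∈ 𝔞, X * Y - Y * X ∈ 𝔞) ∧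
      ∀ z ∈ D, Set.range (fun v : ℂ => df x χ v z) =
        (fun X : Matrix (Fin 3) (Fin 3) ℝ => hor (x z) (χ z) (X *ᵥ x z, -(Xᵀ *ᵥ χ z))) ''
          {X | X ∈ 𝔞} := by
  refine ⟨?_, fun h => ⟨x, χ, hl, h⟩⟩
  rintro ⟨x', χ', hl', 𝔞, ht, hb, h'⟩
  obtain ⟨α, r⟩ := rescaled_of_isLift hl' hl
  refine ⟨𝔞, ht, hb, fun z hz => ?_⟩
  have h0 := r.ne_zero z hz
  let s : V3 × V3 → V3 × V3 := fun p => (α z • p.1, (α z)⁻¹ • p.2)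
  have e1 : (fun v : ℂ => df x χ v z) = s ∘ fun v : ℂ => df x' χ' v z := by
    funext v; exact r.df_eq hD hl'.isQuadricMap hz v
  have e2 : (fun X : Matrix (Fin 3) (Fin 3) ℝ => hor (x z) (χ z) (X *ᵥ x z, -(Xᵀ *ᵥ χ z)))
      = s ∘ fun X => hor (x' z) (χ' z) (X *ᵥ x' z, -(Xᵀ *ᵥ χ' z)) := by
    funext X
    have := r.hor_eq hz (X *ᵥ x' z, -(Xᵀ *ᵥ χ' z))
    simp only [Function.comp, s, ← this]
    rw [r.fst z hz, r.snd z hz, Matrix.mulVec_smul, Matrix.mulVec_smul, smul_neg]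
  rw [e1, e2, Set.range_comp, Set.image_comp, h' z hz]

end lift

/-! ### The moving frame of a conformal lift -/

/-- A smooth map into the quadric whose horizontal part induces the metric `2 H e^u |dz|²`. -/
structure IsConformal (H : ℝ) (D : Set ℂ) (x χ : ℂ → V3) : Prop extends IsQuadricMap D x χ where
  sq_eq_one : H * H = 1
  expU_pos : ∀ z ∈ D, 0 < expU H x χ z
  hForm_I_I : ∀ z ∈ D, hForm x χ Complex.I Complex.I z = hForm x χ 1 1 z
  hForm_I_one : ∀ z ∈ D, hForm x χ Complex.I 1 z = -hForm x χ 1 Complex.I z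

lemma hForm_eq_gDP (x χ : ℂ → V3) (v z : ℂ) :
    hForm x χ v v z = gDP (df x χ v z) (df x χ v z) := by
  simp [hForm, gDP]

lemma isConformal_of_isLift {D : Set ℂ} (hD : IsOpen D) {H : ℝ} (hH : H * H = 1) {f : ℂ → DP2}
    {x χ : ℂ → V3} (hl : IsLift D f x χ) (h : IsDefiniteImmersion H D f) :
    IsConformal H D x χ where
  toIsQuadricMap := hl.isQuadricMap
  sq_eq_one := hH
  expU_pos := fun z hz => by
    have := (definite_of_isLift hD hl h z hz).1
    rw [expU, hForm_eq_gDP]; linarith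
  hForm_I_I := fun z hz => by
    rw [hForm_eq_gDP, hForm_eq_gDP, (definite_of_isLift hD hl h z hz).2.1]
  hForm_I_one := fun z hz => by
    have := (definite_of_isLift hD hl h z hz).2.2
    unfold gDP at this
    unfold hForm
    linarith

/-- The vector `ξ_z`. -/
def xiC (x χ : ℂ → V3) (z : ℂ) (i : Fin 3) : ℂ :=
  (((df x χ 1 z).1 i : ℂ) - Complex.I * ((df x χ Complex.I z).1 i : ℂ)) / 2

/-- The covector `η_z`. -/
def etaC (x χ : ℂ → V3) (z : ℂ) (i : Fin 3) : ℂ :=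
  (((df x χ 1 z).2 i : ℂ) - Complex.I * ((df x χ Complex.I z).2 i : ℂ)) / 2

/-- The complex function `c^{1/2} e^{u/2}`. -/
def tFun (H : ℝ) (x χ : ℂ → V3) (z : ℂ) : ℂ :=
  cFun x χ z ^ (1 / 2 : ℂ) * (Real.sqrt (expU H x χ z) : ℂ)

lemma xiC_dot_etaC (x χ : ℂ → V3) (z : ℂ) : ∑ k, xiC x χ z k * etaC x χ z k =
    ((hForm x χ 1 1 z - hForm x χ Complex.I Complex.I z : ℝ)
      - Complex.I * (hForm x χ 1 Complex.I z + hForm x χ Complex.I 1 z : ℝ)) / 4 := by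
  simp only [xiC, etaC, hForm, dotProduct, Fin.sum_univ_three]
  push_cast
  ring_nf
  simp only [Complex.I_sq]
  ring

lemma xiC_dot_conj_etaC (x χ : ℂ → V3) (z : ℂ) :
    ∑ k, xiC x χ z k * (starRingEnd ℂ) (etaC x χ z k) =
    ((hForm x χ 1 1 z + hForm x χ Complex.I Complex.I z : ℝ)
      + Complex.I * (hForm x χ 1 Complex.I z - hForm x χ Complex.I 1 z : ℝ)) / 4 := by
  simp only [xiC, etaC, hForm, dotProduct, Fin.sum_univ_three, map_div₀, map_sub, map_mul,
    Complex.conj_ofReal, Complex.conj_I, map_ofNat]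
  push_cast
  ring_nf
  simp only [Complex.I_sq]
  ring

/-- The matrix with columns `c^{-1/2} e^{-u/2} ξ_z`, its conjugate, and `x`. -/
def frameM (H : ℝ) (x χ : ℂ → V3) (z : ℂ) : M3 := Matrix.of fun i j =>
    ![frameVec H x χ z i, (starRingEnd ℂ) (frameVec H x χ z i), (x z i : ℂ)] j

/-- The dual coframe. -/
def coframe (H : ℝ) (x χ : ℂ → V3) (z : ℂ) : M3 := Matrix.of fun i j =>
    ![H * (tFun H x χ z)⁻¹ * (starRingEnd ℂ) (etaC x χ z j),
      H * (starRingEnd ℂ) (tFun H x χ z)⁻¹ * etaC x χ z j, (χ z j : ℂ)] i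

lemma movingFrame_eq (H : ℝ) (x χ : ℂ → V3) (z : ℂ) :
    movingFrame H x χ z = R⁻¹ * frameM H x χ z := rfl

/-- This keeps `c` away from the branch cut, so that the principal square root in the frame is
smooth. -/
lemma cFun_re (x χ : ℂ → V3) (z : ℂ) : (cFun x χ z).re = 1 := by
  simp only [cFun, Complex.add_re, Complex.one_re, Complex.mul_re, Complex.I_re, Complex.I_im,
    Complex.ofReal_re, Complex.ofReal_im]
  ring

lemma cFun_mem_slitPlane (x χ : ℂ → V3) (z : ℂ) : cFun x χ z ∈ Complex.slitPlane :=
  Or.inl (by rw [cFun_re]; exact one_pos)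

lemma cFun_ne_zero (x χ : ℂ → V3) (z : ℂ) : cFun x χ z ≠ 0 :=
  Complex.slitPlane_ne_zero (cFun_mem_slitPlane x χ z)

lemma frameVec_eq (H : ℝ) (x χ : ℂ → V3) (z : ℂ) (i : Fin 3) :
    frameVec H x χ z i = (tFun H x χ z)⁻¹ * xiC x χ z i := by
  unfold frameVec tFun xiC
  rw [Complex.cpow_neg]
  field_simp

section conformal
variable {H : ℝ} {D : Set ℂ} {x χ : ℂ → V3} {z : ℂ}

/-- As `c` has real part one, the real part of `t²` is the conformal factor, while its imaginary
part is `H h₁₂ / 2` and measures the failure to be Lagrangian. -/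
lemma IsConformal.tFun_sq (hc : IsConformal H D x χ) (hz : z ∈ D) : tFun H x χ z ^ 2 = cFun x χ z * (expU H x χ z : ℝ) := by
  unfold tFun
  rw [mul_pow, ← Complex.cpow_nat_mul]
  have : ((2 : ℕ) : ℂ) * (1 / 2) = 1 := by norm_num
  rw [this, Complex.cpow_one, ← Complex.ofReal_pow, Real.sq_sqrt (hc.expU_pos z hz).le]

lemma IsConformal.tFun_sq_re (hc : IsConformal H D x χ) (hz : z ∈ D) : (tFun H x χ z ^ 2).re = expU H x χ z := by
  rw [hc.tFun_sq hz, Complex.re_mul_ofReal, cFun_re, one_mul]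

lemma IsConformal.tFun_ne_zero (hc : IsConformal H D x χ) (hz : z ∈ D) : tFun H x χ z ≠ 0 := by
  intro h
  have h1 := hc.tFun_sq_re hz
  have h2 := hc.expU_pos z hz
  rw [h] at h1
  simp at h1
  linarith

lemma IsConformal.tFun_re_pos (hc : IsConformal H D x χ) (hz : z ∈ D) : 0 < (tFun H x χ z).re := by
  unfold tFun
  rw [Complex.re_mul_ofReal]
  refine mul_pos ?_ (Real.sqrt_pos.mpr (hc.expU_pos z hz))
  have h : (1 / 2 : ℂ) = (2 : ℂ)⁻¹ := by norm_num
  rw [h, Complex.cpow_inv_two_re, cFun_re]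
  positivity

lemma IsConformal.smooth_expU (hc : IsConformal H D x χ) (hD : IsOpen D) : ContDiffOn ℝ ∞ (fun z => expU H x χ z) D :=
  (contDiffOn_const.mul (smooth_dot (hc.smooth_df_fst hD 1) (hc.smooth_df_snd hD 1))).div_const 2

lemma IsConformal.hForm_ne_zero (hc : IsConformal H D x χ) (hz : z ∈ D) : hForm x χ 1 1 z ≠ 0 := by
  intro h
  have := hc.expU_pos z hz
  simp [expU, h] at this

lemma smooth_ofReal {g : ℂ → ℝ} (hg : ContDiffOn ℝ ∞ g D) :
    ContDiffOn ℝ ∞ (fun y => (g y : ℂ)) D :=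
  Complex.ofRealCLM.contDiff.comp_contDiffOn hg

lemma IsConformal.smooth_cFun (hD : IsOpen D) (hc : IsConformal H D x χ) :
    ContDiffOn ℝ ∞ (fun z => cFun x χ z) D := by
  have h1 : ContDiffOn ℝ ∞ (fun z => hForm x χ 1 Complex.I z / hForm x χ 1 1 z) D :=
    (smooth_dot (hc.smooth_df_fst hD 1) (hc.smooth_df_snd hD Complex.I)).div
      (smooth_dot (hc.smooth_df_fst hD 1) (hc.smooth_df_snd hD 1)) fun z hz => hc.hForm_ne_zero hz
  exact contDiffOn_const.add (contDiffOn_const.mul (smooth_ofReal h1))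

lemma IsConformal.smooth_tFun (hD : IsOpen D) (hc : IsConformal H D x χ) :
    ContDiffOn ℝ ∞ (fun z => tFun H x χ z) D := by
  have h1 : ContDiffOn ℝ ∞ (fun z => Real.sqrt (expU H x χ z)) D :=
    (hc.smooth_expU hD).sqrt fun z hz => (hc.expU_pos z hz).ne'
  have h2 : ContDiffOn ℝ ∞ (fun z => Complex.log (cFun x χ z)) D := fun z hz =>
    (((Complex.contDiffAt_log (cFun_mem_slitPlane x χ z)).restrict_scalars ℝ
      (n := ∞)).comp_contDiffWithinAt z (hc.smooth_cFun hD z hz))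
  have h3 : ContDiffOn ℝ ∞ (fun z => Complex.exp (Complex.log (cFun x χ z) * (1 / 2))) D :=
    (Complex.contDiff_exp (𝕜 := ℝ)).comp_contDiffOn (h2.mul contDiffOn_const)
  refine (h3.mul (smooth_ofReal h1)).congr fun z _ => ?_
  unfold tFun
  rw [Complex.cpow_def_of_ne_zero (cFun_ne_zero x χ z)]

lemma IsConformal.smooth_xiC (hD : IsOpen D) (hc : IsConformal H D x χ) (i : Fin 3) :
    ContDiffOn ℝ ∞ (fun z => xiC x χ z i) D :=
  ((smooth_ofReal (contDiffOn_pi.mp (hc.smooth_df_fst hD 1) i)).sub (contDiffOn_const.mul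
    (smooth_ofReal (contDiffOn_pi.mp (hc.smooth_df_fst hD Complex.I) i)))).div_const 2

lemma IsConformal.smooth_frameVec (hD : IsOpen D) (hc : IsConformal H D x χ) (i : Fin 3) :
    ContDiffOn ℝ ∞ (fun z => frameVec H x χ z i) D := by
  simp only [frameVec_eq]
  exact ((hc.smooth_tFun hD).inv fun z hz => hc.tFun_ne_zero hz).mul (hc.smooth_xiC hD i)

lemma IsConformal.smooth_frameM (hD : IsOpen D) (hc : IsConformal H D x χ) :
    MSmooth D (frameM H x χ) := by
  intro i j
  fin_cases j
  · exact hc.smooth_frameVec hD i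
  · exact smooth_conj (hc.smooth_frameVec hD i)
  · exact smooth_ofReal (contDiffOn_pi.mp hc.smooth_fst i)

lemma IsConformal.xiC_dot_conj_etaC (hc : IsConformal H D x χ) (hz : z ∈ D) :
    ∑ k, xiC x χ z k * (starRingEnd ℂ) (etaC x χ z k) = H * tFun H x χ z ^ 2 := by
  have h0 : (hForm x χ 1 1 z : ℂ) ≠ 0 := by exact_mod_cast hc.hForm_ne_zero hz
  have hH : (H : ℂ) * H = 1 := by exact_mod_cast hc.sq_eq_one
  rw [RuhVilms.xiC_dot_conj_etaC, hc.hForm_I_I z hz, hc.hForm_I_one z hz, hc.tFun_sq hz, cFun, expU]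
  push_cast
  field_simp
  linear_combination -4 * (((hForm x χ 1 1 z : ℂ) + Complex.I * (hForm x χ 1 Complex.I z : ℂ))) * hH

/-- Both parts vanish by conformality: the difference of the diagonal values of `h`, and the sum of
the off-diagonal ones. -/
lemma IsConformal.xiC_dot_etaC (hc : IsConformal H D x χ) (hz : z ∈ D) :
    ∑ k, xiC x χ z k * etaC x χ z k = 0 := by
  rw [RuhVilms.xiC_dot_etaC, hc.hForm_I_I z hz, hc.hForm_I_one z hz]
  simp

lemma IsConformal.xiC_dot (hc : IsConformal H D x χ) (hz : z ∈ D) :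
    ∑ k, xiC x χ z k * (χ z k : ℂ) = 0 := by
  have h1 : (((df x χ 1 z).1 ⬝ᵥ χ z : ℝ) : ℂ) = 0 := by rw [hc.df_fst_dot hz]; simp
  have h2 : (((df x χ Complex.I z).1 ⬝ᵥ χ z : ℝ) : ℂ) = 0 := by rw [hc.df_fst_dot hz]; simp
  simp only [dotProduct, Fin.sum_univ_three, xiC] at *
  push_cast at h1 h2
  linear_combination h1 / 2 - Complex.I * h2 / 2

lemma IsConformal.dot_etaC (hc : IsConformal H D x χ) (hz : z ∈ D) :
    ∑ k, (x z k : ℂ) * etaC x χ z k = 0 := by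
  have h1 : ((x z ⬝ᵥ (df x χ 1 z).2 : ℝ) : ℂ) = 0 := by rw [hc.dot_df_snd hz]; simp
  have h2 : ((x z ⬝ᵥ (df x χ Complex.I z).2 : ℝ) : ℂ) = 0 := by rw [hc.dot_df_snd hz]; simp
  simp only [dotProduct, Fin.sum_univ_three, etaC] at *
  push_cast at h1 h2
  linear_combination h1 / 2 - Complex.I * h2 / 2

/-- The only nonzero pairings are those of `ξ_z` with the conjugate of `η_z`, equal to `H t²`, its
conjugate, and that of `x` with `χ`. The factors `t⁻¹` in frame and coframe normalize them, using
`H² = 1`. -/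
lemma IsConformal.coframe_mul_frameM (hc : IsConformal H D x χ) (hz : z ∈ D) :
    coframe H x χ z * frameM H x χ z = 1 := by
  have ht := hc.tFun_ne_zero hz
  have htc : (starRingEnd ℂ) (tFun H x χ z) ≠ 0 := (map_ne_zero _).mpr ht
  have hH : (H : ℂ) * H = 1 := by exact_mod_cast hc.sq_eq_one
  have e1 := hc.xiC_dot_conj_etaC hz
  have e1' := congrArg (starRingEnd ℂ) e1
  have e2 := hc.xiC_dot_etaC hz
  have e2' := congrArg (starRingEnd ℂ) e2
  have e3 := hc.xiC_dot hz
  have e3' := congrArg (starRingEnd ℂ) e3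
  have e4 := hc.dot_etaC hz
  have e4' := congrArg (starRingEnd ℂ) e4
  have e5 : ((x z ⬝ᵥ χ z : ℝ) : ℂ) = 1 := by rw [hc.dot_eq_one z hz]; simp
  simp only [dotProduct, Fin.sum_univ_three, map_add, map_mul, Complex.conj_conj, map_zero, map_pow,
    Complex.conj_ofReal] at *
  push_cast at e5
  have hi : tFun H x χ z * (tFun H x χ z)⁻¹ = 1 := mul_inv_cancel₀ ht
  have hi' : (starRingEnd ℂ) (tFun H x χ z) * ((starRingEnd ℂ) (tFun H x χ z))⁻¹ = 1 :=
    mul_inv_cancel₀ htc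
  set t := tFun H x χ z
  set s := (tFun H x χ z)⁻¹
  set t' := (starRingEnd ℂ) t
  set s' := ((starRingEnd ℂ) t)⁻¹
  ext i j
  fin_cases i <;> fin_cases j <;>
    simp [Matrix.mul_apply, Fin.sum_univ_three, coframe, frameM, frameVec_eq]
  · linear_combination H * s * s * e1 + (t * s) ^ 2 * hH + (t * s + 1) * hi
  · linear_combination H * s * s' * e2'
  · linear_combination H * s * e4'
  · linear_combination H * s * s' * e2
  · linear_combination H * s' * s' * e1' + (t' * s') ^ 2 * hH + (t' * s' + 1) * hi'
  · linear_combination H * s' * e4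
  · linear_combination s * e3
  · linear_combination s' * e3'
  · linear_combination e5

end conformal

/-! ### The structure equations of the moving frame -/

lemma fderiv_ofReal_apply {g : ℂ → ℝ} {z : ℂ} (hg : DifferentiableAt ℝ g z) (v : ℂ) :
    fderiv ℝ (fun y => (g y : ℂ)) z v = (fderiv ℝ g z v : ℝ) := by
  have h : HasFDerivAt (fun y => (g y : ℂ)) (Complex.ofRealCLM.comp (fderiv ℝ g z)) z :=
    Complex.ofRealCLM.hasFDerivAt.comp z hg.hasFDerivAt
  rw [h.fderiv]; rfl

lemma fderiv_component {y : ℂ → V3} {z : ℂ} (hy : DifferentiableAt ℝ y z) (v : ℂ) (i : Fin 3) :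
    fderiv ℝ (fun w => y w i) z v = fderiv ℝ y z v i := by
  have h := hasFDerivAt_pi'.mp hy.hasFDerivAt i
  rw [h.fderiv]; rfl

/-- The vertical component `ψ_z`. -/
def psiC (x χ : ℂ → V3) (z : ℂ) : ℂ :=
  ((psi x χ 1 z : ℂ) - Complex.I * (psi x χ Complex.I z : ℂ)) / 2

/-- The constant value of the determinant of `M` is that of `R`, so that `R⁻¹ M` has values in the
special linear group. -/
structure AdaptedFrame (H : ℝ) (D : Set ℂ) (M : ℂ → M3) (t : ℂ → ℂ) : Prop where
  isOpen : IsOpen D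
  sq_eq_one : (H : ℂ) * H = 1
  smooth : MSmooth D M
  smooth_t : ContDiffOn ℝ ∞ t D
  det_eq : ∀ z ∈ D, (M z).det = R.det
  conj_zero : ∀ z ∈ D, ∀ i, (starRingEnd ℂ) (M z i 0) = M z i 1
  conj_two : ∀ z ∈ D, ∀ i, (starRingEnd ℂ) (M z i 2) = M z i 2
  entry02 : ∀ z ∈ D, ((M z)⁻¹ * mwd (-Complex.I) M z) 0 2 = t z
  entry12 : ∀ z ∈ D, ((M z)⁻¹ * mwd (-Complex.I) M z) 1 2 = 0
  entry20 : ∀ z ∈ D, ((M z)⁻¹ * mwd (-Complex.I) M z) 2 0 = 0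
  entry21 : ∀ z ∈ D, ((M z)⁻¹ * mwd (-Complex.I) M z) 2 1 = -H * (starRingEnd ℂ) (t z)
  re_pos : ∀ z ∈ D, 0 < (t z).re
  re_sq_pos : ∀ z ∈ D, 0 < (t z ^ 2).re

section conformal
variable {H : ℝ} {D : Set ℂ} {x χ : ℂ → V3} {z : ℂ}

lemma IsConformal.wd_fst (hD : IsOpen D) (hc : IsConformal H D x χ) (hz : z ∈ D) (i : Fin 3) :
    wd (-Complex.I) (fun y => (x y i : ℂ)) z = xiC x χ z i + psiC x χ z * x z i := by
  have hx := diffAt_of_smooth hD hc.smooth_fst hz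
  have hxi := diffAt_of_smooth hD (contDiffOn_pi.mp hc.smooth_fst i) hz
  unfold wd xiC psiC
  rw [fderiv_ofReal_apply hxi, fderiv_ofReal_apply hxi, fderiv_component hx, fderiv_component hx,
    hc.df_eq hD hz, hc.df_eq hD hz]
  simp
  ring

lemma IsConformal.wd_snd (hD : IsOpen D) (hc : IsConformal H D x χ) (hz : z ∈ D) (i : Fin 3) :
    wd (-Complex.I) (fun y => (χ y i : ℂ)) z = etaC x χ z i - psiC x χ z * χ z i := by
  have hx := diffAt_of_smooth hD hc.smooth_snd hz
  have hxi := diffAt_of_smooth hD (contDiffOn_pi.mp hc.smooth_snd i) hz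
  unfold wd etaC psiC
  rw [fderiv_ofReal_apply hxi, fderiv_ofReal_apply hxi, fderiv_component hx, fderiv_component hx,
    hc.df_eq hD hz, hc.df_eq hD hz]
  simp
  ring

lemma IsConformal.inv_frameM (hc : IsConformal H D x χ) (hz : z ∈ D) :
    (frameM H x χ z)⁻¹ = coframe H x χ z :=
  Matrix.inv_eq_left_inv (hc.coframe_mul_frameM hz)

/-- The last column of the frame is `x`, and `x_z = ξ_z + ψ_z x`, where `ξ_z` is `t` times the first
column. -/
lemma IsConformal.entry_col (hD : IsOpen D) (hc : IsConformal H D x χ) (hz : z ∈ D) (i : Fin 3) :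
    (coframe H x χ z * mwd (-Complex.I) (frameM H x χ) z) i 2
      = ![tFun H x χ z, 0, psiC x χ z] i := by
  have h := hc.coframe_mul_frameM hz
  have h0 := congrFun (congrFun h i) 0
  have h2 := congrFun (congrFun h i) 2
  have e : ∀ k, mwd (-Complex.I) (frameM H x χ) z k 2
      = tFun H x χ z * frameM H x χ z k 0 + psiC x χ z * frameM H x χ z k 2 := fun k => by
    rw [mwd_apply]
    have : (fun y => frameM H x χ y k 2) = fun y => (x y k : ℂ) := rfl
    rw [this, hc.wd_fst hD hz]
    simp [frameM, frameVec_eq, hc.tFun_ne_zero hz]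
  rw [Matrix.mul_apply] at h0 h2 ⊢
  simp only [e, mul_add, Finset.sum_add_distrib, mul_left_comm _ (tFun H x χ z),
    mul_left_comm _ (psiC x χ z), ← Finset.mul_sum, h0, h2]
  match i with
  | 0 => simp
  | 1 => simp
  | 2 => simp

/-- The last row of the coframe is `χ`. Differentiating its constant pairing with the frame columns
transfers the derivative to `χ`, where `χ_z = η_z - ψ_z χ` and `η_z` is `H t̄` times the middle row
of the coframe. -/
lemma IsConformal.entry_row (hD : IsOpen D) (hc : IsConformal H D x χ) (hz : z ∈ D) (j : Fin 3) :
    (coframe H x χ z * mwd (-Complex.I) (frameM H x χ) z) 2 j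
      = ![0, -H * (starRingEnd ℂ) (tFun H x χ z), psiC x χ z] j := by
  have hM := hc.smooth_frameM hD
  have hH : (H : ℂ) * H = 1 := by exact_mod_cast hc.sq_eq_one
  have htc : (starRingEnd ℂ) (tFun H x χ z) ≠ 0 := (map_ne_zero _).mpr (hc.tFun_ne_zero hz)
  have hχ : ∀ k, DifferentiableAt ℝ (fun y => (χ y k : ℂ)) z := fun k =>
    diffAt_of_smooth hD (smooth_ofReal (contDiffOn_pi.mp hc.smooth_snd k)) hz
  have h := hc.coframe_mul_frameM hz
  have h1 := congrFun (congrFun h 1) j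
  have h2 := congrFun (congrFun h 2) j
  have h3 : wd (-Complex.I) (fun y => ∑ k, (χ y k : ℂ) * frameM H x χ y k j) z = 0 := by
    rw [wd_congr_on hD (k := fun _ => (1 : M3) 2 j) (fun y hy => ?_) hz, wd_const]
    have := congrFun (congrFun (hc.coframe_mul_frameM hy) 2) j
    rw [← this, Matrix.mul_apply]
    rfl
  rw [wd_sum (G := fun k y => (χ y k : ℂ) * frameM H x χ y k j) _
    fun k _ => (hχ k).mul (hM.diffAt hD hz k j)] at h3
  simp only [wd_mul (hχ _) (hM.diffAt hD hz _ j), hc.wd_snd hD hz] at h3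
  have e : ∀ k, etaC x χ z k = H * (starRingEnd ℂ) (tFun H x χ z) * coframe H x χ z 1 k :=
    fun k => by
      simp only [coframe, Matrix.of_apply, Matrix.cons_val_one, Matrix.cons_val_zero, map_inv₀]
      field_simp
      linear_combination -(etaC x χ z k) * hH
  have e2 : ∀ k, coframe H x χ z 2 k = χ z k := fun k => rfl
  rw [Matrix.mul_apply] at h1 h2 ⊢
  simp only [e, Fin.sum_univ_three, e2, mwd_apply] at h1 h2 h3 ⊢
  have e3 : ![0, -H * (starRingEnd ℂ) (tFun H x χ z), psiC x χ z] j
      = -H * (starRingEnd ℂ) (tFun H x χ z) * (1 : M3) 1 j + psiC x χ z * (1 : M3) 2 j := by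
    match j with
    | 0 => simp
    | 1 => simp
    | 2 => simp
  rw [e3]
  linear_combination h3 - H * (starRingEnd ℂ) (tFun H x χ z) * h1 + psiC x χ z * h2

lemma IsConformal.adaptedFrame (hD : IsOpen D) (hc : IsConformal H D x χ)
    (hdet : ∀ z ∈ D, (frameM H x χ z).det = R.det) :
    AdaptedFrame H D (frameM H x χ) (tFun H x χ) where
  isOpen := hD
  sq_eq_one := by exact_mod_cast hc.sq_eq_one
  smooth := hc.smooth_frameM hD
  smooth_t := hc.smooth_tFun hD
  det_eq := hdet
  conj_zero := fun z _ i => rfl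
  conj_two := fun z _ i => by simp [frameM]
  entry02 := fun z hz => by rw [hc.inv_frameM hz, hc.entry_col hD hz]; rfl
  entry12 := fun z hz => by rw [hc.inv_frameM hz, hc.entry_col hD hz]; rfl
  entry20 := fun z hz => by rw [hc.inv_frameM hz, hc.entry_row hD hz]; rfl
  entry21 := fun z hz => by rw [hc.inv_frameM hz, hc.entry_row hD hz]; rfl
  re_pos := fun z hz => hc.tFun_re_pos hz
  re_sq_pos := fun z hz => by rw [hc.tFun_sq_re hz]; exact hc.expU_pos z hz

end conformal

/-! ### Normalization -/

lemma sqrtTwo_sq : (Real.sqrt 2 : ℂ) * (Real.sqrt 2 : ℂ) = 2 := by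
  rw [← Complex.ofReal_mul, Real.mul_self_sqrt (by norm_num)]; norm_num

lemma sqrtTwo_ne_zero : (Real.sqrt 2 : ℂ) ≠ 0 := by
  intro h
  have := sqrtTwo_sq
  rw [h] at this
  norm_num at this

lemma inv_R : R⁻¹ = !![1 / (Real.sqrt 2 : ℂ), -Complex.I / (Real.sqrt 2 : ℂ), 0;
     1 / (Real.sqrt 2 : ℂ), Complex.I / (Real.sqrt 2 : ℂ), 0;
     0, 0, 1] := by
  have h2 := sqrtTwo_ne_zero
  have h3 := sqrtTwo_sq
  refine Matrix.inv_eq_left_inv ?_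
  ext i j
  fin_cases i <;> fin_cases j <;>
    simp [R, Matrix.mul_apply, Fin.sum_univ_three] <;> field_simp
  all_goals first
    | ring1
    | linear_combination Complex.I_sq
    | linear_combination -Complex.I_sq - h3

lemma det_R : R.det = -Complex.I := by
  have h2 := sqrtTwo_ne_zero
  have h3 := sqrtTwo_sq
  simp [R, Matrix.det_fin_three]
  field_simp
  rw [sq, h3]
  ring

lemma det_R_ne_zero : R.det ≠ 0 := by rw [det_R]; simp

lemma R_mul_inv : R * R⁻¹ = 1 := Matrix.mul_nonsing_inv _ (isUnit_iff_ne_zero.mpr det_R_ne_zero)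

lemma inv_mul_R : R⁻¹ * R = 1 := Matrix.nonsing_inv_mul _ (isUnit_iff_ne_zero.mpr det_R_ne_zero)

/-- Right multiplication by `R⁻¹` replaces a conjugate pair of columns by multiples of its real and
imaginary parts. -/
lemma im_mul_inv_R {A : M3} (h0 : ∀ i, (starRingEnd ℂ) (A i 0) = A i 1)
    (h2 : ∀ i, (starRingEnd ℂ) (A i 2) = A i 2) (i j : Fin 3) : ((A * R⁻¹) i j).im = 0 := by
  rw [← Complex.conj_eq_iff_im, inv_R]
  have h1 : (starRingEnd ℂ) (A i 1) = A i 0 := by rw [← h0, Complex.conj_conj]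
  fin_cases j <;> simp [Matrix.mul_apply, Fin.sum_univ_three, h0, h1, h2] <;> ring

lemma det_im_eq_zero {A : M3} (h : ∀ i j, (A i j).im = 0) : A.det.im = 0 := by
  have : A = (Matrix.of fun i j => (A i j).re).map Complex.ofRealHom := by
    ext i j
    apply Complex.ext <;> simp [h]
  rw [this, ← RingHom.mapMatrix_apply, ← RingHom.map_det]
  exact Complex.ofReal_im _

lemma cbrt_pow {s : ℝ} (hs : s ≠ 0) : cbrt s ^ 3 = s := by
  unfold cbrt
  rw [mul_pow, ← Real.rpow_natCast (|s| ^ (1 / 3 : ℝ)), ← Real.rpow_mul (abs_nonneg s)]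
  norm_num
  rcases lt_or_gt_of_ne hs with h | h
  · rw [Real.sign_of_neg h, abs_of_neg h]; ring
  · rw [Real.sign_of_pos h, abs_of_pos h]; ring

lemma cbrt_ne_zero {s : ℝ} (hs : s ≠ 0) : cbrt s ≠ 0 := by
  intro h
  have := cbrt_pow hs
  rw [h] at this
  exact hs (by rw [← this]; norm_num)

/-- On each half-line the real cube root is, up to sign, a real power of a positive argument. -/
lemma contDiffAt_cbrt {s : ℝ} (hs : s ≠ 0) : ContDiffAt ℝ ∞ cbrt s := by
  rcases lt_or_gt_of_ne hs with h | h
  · have h1 : ContDiffAt ℝ ∞ (fun r : ℝ => -(-r) ^ (1 / 3 : ℝ)) s :=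
      (contDiffAt_id.neg.rpow_const_of_ne (by simpa using hs)).neg
    refine h1.congr_of_eventuallyEq ?_
    filter_upwards [Iio_mem_nhds h] with r hr
    have hr : r < 0 := hr
    simp [cbrt, Real.sign_of_neg hr, abs_of_neg hr]
  · have h1 : ContDiffAt ℝ ∞ (fun r : ℝ => r ^ (1 / 3 : ℝ)) s :=
      contDiffAt_id.rpow_const_of_ne hs
    refine h1.congr_of_eventuallyEq ?_
    filter_upwards [Ioi_mem_nhds h] with r hr
    have hr : 0 < r := hr
    simp [cbrt, Real.sign_of_pos hr, abs_of_pos hr]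

section conformal
variable {H : ℝ} {D : Set ℂ} {x χ x' χ' : ℂ → V3} {α : ℂ → ℝ} {z : ℂ}

lemma IsConformal.rescaled (hD : IsOpen D) (hc : IsConformal H D x χ)
    (r : Rescaled D α x χ x' χ') : IsConformal H D x' χ' where
  toIsQuadricMap := r.isQuadricMap hc.toIsQuadricMap
  sq_eq_one := hc.sq_eq_one
  expU_pos := fun z hz => by
    rw [expU, r.hForm_eq hD hc.toIsQuadricMap hz]; exact hc.expU_pos z hz
  hForm_I_I := fun z hz => by
    simp only [r.hForm_eq hD hc.toIsQuadricMap hz]; exact hc.hForm_I_I z hz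
  hForm_I_one := fun z hz => by
    simp only [r.hForm_eq hD hc.toIsQuadricMap hz]; exact hc.hForm_I_one z hz

/-- The functions `c` and `u` depend on `h` alone and are invariant, while `ξ_z` and `x` are both
multiplied by the real factor. So the determinant changes by `α³` and can be normalized with a cube
root. -/
lemma IsConformal.frameM_rescaled (hD : IsOpen D) (hc : IsConformal H D x χ)
    (r : Rescaled D α x χ x' χ') (hz : z ∈ D) :
    frameM H x' χ' z = (α z : ℂ) • frameM H x χ z := by
  have q := hc.toIsQuadricMap
  have h1 : ∀ i, frameVec H x' χ' z i = (α z : ℂ) * frameVec H x χ z i := fun i => by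
    simp only [frameVec, cFun, expU, r.hForm_eq hD q hz, r.df_eq hD q hz]
    simp
    ring
  ext i j
  fin_cases j
  · exact h1 i
  · simp [frameM, h1]
  · simp [frameM, r.fst z hz]

/-- The determinant does not change when `R⁻¹` is moved to the right of the frame, and that product
is a real matrix. -/
lemma IsConformal.det_movingFrame_im (z : ℂ) : (movingFrame H x χ z).det.im = 0 := by
  rw [movingFrame_eq, Matrix.det_mul_comm]
  exact det_im_eq_zero (im_mul_inv_R (fun _ => rfl) fun i => by simp [frameM])

lemma IsConformal.det_movingFrame_re_ne_zero (hc : IsConformal H D x χ) (hz : z ∈ D) :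
    (movingFrame H x χ z).det.re ≠ 0 := by
  intro h
  have h1 : (movingFrame H x χ z).det = 0 := Complex.ext h (det_movingFrame_im z)
  have h2 := congrArg Matrix.det (hc.coframe_mul_frameM hz)
  rw [movingFrame_eq, Matrix.det_mul] at h1
  rw [Matrix.det_mul, Matrix.det_one] at h2
  rcases mul_eq_zero.mp h1 with h1 | h1
  · rw [Matrix.det_nonsing_inv, Ring.inverse_eq_inv'] at h1
    exact det_R_ne_zero (inv_eq_zero.mp h1)
  · rw [h1] at h2; simp at h2

/-- The normalized frame is the moving frame of a suitable lift. -/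
lemma exists_normalized_lift (hD : IsOpen D) {f : ℂ → DP2} (hl : IsLift D f x χ)
    (hc : IsConformal H D x χ) : ∃ x' χ' : ℂ → V3, IsLift D f x' χ' ∧ IsConformal H D x' χ' ∧
      ∀ z ∈ D, normalizedFrame H x χ z = R⁻¹ * frameM H x' χ' z ∧
        (frameM H x' χ' z).det = R.det := by
  let δ : ℂ → ℝ := fun z => (movingFrame H x χ z).det.re
  let α : ℂ → ℝ := fun z => (cbrt (δ z))⁻¹
  have hδ : ∀ z ∈ D, δ z ≠ 0 := fun z hz => hc.det_movingFrame_re_ne_zero hz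
  have hs : ContDiffOn ℝ ∞ δ D :=
    Complex.reCLM.contDiff.comp_contDiffOn
      ((MSmooth.const (D := D) R⁻¹).mul (hc.smooth_frameM hD)).det
  have hα : ContDiffOn ℝ ∞ α D :=
    ContDiffOn.inv (fun z hz => (contDiffAt_cbrt (hδ z hz)).comp_contDiffWithinAt z (hs z hz))
      fun z hz => cbrt_ne_zero (hδ z hz)
  have r : Rescaled D α x χ (fun z => α z • x z) (fun z => (α z)⁻¹ • χ z) :=
    ⟨hα, fun z hz => inv_ne_zero (cbrt_ne_zero (hδ z hz)), fun _ _ => rfl, fun _ _ => rfl⟩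
  refine ⟨_, _, r.isLift hl, hc.rescaled hD r, fun z hz => ⟨?_, ?_⟩⟩
  · rw [hc.frameM_rescaled hD r hz, Matrix.mul_smul]; rfl
  · have h1 : (movingFrame H x χ z).det = (δ z : ℂ) :=
      Complex.ext rfl (IsConformal.det_movingFrame_im z)
    rw [movingFrame_eq, Matrix.det_mul, Matrix.det_nonsing_inv, Ring.inverse_eq_inv',
      inv_mul_eq_iff_eq_mul₀ det_R_ne_zero] at h1
    rw [hc.frameM_rescaled hD r hz, Matrix.det_smul, h1, Fintype.card_fin]
    have h3 : α z ^ 3 * δ z = 1 := by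
      change (cbrt (δ z))⁻¹ ^ 3 * δ z = 1
      rw [inv_pow, cbrt_pow (hδ z hz), inv_mul_cancel₀ (hδ z hz)]
    have h4 : (α z : ℂ) ^ 3 * (δ z : ℂ) = 1 := by exact_mod_cast h3
    linear_combination R.det * h4

end conformal

lemma AdaptedFrame.isFrame {H : ℝ} {D : Set ℂ} {M : ℂ → M3} {t : ℂ → ℂ}
    (h : AdaptedFrame H D M t) : IsFrame D (fun z => R⁻¹ * M z) := by
  refine ⟨(MSmooth.const R⁻¹).mul h.smooth, fun z hz => ⟨?_, ?_⟩⟩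
  · rw [Matrix.det_mul, h.det_eq z hz, ← Matrix.det_mul, inv_mul_R, Matrix.det_one]
  · rw [← mul_assoc, R_mul_inv, one_mul]
    exact im_mul_inv_R (h.conj_zero z hz) (h.conj_two z hz)

/-! ### Primitive harmonic frames -/

/-- Expressing the entries as constant combinations makes a linear automorphism preserve smoothness
and commute with Wirtinger derivatives. -/
lemma linearMap_apply_eq_sum (κ : M3 →ₗ[ℂ] M3) (A : M3) (i j : Fin 3) :
    κ A i j = ∑ k, ∑ l, κ (Matrix.single k l 1) i j * A k l := by
  conv_lhs => rw [Matrix.matrix_eq_sum_single A]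
  rw [map_sum, Matrix.sum_apply]
  refine Finset.sum_congr rfl fun k _ => ?_
  rw [map_sum, Matrix.sum_apply]
  refine Finset.sum_congr rfl fun l _ => ?_
  have : Matrix.single k l (A k l) = A k l • Matrix.single k l (1 : ℂ) := by
    rw [Matrix.smul_single, smul_eq_mul, mul_one]
  rw [this, map_smul, Matrix.smul_apply, smul_eq_mul, mul_comm]

lemma MSmooth.linearMap {D : Set ℂ} {A : ℂ → M3} (hA : MSmooth D A) (κ : M3 →ₗ[ℂ] M3) :
    MSmooth D (fun y => κ (A y)) := by
  intro i j
  have h : ContDiffOn ℝ ∞ (fun y => ∑ k, ∑ l, κ (Matrix.single k l 1) i j * A y k l) D :=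
    ContDiffOn.sum fun k _ => ContDiffOn.sum fun l _ => contDiffOn_const.mul (hA k l)
  exact h.congr fun y _ => linearMap_apply_eq_sum κ _ _ _

lemma mwd_linearMap {D : Set ℂ} (hD : IsOpen D) {A : ℂ → M3} (hA : MSmooth D A)
    (κ : M3 →ₗ[ℂ] M3) {z : ℂ} (hz : z ∈ D) (θ : ℂ) :
    mwd θ (fun y => κ (A y)) z = κ (mwd θ A z) := by
  ext i j
  rw [linearMap_apply_eq_sum κ, mwd_apply]
  have hd := hA.diffAt hD hz
  have : (fun y => κ (A y) i j)
      = fun y => ∑ k, ∑ l, κ (Matrix.single k l 1) i j * A y k l := by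
    funext y; exact linearMap_apply_eq_sum κ _ _ _
  rw [this, wd_sum (G := fun k y => ∑ l, κ (Matrix.single k l 1) i j * A y k l) _
    fun k _ => DifferentiableAt.fun_sum fun l _ => (hd k l).const_mul _]
  refine Finset.sum_congr rfl fun k _ => ?_
  rw [wd_sum (G := fun l y => κ (Matrix.single k l 1) i j * A y k l) _
    fun l _ => (hd k l).const_mul _]
  exact Finset.sum_congr rfl fun l _ => wd_const_mul _ (hd k l)

/-- The components of the curvature of `λ⁻¹ α₋₁ dz + α₀' dz + α₀'' dz̄ + λ α₁ dz̄`. -/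
structure IsFlatFamily (D : Set ℂ) (am a0' a0'' ap : ℂ → M3) : Prop where
  plus : ∀ z ∈ D, mwd (-Complex.I) ap z + (a0' z * ap z - ap z * a0' z) = 0
  minus : ∀ z ∈ D, -mwd Complex.I am z + (am z * a0'' z - a0'' z * am z) = 0
  zero : ∀ z ∈ D, mwd (-Complex.I) a0'' z - mwd Complex.I a0' z +
    (a0' z * a0'' z - a0'' z * a0' z) + (am z * ap z - ap z * am z) = 0

section flat
variable {D : Set ℂ} {am a0' a0'' ap : ℂ → M3}

/-- The curvature is a Laurent polynomial in `λ` with exponents `-1`, `0`, `1`, because the two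
`λ`-dependent terms multiply to a term without `λ`. -/
lemma curvature_eq (hD : IsOpen D) (h1 : MSmooth D am) (h2 : MSmooth D a0') (h3 : MSmooth D a0'')
    (h4 : MSmooth D ap) {l : ℂ} (hl : l ≠ 0) {z : ℂ} (hz : z ∈ D) :
    dz (fun y => a0'' y + l • ap y) z - dzbar (fun y => l⁻¹ • am y + a0' y) z +
        ((l⁻¹ • am z + a0' z) * (a0'' z + l • ap z) -
          (a0'' z + l • ap z) * (l⁻¹ • am z + a0' z)) =
    l • (mwd (-Complex.I) ap z + (a0' z * ap z - ap z * a0' z)) +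
    l⁻¹ • (-mwd Complex.I am z + (am z * a0'' z - a0'' z * am z)) +
    (mwd (-Complex.I) a0'' z - mwd Complex.I a0' z +
      (a0' z * a0'' z - a0'' z * a0' z) + (am z * ap z - ap z * am z)) := by
  rw [dz_eq, dzbar_eq, mwd_add hD h3 (h4.smul l) hz, mwd_add hD (h1.smul _) h2 hz,
    mwd_smul hD l h4 hz, mwd_smul hD _ h1 hz]
  simp only [mul_add, add_mul, Matrix.smul_mul, Matrix.mul_smul, smul_smul, smul_add, smul_sub,
    smul_neg, mul_inv_cancel₀ hl, inv_mul_cancel₀ hl, one_smul]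
  abel

lemma isFlatFamily_iff (hD : IsOpen D) (h1 : MSmooth D am) (h2 : MSmooth D a0')
    (h3 : MSmooth D a0'') (h4 : MSmooth D ap) :
    (∀ l : ℂ, l ≠ 0 → ∀ z ∈ D,
      dz (fun y => a0'' y + l • ap y) z - dzbar (fun y => l⁻¹ • am y + a0' y) z +
        ((l⁻¹ • am z + a0' z) * (a0'' z + l • ap z) -
          (a0'' z + l • ap z) * (l⁻¹ • am z + a0' z)) = 0) ↔
    IsFlatFamily D am a0' a0'' ap := by
  constructor
  · intro h
    have key : ∀ z ∈ D, ∀ l : ℂ, l ≠ 0 →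
        l • (mwd (-Complex.I) ap z + (a0' z * ap z - ap z * a0' z)) +
        l⁻¹ • (-mwd Complex.I am z + (am z * a0'' z - a0'' z * am z)) +
        (mwd (-Complex.I) a0'' z - mwd Complex.I a0' z +
          (a0' z * a0'' z - a0'' z * a0' z) + (am z * ap z - ap z * am z)) = 0 := by
      intro z hz l hl
      rw [← curvature_eq hD h1 h2 h3 h4 hl hz]
      exact h l hl z hz
    have lin : ∀ X Y Z : M3, (∀ l : ℂ, l ≠ 0 → l • X + l⁻¹ • Y + Z = 0) →
        X = 0 ∧ Y = 0 ∧ Z = 0 := by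
      intro X Y Z h
      -- The values at `1`, `-1` and `i` separate the three coefficients.
      have e1 := h 1 one_ne_zero
      have e2 := h (-1) (by norm_num)
      have e3 := h Complex.I Complex.I_ne_zero
      rw [← Matrix.ext_iff, ← Matrix.ext_iff, ← Matrix.ext_iff, ← forall_and, ← forall_and]
      rw [← Matrix.ext_iff] at e1 e2 e3
      intro i
      rw [← forall_and, ← forall_and]
      intro j
      have f1 := e1 i j
      have f2 := e2 i j
      have f3 := e3 i j
      simp at f1 f2 f3
      have g1 : X i j + Y i j = 0 := by linear_combination (f1 - f2) / 2
      have g2 : Z i j = 0 := by linear_combination (f1 + f2) / 2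
      have g3 : Complex.I * X i j = 0 := by
        linear_combination (f3 + Complex.I * g1 - g2) / 2
      have g4 : X i j = 0 := by simpa using g3
      exact ⟨g4, by simpa [g4] using g1, g2⟩
    exact ⟨fun z hz => (lin _ _ _ (key z hz)).1, fun z hz => (lin _ _ _ (key z hz)).2.1,
      fun z hz => (lin _ _ _ (key z hz)).2.2⟩
  · intro h l hl z hz
    rw [curvature_eq hD h1 h2 h3 h4 hl hz, h.plus z hz, h.minus z hz, h.zero z hz]
    simp

lemma IsFlatFamily.congr {bm b0' b0'' bp : ℂ → M3} (hD : IsOpen D)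
    (h : IsFlatFamily D am a0' a0'' ap) (e1 : ∀ z ∈ D, bm z = am z) (e2 : ∀ z ∈ D, b0' z = a0' z)
    (e3 : ∀ z ∈ D, b0'' z = a0'' z) (e4 : ∀ z ∈ D, bp z = ap z) :
    IsFlatFamily D bm b0' b0'' bp where
  plus := fun z hz => by
    rw [mwd_congr_on hD e4 hz, e2 z hz, e4 z hz]; exact h.plus z hz
  minus := fun z hz => by
    rw [mwd_congr_on hD e1 hz, e1 z hz, e3 z hz]; exact h.minus z hz
  zero := fun z hz => by
    rw [mwd_congr_on hD e3 hz, mwd_congr_on hD e2 hz, e1 z hz, e2 z hz, e3 z hz, e4 z hz]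
    exact h.zero z hz

end flat

/-- Subtracting the identity from `κ` kills the fixed part and multiplies the other part by `η - 1`.
So the components of a decomposition are linear expressions in the Maurer–Cartan form, hence unique
and smooth. -/
lemma kappa_part {κ : M3 →ₗ[ℂ] M3} {ζ η : ℂ} (hη : η ≠ 1) {X Y Z : M3} (hY : κ Y = η • Y)
    (hZ : κ Z = ζ ^ (0 : ℤ) • Z) (h : X = Y + Z) : Y = (η - 1)⁻¹ • (κ X - X) := by
  rw [eq_inv_smul_iff₀ (sub_ne_zero.mpr hη), h, map_add, hY, hZ, sub_smul]
  simp

/-- The logarithmic derivatives of `F` decompose pointwise as in the definition of primitive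
harmonic maps. -/
def Decomposes (κ : M3 →ₗ[ℂ] M3) (ζ : ℂ) (a b : M3) : Prop :=
  ∃ am a0' a0'' ap : M3, am ∈ gSpace κ ζ (-1) ∧ a0' ∈ gSpace κ ζ 0 ∧ a0'' ∈ gSpace κ ζ 0 ∧
      ap ∈ gSpace κ ζ 1 ∧ a = am + a0' ∧ b = a0'' + ap

/-! ### Uniqueness of the components, automatic integrability, gauge invariance. -/

section PH
variable {κ : M3 →ₗ[ℂ] M3} {ζ : ℂ} {D : Set ℂ} {F : ℂ → M3}

/-- In a decomposition the components are determined. -/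
lemma isPrimitiveHarmonic_iff (hD : IsOpen D) (hζ : ζ ≠ 1) (hF : MSmooth D F)
    (h0 : ∀ z ∈ D, (F z).det ≠ 0) :
    IsPrimitiveHarmonic κ ζ D F ↔ ∃ am a0' a0'' ap : ℂ → M3,
      MSmooth D am ∧ MSmooth D a0' ∧ MSmooth D a0'' ∧ MSmooth D ap ∧
      (∀ z ∈ D, am z ∈ gSpace κ ζ (-1) ∧ a0' z ∈ gSpace κ ζ 0 ∧ a0'' z ∈ gSpace κ ζ 0 ∧
      ap z ∈ gSpace κ ζ 1 ∧ (F z)⁻¹ * mwd (-Complex.I) F z = am z + a0' z ∧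
        (F z)⁻¹ * mwd Complex.I F z = a0'' z + ap z) ∧ IsFlatFamily D am a0' a0'' ap := by
  have hζ' : ζ⁻¹ ≠ 1 := by simpa using hζ
  have ha : MSmooth D (fun z => (F z)⁻¹ * mwd (-Complex.I) F z) := (hF.inv h0).mul (hF.mwd hD _)
  have hb : MSmooth D (fun z => (F z)⁻¹ * mwd Complex.I F z) := (hF.inv h0).mul (hF.mwd hD _)
  constructor
  · rintro ⟨am, a0', a0'', ap, h, hl⟩
    have e1 : ∀ z ∈ D, am z = (ζ⁻¹ - 1)⁻¹ • (κ ((F z)⁻¹ * mwd (-Complex.I) F z)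
        - (F z)⁻¹ * mwd (-Complex.I) F z) := fun z hz => by
      obtain ⟨g1, g2, g3, g4, e, e'⟩ := h z hz
      exact kappa_part hζ' (by simpa using g1.2) g2.2 (by rw [← dz_eq, e])
    have e2 : ∀ z ∈ D, ap z = (ζ - 1)⁻¹ • (κ ((F z)⁻¹ * mwd Complex.I F z)
        - (F z)⁻¹ * mwd Complex.I F z) := fun z hz => by
      obtain ⟨g1, g2, g3, g4, e, e'⟩ := h z hz
      exact kappa_part hζ (by simpa using g4.2) g3.2 (by rw [← dzbar_eq, e', add_comm])
    have s1 : MSmooth D am := (((ha.linearMap κ).sub ha).smul _).congr e1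
    have s4 : MSmooth D ap := (((hb.linearMap κ).sub hb).smul _).congr e2
    have s2 : MSmooth D a0' := (ha.sub s1).congr fun z hz => by
      obtain ⟨g1, g2, g3, g4, e, e'⟩ := h z hz
      rw [← dz_eq, e]; abel
    have s3 : MSmooth D a0'' := (hb.sub s4).congr fun z hz => by
      obtain ⟨g1, g2, g3, g4, e, e'⟩ := h z hz
      rw [← dzbar_eq, e']; abel
    refine ⟨am, a0', a0'', ap, s1, s2, s3, s4, fun z hz => ?_,
      (isFlatFamily_iff hD s1 s2 s3 s4).mp hl⟩
    rw [← dz_eq, ← dzbar_eq]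
    exact h z hz
  · rintro ⟨am, a0', a0'', ap, s1, s2, s3, s4, h, hl⟩
    refine ⟨am, a0', a0'', ap, fun z hz => ?_, (isFlatFamily_iff hD s1 s2 s3 s4).mpr hl⟩
    rw [dz_eq, dzbar_eq]
    exact h z hz

lemma kappa_mwd (hD : IsOpen D) {A : ℂ → M3} (hA : MSmooth D A) {c : ℂ}
    (h : ∀ z ∈ D, κ (A z) = c • A z) (θ : ℂ) {z : ℂ} (hz : z ∈ D) :
    κ (mwd θ A z) = c • mwd θ A z := by
  rw [← mwd_linearMap hD hA κ hz, mwd_congr_on hD h hz, mwd_smul hD c hA hz]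

/-- This is the Maurer–Cartan equation, that is, flatness of the family at `λ = 1`; it gives only
the sum of the three components. -/
lemma flat_sum {am a0' a0'' ap : ℂ → M3} (hD : IsOpen D) (hF : MSmooth D F)
    (h0 : ∀ z ∈ D, (F z).det ≠ 0)
    (s1 : MSmooth D am) (s2 : MSmooth D a0') (s3 : MSmooth D a0'') (s4 : MSmooth D ap)
    (ha : ∀ z ∈ D, (F z)⁻¹ * mwd (-Complex.I) F z = am z + a0' z)
    (hb : ∀ z ∈ D, (F z)⁻¹ * mwd Complex.I F z = a0'' z + ap z) {z : ℂ} (hz : z ∈ D) :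
    (mwd (-Complex.I) ap z + (a0' z * ap z - ap z * a0' z)) +
    (-mwd Complex.I am z + (am z * a0'' z - a0'' z * am z)) +
    (mwd (-Complex.I) a0'' z - mwd Complex.I a0' z +
      (a0' z * a0'' z - a0'' z * a0' z) + (am z * ap z - ap z * am z)) = 0 := by
  have h := maurer_cartan hD hF h0 hz (-Complex.I) Complex.I
  rw [mwd_congr_on hD ha hz, mwd_congr_on hD hb hz, ha z hz, hb z hz, mwd_add hD s1 s2 hz,
    mwd_add hD s3 s4 hz] at h
  rw [← h]
  noncomm_ring

/-- Since `κ` is constant and preserves brackets, the three curvature components are eigenvectors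
for `ζ`, `ζ⁻¹` and `1`. These are distinct because `ζ² ≠ 1`, so a vanishing sum forces each
component to vanish. -/
lemma isFlatFamily_of_order {am a0' a0'' ap : ℂ → M3} (hD : IsOpen D) (hζ0 : ζ ≠ 0)
    (hζ : ζ ^ 2 ≠ 1)
    (hκ : ∀ X Y : M3, κ (X * Y - Y * X) = κ X * κ Y - κ Y * κ X) (hF : MSmooth D F)
    (h0 : ∀ z ∈ D, (F z).det ≠ 0)
    (s1 : MSmooth D am) (s2 : MSmooth D a0') (s3 : MSmooth D a0'') (s4 : MSmooth D ap)
    (h : ∀ z ∈ D, am z ∈ gSpace κ ζ (-1) ∧ a0' z ∈ gSpace κ ζ 0 ∧ a0'' z ∈ gSpace κ ζ 0 ∧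
      ap z ∈ gSpace κ ζ 1 ∧ (F z)⁻¹ * mwd (-Complex.I) F z = am z + a0' z ∧
        (F z)⁻¹ * mwd Complex.I F z = a0'' z + ap z) : IsFlatFamily D am a0' a0'' ap := by
  have k1 : ∀ z ∈ D, κ (am z) = ζ⁻¹ • am z := fun z hz => by simpa using (h z hz).1.2
  have k2 : ∀ z ∈ D, κ (a0' z) = (1 : ℂ) • a0' z := fun z hz => by simpa using (h z hz).2.1.2
  have k3 : ∀ z ∈ D, κ (a0'' z) = (1 : ℂ) • a0'' z := fun z hz => by simpa using (h z hz).2.2.1.2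
  have k4 : ∀ z ∈ D, κ (ap z) = ζ • ap z := fun z hz => by simpa using (h z hz).2.2.2.1.2
  have main : ∀ z ∈ D, _ ∧ _ ∧ _ := fun z hz => by
    have hs := flat_sum hD hF h0 s1 s2 s3 s4 (fun z hz => (h z hz).2.2.2.2.1)
      (fun z hz => (h z hz).2.2.2.2.2) hz
    set C1 := mwd (-Complex.I) ap z + (a0' z * ap z - ap z * a0' z) with hC1
    set Cm := -mwd Complex.I am z + (am z * a0'' z - a0'' z * am z) with hCm
    set C0 := mwd (-Complex.I) a0'' z - mwd Complex.I a0' z +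
      (a0' z * a0'' z - a0'' z * a0' z) + (am z * ap z - ap z * am z) with hC0
    have e1 : κ C1 = ζ • C1 := by
      rw [hC1, map_add, hκ, kappa_mwd hD s4 k4 _ hz, k2 z hz, k4 z hz]
      simp [smul_sub]
    have em : κ Cm = ζ⁻¹ • Cm := by
      rw [hCm, map_add, map_neg, hκ, kappa_mwd hD s1 k1 _ hz, k1 z hz, k3 z hz]
      simp [smul_sub]
    have e0 : κ C0 = C0 := by
      rw [hC0, map_add, map_add, map_sub, hκ, hκ, kappa_mwd hD s2 k2 _ hz,
        kappa_mwd hD s3 k3 _ hz, k1 z hz, k2 z hz, k3 z hz, k4 z hz]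
      simp [smul_smul, hζ0]
    have f1 := congrArg κ hs
    rw [map_add, map_add, e1, em, e0, map_zero] at f1
    have f2 := congrArg κ f1
    rw [map_add, map_add, map_smul, map_smul, e1, em, e0, map_zero] at f2
    have hz1 : ζ - 1 ≠ 0 := fun h => hζ (by rw [sub_eq_zero.mp h]; norm_num)
    have hz2 : ζ ^ 2 - 1 ≠ 0 := sub_ne_zero.mpr hζ
    have g1 : C1 = 0 := by
      ext i j
      have a1 := congrFun (congrFun hs i) j
      have a2 := congrFun (congrFun f1 i) j
      have a3 := congrFun (congrFun f2 i) j
      simp only [Matrix.add_apply, Matrix.smul_apply, smul_eq_mul, Matrix.zero_apply] at a1 a2 a3 ⊢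
      have hi : ζ * ζ⁻¹ = 1 := mul_inv_cancel₀ hζ0
      -- The operator `(1 - κ)(1 - ζ κ)` kills the eigenspaces for `1` and `ζ⁻¹` and acts on the
      -- remaining one by `(ζ² - 1)(ζ - 1)`.
      have : (ζ ^ 2 - 1) * (ζ - 1) * C1 i j = 0 := by
        linear_combination (1 : ℂ) * a1 - (ζ + 1) * a2 + ζ * a3 +
          (1 - ζ⁻¹) * Cm i j * hi
      simpa [hz1, hz2] using this
    have gm : Cm = 0 := by
      ext i j
      have a1 := congrFun (congrFun hs i) j
      have a2 := congrFun (congrFun f1 i) j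
      rw [g1] at a1 a2
      simp only [Matrix.add_apply, Matrix.smul_apply, smul_eq_mul, Matrix.zero_apply] at a1 a2 ⊢
      have hi : ζ * ζ⁻¹ = 1 := mul_inv_cancel₀ hζ0
      have : (ζ - 1) * Cm i j = 0 := by
        linear_combination ζ * a1 - ζ * a2 + Cm i j * hi
      simpa [hz1] using this
    rw [g1, gm] at hs
    exact ⟨g1, gm, by simpa using hs⟩
  exact ⟨fun z hz => (main z hz).1, fun z hz => (main z hz).2.1, fun z hz => (main z hz).2.2⟩

/-- If the order of the automorphism is at least three, the integrability is automatic. -/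
lemma isPrimitiveHarmonic_iff_decomposes (hD : IsOpen D) (hζ0 : ζ ≠ 0) (hζ : ζ ^ 2 ≠ 1)
    (hκ : ∀ X Y : M3, κ (X * Y - Y * X) = κ X * κ Y - κ Y * κ X) (hF : MSmooth D F)
    (h0 : ∀ z ∈ D, (F z).det ≠ 0) :
    IsPrimitiveHarmonic κ ζ D F ↔ ∀ z ∈ D,
      Decomposes κ ζ ((F z)⁻¹ * mwd (-Complex.I) F z) ((F z)⁻¹ * mwd Complex.I F z) := by
  have hz1 : ζ ≠ 1 := fun h => hζ (by rw [h]; norm_num)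
  have hζ' : ζ⁻¹ ≠ 1 := by simpa using hz1
  have ha : MSmooth D (fun z => (F z)⁻¹ * mwd (-Complex.I) F z) := (hF.inv h0).mul (hF.mwd hD _)
  have hb : MSmooth D (fun z => (F z)⁻¹ * mwd Complex.I F z) := (hF.inv h0).mul (hF.mwd hD _)
  rw [isPrimitiveHarmonic_iff hD hz1 hF h0]
  constructor
  · rintro ⟨am, a0', a0'', ap, -, -, -, -, h, -⟩ z hz
    exact ⟨_, _, _, _, h z hz⟩
  · intro h
    choose! am a0' a0'' ap h using h
    have s1 : MSmooth D am := (((ha.linearMap κ).sub ha).smul (ζ⁻¹ - 1)⁻¹).congr fun z hz => by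
      obtain ⟨g1, g2, g3, g4, e, e'⟩ := h z hz
      exact kappa_part hζ' (by simpa using g1.2) g2.2 e
    have s4 : MSmooth D ap := (((hb.linearMap κ).sub hb).smul (ζ - 1)⁻¹).congr fun z hz => by
      obtain ⟨g1, g2, g3, g4, e, e'⟩ := h z hz
      exact kappa_part hz1 (by simpa using g4.2) g3.2 (by rw [e', add_comm])
    have s2 : MSmooth D a0' := (ha.sub s1).congr fun z hz => by
      obtain ⟨g1, g2, g3, g4, e, e'⟩ := h z hz
      rw [e]; abel
    have s3 : MSmooth D a0'' := (hb.sub s4).congr fun z hz => by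
      obtain ⟨g1, g2, g3, g4, e, e'⟩ := h z hz
      rw [e']; abel
    exact ⟨am, a0', a0'', ap, s1, s2, s3, s4, h,
      isFlatFamily_of_order hD hζ0 hζ hκ hF h0 s1 s2 s3 s4 h⟩

/-- Gauge invariance. -/
lemma IsPrimitiveHarmonic.gauge (hD : IsOpen D) (hζ : ζ ≠ 1) (hF : MSmooth D F)
    (h0 : ∀ z ∈ D, (F z).det ≠ 0) {K : ℂ → M3} (hK : MSmooth D K) (hK0 : ∀ z ∈ D, (K z).det = 1)
    (hκ : ∀ z ∈ D, ∀ X : M3, κ ((K z)⁻¹ * X * K z) = (K z)⁻¹ * κ X * K z)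
    (hκ' : ∀ z ∈ D, ∀ θ, κ ((K z)⁻¹ * mwd θ K z) = (K z)⁻¹ * mwd θ K z)
    (h : IsPrimitiveHarmonic κ ζ D F) : IsPrimitiveHarmonic κ ζ D (fun z => F z * K z) := by
  have hK1 : ∀ z ∈ D, (K z).det ≠ 0 := fun z hz => by rw [hK0 z hz]; exact one_ne_zero
  have hL := hK.inv hK1
  have hKL : ∀ z ∈ D, K z * (K z)⁻¹ = 1 := fun z hz =>
    Matrix.mul_nonsing_inv _ (isUnit_iff_ne_zero.mpr (hK1 z hz))
  have hFL : ∀ z ∈ D, (F z)⁻¹ * F z = 1 := fun z hz =>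
    Matrix.nonsing_inv_mul _ (isUnit_iff_ne_zero.mpr (h0 z hz))
  rw [isPrimitiveHarmonic_iff hD hζ hF h0] at h
  rw [isPrimitiveHarmonic_iff hD hζ (hF.mul hK) fun z hz => by
    rw [Matrix.det_mul]; exact mul_ne_zero (h0 z hz) (hK1 z hz)]
  obtain ⟨am, a0', a0'', ap, s1, s2, s3, s4, h, hf⟩ := h
  have tr : ∀ z ∈ D, ∀ X : M3, ((K z)⁻¹ * X * K z).trace = X.trace := fun z hz X => by
    rw [Matrix.trace_mul_comm, ← mul_assoc, hKL z hz, one_mul]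
  have tr' : ∀ z ∈ D, ∀ θ, ((K z)⁻¹ * mwd θ K z).trace = 0 := fun z hz θ =>
    trace_inv_mul_mwd hD hK hK0 hz
  have gc : ∀ z ∈ D, ∀ X m, X ∈ gSpace κ ζ m → (K z)⁻¹ * X * K z ∈ gSpace κ ζ m :=
    fun z hz X m hX => ⟨by rw [tr z hz]; exact hX.1, by
      rw [hκ z hz, hX.2, Matrix.mul_smul, Matrix.smul_mul]⟩
  have gc' : ∀ z ∈ D, ∀ X θ, X ∈ gSpace κ ζ 0 →
      (K z)⁻¹ * X * K z + (K z)⁻¹ * mwd θ K z ∈ gSpace κ ζ 0 := fun z hz X θ hX =>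
    ⟨by rw [Matrix.trace_add, (gc z hz X 0 hX).1, tr' z hz, add_zero], by
      rw [map_add, (gc z hz X 0 hX).2, hκ' z hz]; simp⟩
  have e : ∀ z ∈ D, ∀ θ, (F z * K z)⁻¹ * mwd θ (fun y => F y * K y) z
      = (K z)⁻¹ * ((F z)⁻¹ * mwd θ F z) * K z + (K z)⁻¹ * mwd θ K z := fun z hz θ => by
    rw [mwd_mul hD hF hK hz, Matrix.mul_inv_rev, mul_add, mul_assoc (K z)⁻¹ (F z)⁻¹ (F z * _),
      ← mul_assoc (F z)⁻¹ (F z), hFL z hz, one_mul]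
    simp only [mul_assoc]
  refine ⟨fun z => (K z)⁻¹ * am z * K z, fun z => (K z)⁻¹ * a0' z * K z
      + (K z)⁻¹ * mwd (-Complex.I) K z, fun z => (K z)⁻¹ * a0'' z * K z
      + (K z)⁻¹ * mwd Complex.I K z, fun z => (K z)⁻¹ * ap z * K z,
      (hL.mul s1).mul hK, ((hL.mul s2).mul hK).add (hL.mul (hK.mwd hD _)),
      ((hL.mul s3).mul hK).add (hL.mul (hK.mwd hD _)), (hL.mul s4).mul hK, fun z hz => ?_, ?_⟩
  · obtain ⟨g1, g2, g3, g4, e1, e2⟩ := h z hz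
    refine ⟨gc z hz _ _ g1, gc' z hz _ _ g2, gc' z hz _ _ g3, gc z hz _ _ g4, ?_, ?_⟩
    · rw [e z hz, e1]; noncomm_ring
    · rw [e z hz, e2]; noncomm_ring
  -- Differentiation commutes with conjugation by `K` up to a bracket with `K⁻¹ dK`, which is
  -- absorbed by the inhomogeneous term of the new `𝔤₀`-part.
  · have dc : ∀ z ∈ D, ∀ θ, ∀ A : ℂ → M3, MSmooth D A →
        mwd θ (fun y => (K y)⁻¹ * A y * K y) z = (K z)⁻¹ * mwd θ A z * K z +
          ((K z)⁻¹ * A z * K z * ((K z)⁻¹ * mwd θ K z)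
            - (K z)⁻¹ * mwd θ K z * ((K z)⁻¹ * A z * K z)) := fun z hz θ A hA => by
      have h1 : K z * ((K z)⁻¹ * mwd θ K z) = mwd θ K z := by
        rw [← mul_assoc, hKL z hz, one_mul]
      rw [mwd_mul hD (hL.mul hA) hK hz, mwd_mul hD hL hA hz, mwd_inv hD hK hK1 hz,
        mul_assoc ((K z)⁻¹ * A z) (K z), h1]
      noncomm_ring
    have cc : ∀ z ∈ D, ∀ X Y : M3, (K z)⁻¹ * X * K z * ((K z)⁻¹ * Y * K z)
        = (K z)⁻¹ * (X * Y) * K z := fun z hz X Y => by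
      calc _ = (K z)⁻¹ * X * (K z * (K z)⁻¹) * Y * K z := by noncomm_ring
        _ = _ := by rw [hKL z hz]; noncomm_ring
    have conj0 : ∀ z, ∀ X : M3, X = 0 → (K z)⁻¹ * X * K z = 0 := fun z X hX => by
      rw [hX]; simp
    refine ⟨fun z hz => ?_, fun z hz => ?_, fun z hz => ?_⟩
    · rw [dc z hz _ _ s4, ← conj0 z _ (hf.plus z hz)]
      simp only [mul_add, add_mul, mul_sub, sub_mul, ← cc z hz]
      abel
    · rw [dc z hz _ _ s1, ← conj0 z _ (hf.minus z hz)]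
      simp only [mul_add, add_mul, mul_sub, sub_mul, ← cc z hz, mul_neg, neg_mul]
      abel
    -- In the component free of `λ` the inhomogeneous terms also produce the curvature of `K⁻¹ dK`,
    -- which is zero.
    · have mc := maurer_cartan hD hK hK1 hz (-Complex.I) Complex.I
      rw [mwd_add hD ((hL.mul s3).mul hK) (hL.mul (hK.mwd hD _)) hz,
        mwd_add hD ((hL.mul s2).mul hK) (hL.mul (hK.mwd hD _)) hz, dc z hz _ _ s3, dc z hz _ _ s2]
      rw [← conj0 z _ (hf.zero z hz), ← sub_eq_zero, ← mc]
      simp only [mul_add, add_mul, mul_sub, sub_mul, ← cc z hz]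
      abel

end PH

/-! ### Scalar structure equations -/

/-- The `dz`-part of the Maurer–Cartan form of an adapted frame. -/
def mcZ (H : ℝ) (p q A B t : ℂ) : M3 := !![p, A, t; B, q, 0; 0, -H * conj t, -(p + q)]

/-- The `dz̄`-part of the Maurer–Cartan form of an adapted frame. -/
def mcZbar (H : ℝ) (p q A B t : ℂ) : M3 :=
  !![conj q, conj B, 0; conj A, conj p, conj t; -H * t, 0, -(conj p + conj q)]

/-- The compatibility equations of the coefficients of an adapted frame. -/
structure StructureEqs (H : ℝ) (D : Set ℂ) (p q A B t : ℂ → ℂ) : Prop where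
  isOpen : IsOpen D
  sq_eq_one : (H : ℂ) * H = 1
  smooth_p : ContDiffOn ℝ ∞ p D
  smooth_q : ContDiffOn ℝ ∞ q D
  smooth_A : ContDiffOn ℝ ∞ A D
  smooth_B : ContDiffOn ℝ ∞ B D
  smooth_t : ContDiffOn ℝ ∞ t D
  re_pos : ∀ z ∈ D, 0 < (t z).re
  re_sq_pos : ∀ z ∈ D, 0 < (t z ^ 2).re
  tbar : ∀ z ∈ D, wd Complex.I t z = A z * conj (t z) - t z * (conj (p z) + 2 * conj (q z))
  tz : ∀ z ∈ D, wd (-Complex.I) t z = t z * (2 * p z + q z) - conj (t z) * conj (A z)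
  psi : ∀ z ∈ D, wd Complex.I p z + wd Complex.I q z - conj (wd Complex.I p z + wd Complex.I q z)
    = H * (conj (t z) ^ 2 - t z ^ 2)
  gauss : ∀ z ∈ D, conj (wd Complex.I q z) - wd Complex.I p z + A z * conj (A z)
    - B z * conj (B z) - H * t z ^ 2 = 0
  codazzi : ∀ z ∈ D, conj (wd Complex.I B z) - wd Complex.I A z + (p z - q z) * conj (B z)
    + (conj (p z) - conj (q z)) * A z = 0

/-- The permutation matrix of the first two basis vectors. -/
def J : M3 := !![0, 1, 0; 1, 0, 0; 0, 0, 1]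

lemma J_mul_J : J * J = 1 := by
  ext i j; fin_cases i <;> fin_cases j <;> simp [J, Matrix.mul_apply, Fin.sum_univ_three]

section adapted
variable {H : ℝ} {D : Set ℂ} {M : ℂ → M3} {t : ℂ → ℂ} {z : ℂ}

lemma AdaptedFrame.det_ne_zero (h : AdaptedFrame H D M t) : ∀ z ∈ D, (M z).det ≠ 0 :=
  fun z hz => by rw [h.det_eq z hz]; exact det_R_ne_zero

/-- The first two columns are conjugate to each other and the third is real. -/
lemma AdaptedFrame.map_conj (h : AdaptedFrame H D M t) (hz : z ∈ D) :
    (M z).map conj = M z * J := by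
  have h1 : ∀ i, conj (M z i 1) = M z i 0 := fun i => by
    rw [← h.conj_zero z hz, Complex.conj_conj]
  ext i j
  fin_cases j <;> simp [J, Matrix.mul_apply, Fin.sum_univ_three, h1, h.conj_zero z hz,
    h.conj_two z hz]

lemma mwd_map_conj (hD : IsOpen D) {A : ℂ → M3} (hA : MSmooth D A) (hz : z ∈ D) (θ : ℂ) :
    mwd θ (fun y => (A y).map conj) z = (mwd (conj θ) A z).map conj := by
  ext i j
  exact wd_conj (hA.diffAt hD hz i j)

/-- Conjugation interchanges `∂_z` and `∂_z̄` and replaces `M` by `M J`; hence one half of the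
Maurer–Cartan form determines the other. -/
lemma AdaptedFrame.mc_conj (h : AdaptedFrame H D M t) (hz : z ∈ D) :
    (M z)⁻¹ * mwd Complex.I M z = J * ((M z)⁻¹ * mwd (-Complex.I) M z).map conj * J := by
  have hu : IsUnit (M z).det := isUnit_iff_ne_zero.mpr (h.det_ne_zero z hz)
  have e0 : ((M z)⁻¹).map conj * (M z).map conj = 1 := by
    have := congrArg (starRingEnd ℂ).mapMatrix (Matrix.nonsing_inv_mul _ hu)
    rwa [map_mul, map_one] at this
  have e1 : (M z)⁻¹ = J * ((M z)⁻¹).map conj := by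
    refine Matrix.inv_eq_left_inv ?_
    rw [h.map_conj hz] at e0
    calc J * ((M z)⁻¹).map conj * M z = J * (((M z)⁻¹).map conj * (M z * J)) * J := by
          simp only [mul_assoc, J_mul_J, mul_one]
      _ = 1 := by rw [e0, mul_one, J_mul_J]
  have e2 : mwd Complex.I M z = (mwd (-Complex.I) M z).map conj * J := by
    have h1 := mwd_map_conj h.isOpen h.smooth hz Complex.I
    rw [mwd_congr_on h.isOpen (fun y hy => h.map_conj hy) hz,
      mwd_mul_const h.isOpen J h.smooth hz, Complex.conj_I] at h1
    rw [← h1, mul_assoc, J_mul_J, mul_one]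
  have e3 : ((M z)⁻¹ * mwd (-Complex.I) M z).map conj
      = ((M z)⁻¹).map conj * (mwd (-Complex.I) M z).map conj :=
    map_mul (starRingEnd ℂ).mapMatrix _ _
  conv_lhs => rw [e1, e2]
  rw [e3]
  simp only [mul_assoc]

/-- The coefficients of the Maurer–Cartan form. -/
def coeff (M : ℂ → M3) (i j : Fin 3) (z : ℂ) : ℂ := ((M z)⁻¹ * mwd (-Complex.I) M z) i j

lemma AdaptedFrame.mc_z (h : AdaptedFrame H D M t) (hz : z ∈ D) :
    (M z)⁻¹ * mwd (-Complex.I) M z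
      = mcZ H (coeff M 0 0 z) (coeff M 1 1 z) (coeff M 0 1 z) (coeff M 1 0 z) (t z) := by
  have ht := trace_inv_mul_mwd h.isOpen h.smooth h.det_eq hz (θ := -Complex.I)
  rw [Matrix.trace_fin_three] at ht
  ext i j
  fin_cases i <;> fin_cases j
  · rfl
  · rfl
  · exact h.entry02 z hz
  · rfl
  · rfl
  · exact h.entry12 z hz
  · exact h.entry20 z hz
  · exact h.entry21 z hz
  · simp only [mcZ, coeff]
    simp
    linear_combination ht

lemma mcZ_conj (H : ℝ) (p q A B t : ℂ) :
    J * (mcZ H p q A B t).map conj * J = mcZbar H p q A B t := by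
  ext i j
  simp only [Matrix.mul_apply, Fin.sum_univ_three, Matrix.map_apply, J, mcZ, mcZbar]
  fin_cases i <;> fin_cases j <;> simp

lemma AdaptedFrame.mc_zbar (h : AdaptedFrame H D M t) (hz : z ∈ D) :
    (M z)⁻¹ * mwd Complex.I M z
      = mcZbar H (coeff M 0 0 z) (coeff M 1 1 z) (coeff M 0 1 z) (coeff M 1 0 z) (t z) := by
  rw [h.mc_conj hz, h.mc_z hz, mcZ_conj]

lemma AdaptedFrame.smooth_coeff (h : AdaptedFrame H D M t) (i j : Fin 3) :
    ContDiffOn ℝ ∞ (coeff M i j) D :=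
  ((h.smooth.inv h.det_ne_zero).mul (h.smooth.mwd h.isOpen _)) i j

/-- These are entries of the Maurer–Cartan equation: `(0,2)` and `(2,0)` give the two derivatives of
`t`, `(2,2)` the derivative of `ψ`, `(0,0)` the Gauss equation and `(0,1)` the Codazzi equation. -/
lemma AdaptedFrame.structureEqs (h : AdaptedFrame H D M t) :
    StructureEqs H D (coeff M 0 0) (coeff M 1 1) (coeff M 0 1) (coeff M 1 0) t := by
  have hD := h.isOpen
  have sp := h.smooth_coeff 0 0
  have sq := h.smooth_coeff 1 1
  have sA := h.smooth_coeff 0 1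
  have sB := h.smooth_coeff 1 0
  have st := h.smooth_t
  have mc : ∀ z ∈ D, _ := fun z hz =>
    maurer_cartan hD h.smooth h.det_ne_zero hz (-Complex.I) Complex.I
  have key : ∀ z ∈ D, ∀ i j,
      wd (-Complex.I) (fun y => mcZbar H (coeff M 0 0 y) (coeff M 1 1 y) (coeff M 0 1 y)
        (coeff M 1 0 y) (t y) i j) z
      - wd Complex.I (fun y => mcZ H (coeff M 0 0 y) (coeff M 1 1 y) (coeff M 0 1 y)
        (coeff M 1 0 y) (t y) i j) z
      + (mcZ H (coeff M 0 0 z) (coeff M 1 1 z) (coeff M 0 1 z) (coeff M 1 0 z) (t z)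
          * mcZbar H (coeff M 0 0 z) (coeff M 1 1 z) (coeff M 0 1 z) (coeff M 1 0 z) (t z)
        - mcZbar H (coeff M 0 0 z) (coeff M 1 1 z) (coeff M 0 1 z) (coeff M 1 0 z) (t z)
          * mcZ H (coeff M 0 0 z) (coeff M 1 1 z) (coeff M 0 1 z) (coeff M 1 0 z) (t z)) i j
      = 0 := fun z hz i j => by
    have := congrFun (congrFun (mc z hz) i) j
    rw [mwd_congr_on hD (fun y hy => h.mc_z hy) hz, mwd_congr_on hD (fun y hy => h.mc_zbar hy) hz,
      h.mc_z hz, h.mc_zbar hz] at this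
    exact this
  have hc : ∀ g : ℂ → ℂ, ContDiffOn ℝ ∞ g D → ∀ z ∈ D,
      wd (-Complex.I) (fun y => conj (g y)) z = conj (wd Complex.I g z) := fun g hg z hz => by
    rw [wd_conj (diffAt_of_smooth hD hg hz)]; simp
  refine ⟨hD, h.sq_eq_one, sp, sq, sA, sB, st, h.re_pos, h.re_sq_pos, ?_, ?_, ?_, ?_, ?_⟩ <;>
    intro z hz
  · have := key z hz 0 2
    simp [mcZ, mcZbar, wd_const] at this
    linear_combination -this
  · have := key z hz 2 0
    simp [mcZ, mcZbar, wd_const] at this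
    rw [wd_neg, wd_const_mul _ (diffAt_of_smooth hD st hz)] at this
    linear_combination -H * this + (-wd (-Complex.I) t z
      + 2 * t z * coeff M 0 0 z + t z * coeff M 1 1 z
      - conj (t z) * conj (coeff M 0 1 z)) * h.sq_eq_one
  · have := key z hz 2 2
    have dp := hasWd (θ := Complex.I) (diffAt_of_smooth hD sp hz)
    have dq := hasWd (θ := Complex.I) (diffAt_of_smooth hD sq hz)
    have e1 := (dp.add dq).neg.2
    have e2 := ((HasWd.conj (θ := -Complex.I) (by simpa using dp)).add
      (HasWd.conj (θ := -Complex.I) (by simpa using dq))).neg.2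
    simp only [mcZ, mcZbar, Matrix.of_apply, Matrix.cons_val] at this e1 e2
    rw [e1, e2] at this
    simp at this
    simp only [map_add]
    linear_combination this
  · have := key z hz 0 0
    simp [mcZ, mcZbar] at this
    rw [hc _ sq z hz] at this
    linear_combination this
  · have := key z hz 0 1
    simp [mcZ, mcZbar] at this
    rw [hc _ sB z hz] at this
    linear_combination this

end adapted

/-! ### The automorphism -/

lemma eps_pow_three : eps ^ 3 = -1 := by
  unfold eps
  rw [← Complex.exp_nat_mul]
  have : ((3 : ℕ) : ℂ) * (Complex.I * (Real.pi : ℂ) / 3) = Real.pi * Complex.I := by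
    push_cast; ring
  rw [this, Complex.exp_pi_mul_I]

lemma eps_ne_neg_one : eps + 1 ≠ 0 := by
  intro h
  have h1 := congrArg Complex.re h
  have : Complex.I * (Real.pi : ℂ) / 3 = ((Real.pi / 3 : ℝ) : ℂ) * Complex.I := by
    push_cast; ring
  rw [eps, this, Complex.add_re, Complex.exp_ofReal_mul_I_re, Real.cos_pi_div_three] at h1
  norm_num at h1

/-- The equation `ε³ = -1` factors, and `ε ≠ -1` leaves the sixth cyclotomic polynomial. With it all
powers of `ε` reduce to degree one. -/
lemma eps_sq : eps ^ 2 = eps - 1 := by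
  have h : (eps + 1) * (eps ^ 2 - eps + 1) = 0 := by linear_combination eps_pow_three
  rcases mul_eq_zero.mp h with h | h
  · exact absurd h eps_ne_neg_one
  · linear_combination h

lemma eps_pow_four : eps ^ 4 = -eps := by linear_combination eps * eps_pow_three

lemma eps_ne_zero : eps ≠ 0 := Complex.exp_ne_zero _

lemma eps_inv : eps⁻¹ = 1 - eps :=
  inv_eq_of_mul_eq_one_right (by linear_combination -eps_sq)

lemma eps_sq_ne_one : eps ^ 2 ≠ 1 := by
  intro h
  have h3 := eps_pow_three
  have : eps = -1 := by rw [pow_succ, h, one_mul] at h3; exact h3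
  exact eps_ne_neg_one (by rw [this]; norm_num)

lemma eps_pow_four_ne_one : eps ^ 4 ≠ 1 := by
  rw [eps_pow_four]
  intro h
  exact eps_ne_neg_one (by linear_combination -h)

/-- `σ_H` as a linear map. -/
def sigmaL (H : ℝ) : M3 →ₗ[ℂ] M3 where
  toFun := sigma H
  map_add' X Y := by simp [sigma, mul_add, add_mul]; abel
  map_smul' c X := by simp [sigma]

lemma P_mul_P {H : ℝ} (hH : (H : ℂ) * H = 1) : P H * P H = 1 := by
  have h : eps ^ 2 * eps ^ 4 = 1 := by linear_combination (eps ^ 3 - 1) * eps_pow_three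
  ext i j
  fin_cases i <;> fin_cases j <;> simp [P, Matrix.mul_apply, Fin.sum_univ_three, hH, h]
  rw [mul_comm, h]

/-- The negative transpose is an automorphism of the Lie algebra, and so is conjugation by `P`,
which is its own inverse. -/
lemma sigma_bracket {H : ℝ} (hH : (H : ℂ) * H = 1) (X Y : M3) :
    sigmaL H (X * Y - Y * X) = sigmaL H X * sigmaL H Y - sigmaL H Y * sigmaL H X := by
  have key : ∀ X Y : M3, P H * X * P H * (P H * Y * P H) = P H * (X * Y) * P H := fun X Y => by
    calc _ = P H * X * (P H * P H) * Y * P H := by noncomm_ring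
      _ = _ := by rw [P_mul_P hH]; noncomm_ring
  change -(P H * (X * Y - Y * X)ᵀ * P H) = -(P H * Xᵀ * P H) * -(P H * Yᵀ * P H)
    - -(P H * Yᵀ * P H) * -(P H * Xᵀ * P H)
  rw [neg_mul_neg, neg_mul_neg, key, key, Matrix.transpose_sub, Matrix.transpose_mul,
    Matrix.transpose_mul]
  noncomm_ring

lemma sigma_pow_bracket {H : ℝ} (hH : (H : ℂ) * H = 1) (n : ℕ) (X Y : M3) :
    ((sigmaL H) ^ n) (X * Y - Y * X)
      = ((sigmaL H) ^ n) X * ((sigmaL H) ^ n) Y - ((sigmaL H) ^ n) Y * ((sigmaL H) ^ n) X := by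
  induction n with
  | zero => rfl
  | succ n ih => rw [pow_succ', Module.End.mul_apply, ih, sigma_bracket hH]; rfl

lemma isPrimitiveHarmonicSigma_iff (H : ℝ) (n : ℕ) (D : Set ℂ) (F : ℂ → M3) :
    IsPrimitiveHarmonicSigma H n D F ↔
      IsPrimitiveHarmonic (sigmaL H ^ n : M3 →ₗ[ℂ] M3) (eps ^ n) D F := by
  rw [Module.End.coe_pow]; rfl

lemma sigma_eq {H : ℝ} (hH : (H : ℂ) * H = 1) (X : M3) : sigmaL H X =
    !![-X 1 1, eps * X 0 1, H * eps ^ 2 * X 2 1;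
       -eps ^ 2 * X 1 0, -X 0 0, -H * eps * X 2 0;
       -H * eps * X 1 2, H * eps ^ 2 * X 0 2, -X 2 2] := by
  have h3 := eps_pow_three
  have e : sigmaL H X = -(P H * Xᵀ * P H) := rfl
  rw [e]
  ext i j
  simp only [Matrix.neg_apply, Matrix.mul_apply, Fin.sum_univ_three, P, Matrix.transpose_apply]
  fin_cases i <;> fin_cases j <;> simp
  · linear_combination (eps ^ 3 - 1) * X 1 1 * h3
  · linear_combination -eps * X 0 1 * h3
  · ring
  · linear_combination (eps ^ 2) * (eps ^ 3 - 1) * X 1 0 * h3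
  · linear_combination (eps ^ 3 - 1) * X 0 0 * h3
  · linear_combination H * eps * X 2 0 * h3
  · linear_combination H * eps * X 1 2 * h3
  · ring
  · linear_combination X 2 2 * hH

/-- The square acts diagonally on entries. With `ζ = ε²`, the positions `(0,2)`, `(1,0)`, `(2,1)`
belong to `𝔤₋₁`, their transposes to `𝔤₁`, and the diagonal to `𝔤₀`. -/
lemma sigma_two_eq {H : ℝ} (hH : (H : ℂ) * H = 1) (X : M3) : (sigmaL H ^ 2) X =
    !![X 0 0, eps ^ 2 * X 0 1, -eps * X 0 2;
       -eps * X 1 0, X 1 1, eps ^ 2 * X 1 2;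
       eps ^ 2 * X 2 0, -eps * X 2 1, X 2 2] := by
  have h3 := eps_pow_three
  rw [pow_two, Module.End.mul_apply, sigma_eq hH, sigma_eq hH]
  ext i j
  fin_cases i <;> fin_cases j <;> simp
  · ring
  · linear_combination eps ^ 4 * X 0 2 * hH + eps * X 0 2 * h3
  · linear_combination eps * X 1 0 * h3
  · linear_combination eps ^ 2 * X 1 2 * hH
  · linear_combination eps ^ 2 * X 2 0 * hH
  · linear_combination eps ^ 4 * X 2 1 * hH + eps * X 2 1 * h3

/-- All powers of `ε` disappear; this is the Cartan involution type symmetry `X ↦ -S Xᵀ S` with an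
explicit constant matrix `S`. -/
lemma sigma_three_eq {H : ℝ} (hH : (H : ℂ) * H = 1) (X : M3) : (sigmaL H ^ 3) X =
    !![-X 1 1, -X 0 1, H * X 2 1;
       -X 1 0, -X 0 0, H * X 2 0;
       H * X 1 2, H * X 0 2, -X 2 2] := by
  have h3 := eps_pow_three
  rw [pow_succ, Module.End.mul_apply, sigma_two_eq hH, sigma_eq hH]
  ext i j
  fin_cases i <;> fin_cases j <;> simp
  · linear_combination X 0 1 * h3
  · linear_combination -H * X 2 1 * h3
  · linear_combination X 1 0 * h3
  · linear_combination -H * X 2 0 * h3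
  · linear_combination -H * X 1 2 * h3
  · linear_combination -H * X 0 2 * h3

lemma mul_eq_zero_of_ne {c x : ℂ} (hc : c ≠ 0) (h : c * x = 0) : x = 0 :=
  (mul_eq_zero.mp h).resolve_left hc

/-! ### Decompositions of the Maurer–Cartan form -/

/-- Once `A` and `p + q` vanish and `t` is real, the diagonal entries form the `𝔤₀`-part and the
other entries lie in the eigenspaces required by the type of the form. -/
lemma decomposes_one {H : ℝ} (hH : (H : ℂ) * H = 1) {p q A B t : ℂ} (hpq : p + q = 0)
    (hA : A = 0) (ht : conj t = t) :
    Decomposes (sigmaL H ^ 1) (eps ^ 1) (mcZ H p q A B t) (mcZbar H p q A B t) := by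
  have h3 := eps_pow_three
  have hq : q = -p := by linear_combination hpq
  refine ⟨!![0, 0, t; B, 0, 0; 0, -H * t, 0], !![p, 0, 0; 0, -p, 0; 0, 0, 0],
    !![-conj p, 0, 0; 0, conj p, 0; 0, 0, 0], !![0, conj B, 0; 0, 0, t; -H * t, 0, 0],
    ⟨?_, ?_⟩, ⟨?_, ?_⟩, ⟨?_, ?_⟩, ⟨?_, ?_⟩, ?_, ?_⟩
  · simp [Matrix.trace_fin_three]
  · rw [pow_one, pow_one, sigma_eq hH, zpow_neg_one, eps_inv]
    ext i j
    fin_cases i <;> fin_cases j <;> simp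
    · linear_combination -eps ^ 2 * t * hH - t * eps_sq
    · linear_combination -B * eps_sq
    · linear_combination H * t * eps_sq
  · simp [Matrix.trace_fin_three]
  · rw [pow_one, pow_one, sigma_eq hH]
    ext i j
    fin_cases i <;> fin_cases j <;> simp
  · simp [Matrix.trace_fin_three]
  · rw [pow_one, pow_one, sigma_eq hH]
    ext i j
    fin_cases i <;> fin_cases j <;> simp
  · simp [Matrix.trace_fin_three]
  · rw [pow_one, pow_one, sigma_eq hH]
    ext i j
    fin_cases i <;> fin_cases j <;> simp
    · linear_combination eps * t * hH
    · ring
  · ext i j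
    fin_cases i <;> fin_cases j <;> simp [mcZ, hA, hq, ht]
  · ext i j
    fin_cases i <;> fin_cases j <;> simp [mcZbar, hA, hq, ht]

/-- The `dz`-part alone suffices. The position `(0,1)` has eigenvalue `ε` and cannot occur in `𝔤₋₁ +
𝔤₀`. The positions `(0,2)` and `(2,1)` are interchanged by `σ_H`, and their entries, `t` and `-H
t̄`, match only for real `t`. -/
lemma of_decomposes_one {H : ℝ} (hH : (H : ℂ) * H = 1) {p q A B t : ℂ}
    (h : Decomposes (sigmaL H ^ 1) (eps ^ 1) (mcZ H p q A B t) (mcZbar H p q A B t)) :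
    A = 0 ∧ conj t = t := by
  have h3 := eps_pow_three
  have h2 : eps ^ 2 - 1 ≠ 0 := sub_ne_zero.mpr eps_sq_ne_one
  have h1' : eps ≠ 1 := fun h => h2 (by rw [h]; norm_num)
  have h4 : eps + 1 ≠ 0 := eps_ne_neg_one
  obtain ⟨am, a0', -, -, ⟨-, g1⟩, ⟨-, g2⟩, -, -, e, -⟩ := h
  rw [pow_one, pow_one, sigma_eq hH, ← Matrix.ext_iff] at g1 g2
  rw [zpow_neg_one, eps_inv] at g1
  rw [← Matrix.ext_iff] at e
  have a1 := g1 0 1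
  have a2 := g2 0 1
  have a3 := e 0 1
  have b1 := g1 0 2
  have b2 := g2 0 2
  have b2' := g2 2 1
  have b3 := e 0 2
  have b3' := e 2 1
  simp [mcZ] at a1 a2 a3 b1 b2 b2' b3 b3'
  -- Otherwise `ε = ε⁻¹ = 1 - ε`, whereas `(2ε - 1)² = -3`.
  have c1 : am 0 1 = 0 := a1.resolve_left fun h => three_ne_zero (α := ℂ) (by
    linear_combination -(2 * eps - 1) * h + 4 * eps_sq)
  have c2 : a0' 0 1 = 0 :=
    mul_eq_zero_of_ne (sub_ne_zero.mpr h1') (by linear_combination a2)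
  have c3 : a0' 0 2 = 0 := mul_eq_zero_of_ne h4 (by
    linear_combination -b2 - H * eps ^ 2 * b2' + eps ^ 4 * a0' 0 2 * hH + eps * a0' 0 2 * h3)
  have c4 : a0' 2 1 = 0 := by rw [← b2', c3, mul_zero]
  have c5 : am 0 2 = -H * am 2 1 := by
    linear_combination -eps * b1 + am 0 2 * eps_sq + H * am 2 1 * h3
  refine ⟨by rw [a3, c1, c2, add_zero], ?_⟩
  linear_combination -b3 - H * b3' - c3 - H * c4 - c5 - conj t * hH

lemma decomposes_two {H : ℝ} (hH : (H : ℂ) * H = 1) {p q A B t : ℂ} (hA : A = 0) :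
    Decomposes (sigmaL H ^ 2) (eps ^ 2) (mcZ H p q A B t) (mcZbar H p q A B t) := by
  have h3 := eps_pow_three
  have hi : (eps ^ 2)⁻¹ = -eps :=
    inv_eq_of_mul_eq_one_right (by linear_combination -eps_pow_three)
  refine ⟨!![0, 0, t; B, 0, 0; 0, -H * conj t, 0], !![p, 0, 0; 0, q, 0; 0, 0, -(p + q)],
    !![conj q, 0, 0; 0, conj p, 0; 0, 0, -(conj p + conj q)],
    !![0, conj B, 0; 0, 0, conj t; -H * t, 0, 0],
    ⟨?_, ?_⟩, ⟨?_, ?_⟩, ⟨?_, ?_⟩, ⟨?_, ?_⟩, ?_, ?_⟩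
  · simp [Matrix.trace_fin_three]
  · rw [sigma_two_eq hH, zpow_neg_one, hi]
    ext i j
    fin_cases i <;> fin_cases j <;> simp
  · simp [Matrix.trace_fin_three]
  · rw [sigma_two_eq hH]
    ext i j
    fin_cases i <;> fin_cases j <;> simp
  · simp [Matrix.trace_fin_three]; ring
  · rw [sigma_two_eq hH]
    ext i j
    fin_cases i <;> fin_cases j <;> simp
  · simp [Matrix.trace_fin_three]
  · rw [sigma_two_eq hH]
    ext i j
    fin_cases i <;> fin_cases j <;> simp
  · ext i j
    fin_cases i <;> fin_cases j <;> simp [mcZ, hA]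
  · ext i j
    fin_cases i <;> fin_cases j <;> simp [mcZbar, hA]

/-- The entry `A` is in a position of eigenvalue `ε² = ζ`, which differs from `ζ⁻¹` and from `1`. -/
lemma of_decomposes_two {H : ℝ} (hH : (H : ℂ) * H = 1) {p q A B t : ℂ}
    (h : Decomposes (sigmaL H ^ 2) (eps ^ 2) (mcZ H p q A B t) (mcZbar H p q A B t)) :
    A = 0 := by
  have h3 := eps_pow_three
  have h2 := eps_sq_ne_one
  have h4 : eps ^ 2 + eps ≠ 0 := by
    rw [sq, ← mul_add_one]; exact mul_ne_zero eps_ne_zero eps_ne_neg_one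
  have hi : (eps ^ 2)⁻¹ = -eps :=
    inv_eq_of_mul_eq_one_right (by linear_combination -eps_pow_three)
  obtain ⟨am, a0', -, -, ⟨-, g1⟩, ⟨-, g2⟩, -, -, e, -⟩ := h
  rw [sigma_two_eq hH, ← Matrix.ext_iff] at g1 g2
  rw [zpow_neg_one, hi] at g1
  rw [← Matrix.ext_iff] at e
  have a1 := g1 0 1
  have a2 := g2 0 1
  have a3 := e 0 1
  simp [mcZ] at a1 a2 a3
  have c1 : am 0 1 = 0 := mul_eq_zero_of_ne h4 (by linear_combination a1)
  have c2 : a0' 0 1 = 0 := 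
    mul_eq_zero_of_ne (sub_ne_zero.mpr h2) (by linear_combination a2)
  rw [a3, c1, c2, add_zero]

/-! ### Primitive harmonicity of the normalized frame for the orders six and three -/

section adapted
variable {H : ℝ} {D : Set ℂ} {M : ℂ → M3} {t : ℂ → ℂ}

lemma inv_mul_mwd_const_mul (hD : IsOpen D) (hM : MSmooth D M) {z : ℂ} (hz : z ∈ D) (θ : ℂ) :
    (R⁻¹ * M z)⁻¹ * mwd θ (fun y => R⁻¹ * M y) z = (M z)⁻¹ * mwd θ M z := by
  rw [mwd_const_mul hD _ hM hz, Matrix.mul_inv_rev, Matrix.nonsing_inv_nonsing_inv _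
    (isUnit_iff_ne_zero.mpr det_R_ne_zero), mul_assoc, ← mul_assoc R, R_mul_inv, one_mul]

lemma AdaptedFrame.det_frame (h : AdaptedFrame H D M t) : ∀ z ∈ D, (R⁻¹ * M z).det ≠ 0 :=
  fun z hz => by rw [(h.isFrame.2 z hz).1]; exact one_ne_zero

/-- For real `t` the derivative `t_z̄` is the conjugate of `t_z`; with `A = 0` the difference of the
two formulas is `3 t` times the conjugate of `p + q`. -/
lemma StructureEqs.trace_zero {p q A B : ℂ → ℂ} (h : StructureEqs H D p q A B t)
    (hA : ∀ z ∈ D, A z = 0) (ht : ∀ z ∈ D, conj (t z) = t z) {z : ℂ} (hz : z ∈ D) :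
    p z + q z = 0 := by
  have e1 := h.tbar z hz
  have e2 := congrArg conj (h.tz z hz)
  have e3 : wd Complex.I t z = conj (wd (-Complex.I) t z) := by
    rw [← wd_congr_on h.isOpen ht hz, wd_conj (diffAt_of_smooth h.isOpen h.smooth_t hz)]
    simp
  have ht0 : t z ≠ 0 := fun h0 => by have := h.re_pos z hz; rw [h0] at this; simp at this
  simp only [map_sub, map_mul, map_add, Complex.conj_conj, ht z hz, hA z hz, map_ofNat] at e1 e2
  have e4 : conj (p z + q z) = 0 := mul_eq_zero_of_ne (mul_ne_zero three_ne_zero ht0) (by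
    rw [map_add]; linear_combination e1 - e2 - e3)
  simpa using congrArg conj e4

/-- The type of the form also needs `p + q = 0`. This does not appear on the right because
`StructureEqs.trace_zero` derives it from the other two conditions. -/
lemma AdaptedFrame.primitive_one_iff (h : AdaptedFrame H D M t) :
    IsPrimitiveHarmonicSigma H 1 D (fun z => R⁻¹ * M z) ↔
      ∀ z ∈ D, coeff M 0 1 z = 0 ∧ conj (t z) = t z := by
  have hH := h.sq_eq_one
  rw [isPrimitiveHarmonicSigma_iff, isPrimitiveHarmonic_iff_decomposes h.isOpen
    (pow_ne_zero _ eps_ne_zero) (by simpa using eps_sq_ne_one) (sigma_pow_bracket hH 1)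
    h.isFrame.1 h.det_frame]
  constructor
  · intro hp z hz
    have := hp z hz
    rw [inv_mul_mwd_const_mul h.isOpen h.smooth hz, inv_mul_mwd_const_mul h.isOpen h.smooth hz,
      h.mc_z hz, h.mc_zbar hz] at this
    exact of_decomposes_one hH this
  · intro hp z hz
    rw [inv_mul_mwd_const_mul h.isOpen h.smooth hz, inv_mul_mwd_const_mul h.isOpen h.smooth hz,
      h.mc_z hz, h.mc_zbar hz]
    exact decomposes_one hH (h.structureEqs.trace_zero (fun z hz => (hp z hz).1)
      (fun z hz => (hp z hz).2) hz) (hp z hz).1 (hp z hz).2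

lemma AdaptedFrame.primitive_two_iff (h : AdaptedFrame H D M t) :
    IsPrimitiveHarmonicSigma H 2 D (fun z => R⁻¹ * M z) ↔ ∀ z ∈ D, coeff M 0 1 z = 0 := by
  have hH := h.sq_eq_one
  rw [isPrimitiveHarmonicSigma_iff, isPrimitiveHarmonic_iff_decomposes h.isOpen
    (pow_ne_zero _ eps_ne_zero) (by rw [← pow_mul]; exact eps_pow_four_ne_one)
    (sigma_pow_bracket hH 2) h.isFrame.1 h.det_frame]
  constructor
  · intro hp z hz
    have := hp z hz
    rw [inv_mul_mwd_const_mul h.isOpen h.smooth hz, inv_mul_mwd_const_mul h.isOpen h.smooth hz,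
      h.mc_z hz, h.mc_zbar hz] at this
    exact of_decomposes_two hH this
  · intro hp z hz
    rw [inv_mul_mwd_const_mul h.isOpen h.smooth hz, inv_mul_mwd_const_mul h.isOpen h.smooth hz,
      h.mc_z hz, h.mc_zbar hz]
    exact decomposes_two hH (hp z hz)

end adapted

/-! ### Primitive harmonicity for the order two -/

/-- The component in `𝔤₋₁` of the `dz`-part. -/
def oddZ (H : ℝ) (p q A B t : ℂ) : M3 :=
  !![(p + q) / 2, A, (t + conj t) / 2; B, (p + q) / 2, 0;
    0, -H * (t + conj t) / 2, -(p + q)]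

/-- The component in `𝔤₀` of the `dz`-part. -/
def evenZ (H : ℝ) (p q t : ℂ) : M3 :=
  !![(p - q) / 2, 0, (t - conj t) / 2; 0, -(p - q) / 2, 0; 0, H * (t - conj t) / 2, 0]

/-- The component in `𝔤₁` of the `dz̄`-part. -/
def oddZbar (H : ℝ) (p q A B t : ℂ) : M3 :=
  !![(conj p + conj q) / 2, conj B, 0; conj A, (conj p + conj q) / 2, (t + conj t) / 2;
    -H * (t + conj t) / 2, 0, -(conj p + conj q)]

/-- The component in `𝔤₀` of the `dz̄`-part. -/
def evenZbar (H : ℝ) (p q t : ℂ) : M3 :=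
  !![-(conj p - conj q) / 2, 0, 0; 0, (conj p - conj q) / 2, (conj t - t) / 2;
    H * (conj t - t) / 2, 0, 0]

section pointwise
variable {H : ℝ} (hH : (H : ℂ) * H = 1) (p q A B t : ℂ)

lemma mcZ_eq_add : mcZ H p q A B t = oddZ H p q A B t + evenZ H p q t := by
  ext i j
  fin_cases i <;> fin_cases j <;> simp [mcZ, oddZ, evenZ] <;> ring

lemma mcZbar_eq_add : mcZbar H p q A B t = evenZbar H p q t + oddZbar H p q A B t := by
  ext i j
  fin_cases i <;> fin_cases j <;> simp [mcZbar, oddZbar, evenZbar] <;> ring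

/-- For the order two `ζ = -1`, so `𝔤₁` and `𝔤₋₁` coincide; the exponent is left general to serve
for either. -/
lemma oddZ_mem (hH : (H : ℂ) * H = 1) (m : ℤ) (hm : (eps ^ 3) ^ m = -1) :
    oddZ H p q A B t ∈ gSpace (sigmaL H ^ 3 : M3 →ₗ[ℂ] M3) (eps ^ 3) m := by
  refine ⟨?_, ?_⟩
  · simp [Matrix.trace_fin_three, oddZ]
  · rw [sigma_three_eq hH, hm]
    ext i j
    fin_cases i <;> fin_cases j <;> simp [oddZ]
    · linear_combination -(t + conj t) / 2 * hH
    · ring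

lemma oddZbar_mem (hH : (H : ℂ) * H = 1) (m : ℤ) (hm : (eps ^ 3) ^ m = -1) :
    oddZbar H p q A B t ∈ gSpace (sigmaL H ^ 3 : M3 →ₗ[ℂ] M3) (eps ^ 3) m := by
  refine ⟨?_, ?_⟩
  · simp [Matrix.trace_fin_three, oddZbar]
  · rw [sigma_three_eq hH, hm]
    ext i j
    fin_cases i <;> fin_cases j <;> simp [oddZbar]
    · linear_combination -(t + conj t) / 2 * hH
    · ring

lemma evenZ_mem (hH : (H : ℂ) * H = 1) :
    evenZ H p q t ∈ gSpace (sigmaL H ^ 3 : M3 →ₗ[ℂ] M3) (eps ^ 3) 0 := by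
  refine ⟨?_, ?_⟩
  · simp [Matrix.trace_fin_three, evenZ]; ring
  · rw [sigma_three_eq hH, zpow_zero]
    ext i j
    fin_cases i <;> fin_cases j <;> simp [evenZ]
    all_goals first
      | ring1
      | linear_combination (t - conj t) / 2 * hH

lemma evenZbar_mem (hH : (H : ℂ) * H = 1) :
    evenZbar H p q t ∈ gSpace (sigmaL H ^ 3 : M3 →ₗ[ℂ] M3) (eps ^ 3) 0 := by
  refine ⟨?_, ?_⟩
  · simp [Matrix.trace_fin_three, evenZbar]; ring
  · rw [sigma_three_eq hH, zpow_zero]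
    ext i j
    fin_cases i <;> fin_cases j <;> simp [evenZbar]
    all_goals first
      | ring1
      | linear_combination (conj t - t) / 2 * hH

end pointwise

section smooth
variable {H : ℝ} {D : Set ℂ} {p q A B t : ℂ → ℂ}

lemma smooth_oddZ (hp : ContDiffOn ℝ ∞ p D) (hq : ContDiffOn ℝ ∞ q D) (hA : ContDiffOn ℝ ∞ A D)
    (hB : ContDiffOn ℝ ∞ B D) (ht : ContDiffOn ℝ ∞ t D) :
    MSmooth D (fun z => oddZ H (p z) (q z) (A z) (B z) (t z)) := by
  have ht' := smooth_conj ht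
  intro i j
  fin_cases i <;> fin_cases j <;> simp [oddZ] <;> fun_prop

lemma smooth_evenZ (hp : ContDiffOn ℝ ∞ p D) (hq : ContDiffOn ℝ ∞ q D)
    (ht : ContDiffOn ℝ ∞ t D) : MSmooth D (fun z => evenZ H (p z) (q z) (t z)) := by
  have ht' := smooth_conj ht
  intro i j
  fin_cases i <;> fin_cases j <;> simp [evenZ] <;> fun_prop

lemma smooth_oddZbar (hp : ContDiffOn ℝ ∞ p D) (hq : ContDiffOn ℝ ∞ q D)
    (hA : ContDiffOn ℝ ∞ A D) (hB : ContDiffOn ℝ ∞ B D) (ht : ContDiffOn ℝ ∞ t D) :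
    MSmooth D (fun z => oddZbar H (p z) (q z) (A z) (B z) (t z)) := by
  have ht' := smooth_conj ht
  have hp' := smooth_conj hp
  have hq' := smooth_conj hq
  have hA' := smooth_conj hA
  have hB' := smooth_conj hB
  intro i j
  fin_cases i <;> fin_cases j <;> simp [oddZbar] <;> fun_prop

lemma smooth_evenZbar (hp : ContDiffOn ℝ ∞ p D) (hq : ContDiffOn ℝ ∞ q D)
    (ht : ContDiffOn ℝ ∞ t D) : MSmooth D (fun z => evenZbar H (p z) (q z) (t z)) := by
  have ht' := smooth_conj ht
  have hp' := smooth_conj hp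
  have hq' := smooth_conj hq
  intro i j
  fin_cases i <;> fin_cases j <;> simp [evenZbar] <;> fun_prop

/-- The equations of harmonicity of the map into the symmetric space. -/
structure SymmetricEqs (D : Set ℂ) (p q A B t : ℂ → ℂ) : Prop where
  real_t : ∀ z ∈ D, conj (t z) = t z
  psi_bar : ∀ z ∈ D, wd Complex.I p z + wd Complex.I q z = 0
  A_bar : ∀ z ∈ D, wd Complex.I A z = (conj (p z) - conj (q z)) * A z
  B_bar : ∀ z ∈ D, wd Complex.I B z = -(conj (p z) - conj (q z)) * B z

lemma mwd_oddZ (hD : IsOpen D) (hp : ContDiffOn ℝ ∞ p D) (hq : ContDiffOn ℝ ∞ q D)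
    (ht : ContDiffOn ℝ ∞ t D) {z : ℂ} (hz : z ∈ D) (θ : ℂ) :
    mwd θ (fun z => oddZ H (p z) (q z) (A z) (B z) (t z)) z =
      !![(wd θ p z + wd θ q z) / 2, wd θ A z, (wd θ t z + conj (wd (conj θ) t z)) / 2;
        wd θ B z, (wd θ p z + wd θ q z) / 2, 0;
        0, -H * (wd θ t z + conj (wd (conj θ) t z)) / 2, -(wd θ p z + wd θ q z)] := by
  have dp := hasWd (θ := θ) (diffAt_of_smooth hD hp hz)
  have dq := hasWd (θ := θ) (diffAt_of_smooth hD hq hz)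
  have dt := hasWd (θ := θ) (diffAt_of_smooth hD ht hz)
  have dt' := (hasWd (θ := conj θ) (diffAt_of_smooth hD ht hz)).conj
  have e1 : (fun y => (p y + q y) / 2) = fun y => 1 / 2 * (p y + q y) := by funext y; ring
  have e2 : (fun y => (t y + conj (t y)) / 2) = fun y => 1 / 2 * (t y + conj (t y)) := by
    funext y; ring
  have e3 : (fun y => -H * (t y + conj (t y)) / 2)
      = fun y => -H / 2 * (t y + conj (t y)) := by
    funext y; ring
  ext i j
  rw [mwd_apply]
  fin_cases i <;> fin_cases j <;> simp only [oddZ, Matrix.of_apply]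
  · exact (congrArg (fun g => wd θ g z) e1).trans (((dp.add dq).const_mul _).2.trans (by simp; ring))
  · rfl
  · exact (congrArg (fun g => wd θ g z) e2).trans (((dt.add dt').const_mul _).2.trans (by simp; ring))
  · rfl
  · exact (congrArg (fun g => wd θ g z) e1).trans (((dp.add dq).const_mul _).2.trans (by simp; ring))
  · exact wd_const 0
  · exact wd_const 0
  · exact (congrArg (fun g => wd θ g z) e3).trans (((dt.add dt').const_mul _).2.trans (by simp; ring))
  · exact (dp.add dq).neg.2

lemma oddZ_conj (p q A B t : ℂ) :
    J * (oddZ H p q A B t).map conj * J = oddZbar H p q A B t := by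
  ext i j
  simp only [Matrix.mul_apply, Fin.sum_univ_three, Matrix.map_apply, J, oddZ, oddZbar]
  fin_cases i <;> fin_cases j <;> simp [map_ofNat] <;> first
    | ring1
    | exact Or.inl (by ring)

lemma evenZbar_conj (p q t : ℂ) :
    J * (evenZbar H p q t).map conj * J = evenZ H p q t := by
  ext i j
  simp only [Matrix.mul_apply, Fin.sum_univ_three, Matrix.map_apply, J, evenZ, evenZbar]
  fin_cases i <;> fin_cases j <;> simp [map_ofNat]

lemma J_conj_mul (X Y : M3) : J * (X * Y).map conj * J
    = (J * X.map conj * J) * (J * Y.map conj * J) := by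
  have : (X * Y).map conj = X.map conj * Y.map conj := map_mul (starRingEnd ℂ).mapMatrix X Y
  rw [this]
  calc _ = J * X.map conj * 1 * Y.map conj * J := by noncomm_ring
    _ = _ := by rw [← J_mul_J]; noncomm_ring

lemma StructureEqs.dt_real (h : StructureEqs H D p q A B t)
    (ht : ∀ z ∈ D, conj (t z) = t z) {z : ℂ} (hz : z ∈ D) :
    wd Complex.I t z = conj (wd (-Complex.I) t z) := by
  rw [← wd_congr_on h.isOpen ht hz, wd_conj (diffAt_of_smooth h.isOpen h.smooth_t hz)]
  simp

/-- The `λ⁻¹`-equation carries everything: its entries contain the stated derivatives and the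
relation `(t̄ - t)(p + q) = 0`. Conversely it follows from the symmetric equations and the formulas
for `dt`; conjugation turns it into the `λ`-equation, and the remaining component vanishes because
the sum of all three does. -/
lemma isFlatFamily_iff_symmetricEqs (h : StructureEqs H D p q A B t)
    (hz0 : ∀ z ∈ D, (mwd (-Complex.I) (fun z => oddZbar H (p z) (q z) (A z) (B z) (t z)) z
        + (evenZ H (p z) (q z) (t z) * oddZbar H (p z) (q z) (A z) (B z) (t z)
          - oddZbar H (p z) (q z) (A z) (B z) (t z) * evenZ H (p z) (q z) (t z))) +
      (-mwd Complex.I (fun z => oddZ H (p z) (q z) (A z) (B z) (t z)) z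
        + (oddZ H (p z) (q z) (A z) (B z) (t z) * evenZbar H (p z) (q z) (t z)
          - evenZbar H (p z) (q z) (t z) * oddZ H (p z) (q z) (A z) (B z) (t z))) +
      (mwd (-Complex.I) (fun z => evenZbar H (p z) (q z) (t z)) z
        - mwd Complex.I (fun z => evenZ H (p z) (q z) (t z)) z +
        (evenZ H (p z) (q z) (t z) * evenZbar H (p z) (q z) (t z)
          - evenZbar H (p z) (q z) (t z) * evenZ H (p z) (q z) (t z)) +
        (oddZ H (p z) (q z) (A z) (B z) (t z) * oddZbar H (p z) (q z) (A z) (B z) (t z)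
          - oddZbar H (p z) (q z) (A z) (B z) (t z) * oddZ H (p z) (q z) (A z) (B z) (t z)))
      = 0) :
    IsFlatFamily D (fun z => oddZ H (p z) (q z) (A z) (B z) (t z))
      (fun z => evenZ H (p z) (q z) (t z)) (fun z => evenZbar H (p z) (q z) (t z))
      (fun z => oddZbar H (p z) (q z) (A z) (B z) (t z)) ↔ SymmetricEqs D p q A B t := by
  have hD := h.isOpen
  have hH := h.sq_eq_one
  have hH0 : (H : ℂ) ≠ 0 := left_ne_zero_of_mul_eq_one hH
  constructor
  · intro hf
    have key := fun z hz i j => congrFun (congrFun (hf.minus z hz) i) j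
    have e00 : ∀ z ∈ D, wd Complex.I p z + wd Complex.I q z
        = H * (conj (t z) ^ 2 - t z ^ 2) / 2 := fun z hz => by
      have := key z hz 0 0
      simp only [mwd_oddZ hD h.smooth_p h.smooth_q h.smooth_t hz] at this
      simp [oddZ, evenZbar] at this
      linear_combination -2 * this
    have e12 : ∀ z ∈ D, (conj (t z) - t z) * (p z + q z) = 0 := fun z hz => by
      have := key z hz 1 2
      simp only [mwd_oddZ hD h.smooth_p h.smooth_q h.smooth_t hz] at this
      simp [oddZ, evenZbar] at this
      linear_combination 4 / 3 * this
    have ht : ∀ z ∈ D, conj (t z) = t z := by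
      intro z hz
      by_contra hne
      have hcont : ContinuousAt (fun y => conj (t y) - t y) z :=
        ((smooth_conj h.smooth_t).sub h.smooth_t).continuousOn.continuousAt (hD.mem_nhds hz)
      have hev : ∀ᶠ y in nhds z, conj (t y) - t y ≠ 0 :=
        hcont.eventually_ne (sub_ne_zero.mpr hne)
      -- If `t` is not real at `z`, it is not real nearby, so `p + q` vanishes identically near `z`.
      -- Its `z̄`-derivative then forces `t̄² = t²`, hence `t̄ = -t`, against `Re t > 0`.
      have hpq : (fun y => p y + q y) =ᶠ[nhds z] fun _ => 0 := by
        filter_upwards [hev, hD.mem_nhds hz] with y hy hyD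
        exact mul_eq_zero_of_ne hy (e12 y hyD)
      have h0 := wd_congr (θ := Complex.I) hpq
      rw [wd_const, wd_add (diffAt_of_smooth hD h.smooth_p hz)
        (diffAt_of_smooth hD h.smooth_q hz), e00 z hz] at h0
      have h1 : (H : ℂ) * (conj (t z) - t z) ≠ 0 := mul_ne_zero hH0 (sub_ne_zero.mpr hne)
      have h2 : conj (t z) + t z = 0 := mul_eq_zero_of_ne h1 (by linear_combination 2 * h0)
      have h3 := congrArg Complex.re h2
      have h4 := h.re_pos z hz
      simp at h3
      linarith
    refine ⟨ht, fun z hz => ?_, fun z hz => ?_, fun z hz => ?_⟩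
    · rw [e00 z hz, ht z hz]; ring
    · have := key z hz 0 1
      simp only [mwd_oddZ hD h.smooth_p h.smooth_q h.smooth_t hz] at this
      simp [oddZ, evenZbar] at this
      linear_combination -this
    · have := key z hz 1 0
      simp only [mwd_oddZ hD h.smooth_p h.smooth_q h.smooth_t hz] at this
      simp [oddZ, evenZbar] at this
      linear_combination -this
  · intro hs
    have hm : ∀ z ∈ D, -mwd Complex.I (fun z => oddZ H (p z) (q z) (A z) (B z) (t z)) z
        + (oddZ H (p z) (q z) (A z) (B z) (t z) * evenZbar H (p z) (q z) (t z)
          - evenZbar H (p z) (q z) (t z) * oddZ H (p z) (q z) (A z) (B z) (t z)) = 0 := by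
      intro z hz
      rw [mwd_oddZ hD h.smooth_p h.smooth_q h.smooth_t hz]
      have ht := hs.real_t z hz
      have e1 := hs.psi_bar z hz
      have e2 := hs.A_bar z hz
      have e3 := hs.B_bar z hz
      have e4 := h.tbar z hz
      have e5 := congrArg conj (h.tz z hz)
      have e6 := h.dt_real hs.real_t hz
      simp only [map_sub, map_mul, map_add, Complex.conj_conj, map_ofNat, ht] at e4 e5
      ext i j
      fin_cases i <;> fin_cases j <;> simp [oddZ, evenZbar, ht, ← e6]
      · linear_combination -e1 / 2
      · linear_combination -e2
      · linear_combination -(e4 + e5 + e6) / 2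
      · linear_combination -e3
      · linear_combination -e1 / 2
      · linear_combination H * (e4 + e5 + e6) / 2
      · linear_combination e1
    have hp : ∀ z ∈ D, mwd (-Complex.I) (fun z => oddZbar H (p z) (q z) (A z) (B z) (t z)) z
        + (evenZ H (p z) (q z) (t z) * oddZbar H (p z) (q z) (A z) (B z) (t z)
          - oddZbar H (p z) (q z) (A z) (B z) (t z) * evenZ H (p z) (q z) (t z)) = 0 := by
      intro z hz
      have so : MSmooth D (fun z => oddZ H (p z) (q z) (A z) (B z) (t z)) :=
        smooth_oddZ h.smooth_p h.smooth_q h.smooth_A h.smooth_B h.smooth_t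
      have sc : MSmooth D (fun z => (oddZ H (p z) (q z) (A z) (B z) (t z)).map conj) :=
        fun i j => smooth_conj (so i j)
      -- The `𝔤₁`-part is the `J`-conjugate of the `𝔤₋₁`-part, so its equation is the conjugate of
      -- the one already proved.
      have e1 : mwd (-Complex.I) (fun z => oddZbar H (p z) (q z) (A z) (B z) (t z)) z
          = J * (mwd Complex.I (fun z => oddZ H (p z) (q z) (A z) (B z) (t z)) z).map conj
            * J := by
        simp only [← oddZ_conj]
        rw [mwd_mul_const hD J ((MSmooth.const J).mul sc) hz, mwd_const_mul hD J sc hz,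
          mwd_map_conj hD so hz]
        simp
      have e2 : mwd Complex.I (fun z => oddZ H (p z) (q z) (A z) (B z) (t z)) z
        = oddZ H (p z) (q z) (A z) (B z) (t z) * evenZbar H (p z) (q z) (t z)
          - evenZbar H (p z) (q z) (t z) * oddZ H (p z) (q z) (A z) (B z) (t z) := by
        rw [← sub_eq_zero, ← neg_eq_zero, ← hm z hz]; abel
      have e3 : ∀ X Y : M3, J * (X - Y).map conj * J
          = J * X.map conj * J - J * Y.map conj * J := fun X Y => by
        rw [Matrix.map_sub conj (map_sub _), mul_sub, sub_mul]
      rw [e1, e2, e3, J_conj_mul, J_conj_mul, oddZ_conj, evenZbar_conj]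
      abel
    refine ⟨hp, hm, fun z hz => ?_⟩
    have := hz0 z hz
    rw [hp z hz, hm z hz, zero_add, zero_add] at this
    exact this

end smooth

section adapted
variable {H : ℝ} {D : Set ℂ} {M : ℂ → M3} {t : ℂ → ℂ}

/-- The splitting into odd and even parts exists without any hypothesis on the immersion, and it is
the only one, so that just the integrability remains. -/
lemma AdaptedFrame.primitive_three_iff (h : AdaptedFrame H D M t) :
    IsPrimitiveHarmonicSigma H 3 D (fun z => R⁻¹ * M z) ↔
      SymmetricEqs D (coeff M 0 0) (coeff M 1 1) (coeff M 0 1) (coeff M 1 0) t := by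
  have hD := h.isOpen
  have hH := h.sq_eq_one
  have hz3 := eps_pow_three
  have hz1 : eps ^ 3 ≠ 1 := by rw [hz3]; norm_num
  have hi1 : (eps ^ 3) ^ (-1 : ℤ) = -1 := by rw [hz3]; norm_num
  have hi2 : (eps ^ 3) ^ (1 : ℤ) = -1 := by rw [hz3]; norm_num
  have s := h.structureEqs
  have sm1 := smooth_oddZ (H := H) s.smooth_p s.smooth_q s.smooth_A s.smooth_B s.smooth_t
  have sm2 := smooth_evenZ (H := H) s.smooth_p s.smooth_q s.smooth_t
  have sm3 := smooth_evenZbar (H := H) s.smooth_p s.smooth_q s.smooth_t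
  have sm4 := smooth_oddZbar (H := H) s.smooth_p s.smooth_q s.smooth_A s.smooth_B s.smooth_t
  have ea : ∀ z ∈ D, (R⁻¹ * M z)⁻¹ * mwd (-Complex.I) (fun y => R⁻¹ * M y) z
      = oddZ H (coeff M 0 0 z) (coeff M 1 1 z) (coeff M 0 1 z) (coeff M 1 0 z) (t z)
        + evenZ H (coeff M 0 0 z) (coeff M 1 1 z) (t z) := fun z hz => by
    rw [inv_mul_mwd_const_mul hD h.smooth hz, h.mc_z hz, mcZ_eq_add]
  have eb : ∀ z ∈ D, (R⁻¹ * M z)⁻¹ * mwd Complex.I (fun y => R⁻¹ * M y) z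
      = evenZbar H (coeff M 0 0 z) (coeff M 1 1 z) (t z)
       + oddZbar H (coeff M 0 0 z) (coeff M 1 1 z) (coeff M 0 1 z) (coeff M 1 0 z) (t z) :=
      fun z hz => by
    rw [inv_mul_mwd_const_mul hD h.smooth hz, h.mc_zbar hz, mcZbar_eq_add]
  have hz0 := fun z hz => flat_sum hD h.isFrame.1 h.det_frame sm1 sm2 sm3 sm4 ea eb (z := z) hz
  rw [isPrimitiveHarmonicSigma_iff, isPrimitiveHarmonic_iff hD hz1 h.isFrame.1 h.det_frame,
    ← isFlatFamily_iff_symmetricEqs s hz0]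
  constructor
  · rintro ⟨am, a0', a0'', ap, -, -, -, -, hd, hf⟩
    have hi : (eps ^ 3)⁻¹ ≠ 1 := by rw [hz3]; norm_num
    have p1 : ∀ z ∈ D, oddZ H (coeff M 0 0 z) (coeff M 1 1 z) (coeff M 0 1 z) (coeff M 1 0 z) (t z)
        = am z := fun z hz => by
      obtain ⟨g1, g2, g3, g4, e, e'⟩ := hd z hz
      rw [kappa_part hi (by simpa using g1.2) g2.2 e,
        kappa_part hi (by simpa using (oddZ_mem _ _ _ _ _ hH _ hi1).2)
          (evenZ_mem _ _ _ hH).2 (ea z hz)]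
    have p4 : ∀ z ∈ D, oddZbar H (coeff M 0 0 z) (coeff M 1 1 z) (coeff M 0 1 z) (coeff M 1 0 z)
        (t z) = ap z := fun z hz => by
      obtain ⟨g1, g2, g3, g4, e, e'⟩ := hd z hz
      rw [kappa_part hz1 (by simpa using g4.2) g3.2 (e'.trans (add_comm _ _)),
        kappa_part hz1 (by simpa using (oddZbar_mem _ _ _ _ _ hH _ hi2).2)
          (evenZbar_mem _ _ _ hH).2 ((eb z hz).trans (add_comm _ _))]
    refine hf.congr hD p1 (fun z hz => ?_) (fun z hz => ?_) p4
    · obtain ⟨g1, g2, g3, g4, e, e'⟩ := hd z hz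
      rw [ea z hz, p1 z hz] at e
      exact add_left_cancel e
    · obtain ⟨g1, g2, g3, g4, e, e'⟩ := hd z hz
      rw [eb z hz, p4 z hz] at e'
      exact add_right_cancel e'
  · intro hf
    exact ⟨_, _, _, _, sm1, sm2, sm3, sm4, fun z hz => ⟨oddZ_mem _ _ _ _ _ hH _ hi1,
      evenZ_mem _ _ _ hH, evenZbar_mem _ _ _ hH, oddZbar_mem _ _ _ _ _ hH _ hi2, ea z hz, eb z hz⟩,
      hf⟩

end adapted

/-! ### Gauss maps: reduction to frames -/

lemma IsPrimitiveHarmonic.congr {κ : M3 → M3} {ζ : ℂ} {D : Set ℂ} {F G : ℂ → M3}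
    (hD : IsOpen D) (h : IsPrimitiveHarmonic κ ζ D F) (e : ∀ z ∈ D, G z = F z) :
    IsPrimitiveHarmonic κ ζ D G := by
  obtain ⟨am, a0', a0'', ap, hd, hl⟩ := h
  refine ⟨am, a0', a0'', ap, fun z hz => ?_, hl⟩
  rw [e z hz, dz_eq, dzbar_eq, mwd_congr_on hD e hz, mwd_congr_on hD e hz, ← dz_eq, ← dzbar_eq]
  exact hd z hz

/-- The stabilizer condition `K S Kᵀ = S` or `K Q = Q K` on an element `K`, which makes it a fixed
point of the automorphism `σ_H ^ n` of the group. -/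
def IsFixed (H : ℝ) (n : ℕ) (K : M3) : Prop :=
  (n = 1 ∧ K * P H * Kᵀ = P H) ∨ (n = 2 ∧ K * (P H * (P H)ᵀ) = P H * (P H)ᵀ * K) ∨
    (n = 3 ∧ K * (P H * (P H)ᵀ * P H) * Kᵀ = P H * (P H)ᵀ * P H)

lemma transpose_P_mul_self {H : ℝ} (hH : (H : ℂ) * H = 1) : (P H)ᵀ * (P H)ᵀ = 1 := by
  rw [← Matrix.transpose_mul, P_mul_P hH, Matrix.transpose_one]

lemma PPP_mul_self {H : ℝ} (hH : (H : ℂ) * H = 1) :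
    P H * (P H)ᵀ * P H * (P H * (P H)ᵀ * P H) = 1 := by
  calc _ = P H * (P H)ᵀ * (P H * P H) * (P H)ᵀ * P H := by noncomm_ring
    _ = P H * ((P H)ᵀ * (P H)ᵀ) * P H := by rw [P_mul_P hH]; noncomm_ring
    _ = 1 := by rw [transpose_P_mul_self hH, mul_one, P_mul_P hH]

lemma sigma_one_apply (H : ℝ) (X : M3) : (sigmaL H ^ 1) X = -(P H * Xᵀ * P H) := by
  rw [pow_one]; rfl

lemma sigma_two_apply (H : ℝ) (X : M3) :
    (sigmaL H ^ 2) X = P H * (P H)ᵀ * X * ((P H)ᵀ * P H) := by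
  rw [pow_two, Module.End.mul_apply]
  change -(P H * (-(P H * Xᵀ * P H))ᵀ * P H) = _
  simp only [Matrix.transpose_neg, Matrix.transpose_mul, Matrix.transpose_transpose]
  noncomm_ring

lemma sigma_three_apply (H : ℝ) (X : M3) :
    (sigmaL H ^ 3) X = -(P H * (P H)ᵀ * P H * Xᵀ * (P H * (P H)ᵀ * P H)) := by
  rw [pow_succ', Module.End.mul_apply, sigma_two_apply]
  change -(P H * (P H * (P H)ᵀ * X * ((P H)ᵀ * P H))ᵀ * P H) = _
  simp only [Matrix.transpose_mul, Matrix.transpose_transpose]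
  noncomm_ring

/-! ### Gauge transformations with values in the fixed points of the automorphism. -/

section transpose
variable {S K : M3}

lemma inv_transpose_mul (hS : S * S = 1) (hK : K * S * Kᵀ = S) :
    S * Kᵀ * S * K = 1 ∧ K * (S * Kᵀ * S) = 1 := by
  have h : K * (S * Kᵀ * S) = 1 := by
    rw [← mul_assoc, ← mul_assoc, hK, hS]
  exact ⟨mul_eq_one_comm.mp h, h⟩

/-- The relation `K S Kᵀ = S` says that `K` is fixed by the group automorphism whose differential is
`X ↦ -S Xᵀ S`; hence this differential commutes with conjugation by `K`. -/
lemma conj_fixed_transpose (hS : S * S = 1) (hK : K * S * Kᵀ = S) (X : M3) :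
    -(S * (K⁻¹ * X * K)ᵀ * S) = K⁻¹ * -(S * Xᵀ * S) * K := by
  obtain ⟨h1, h2⟩ := inv_transpose_mul hS hK
  have hi : K⁻¹ = S * Kᵀ * S := Matrix.inv_eq_left_inv h1
  rw [hi]
  simp only [Matrix.transpose_mul, Matrix.transpose_transpose]
  have hST : Sᵀ * Sᵀ = 1 := by rw [← Matrix.transpose_mul, hS, Matrix.transpose_one]
  have h3 : Sᵀ * (K * Sᵀ) * S = S * K := by
    have h4 : Kᵀ * (Sᵀ * K * Sᵀ) = 1 := by
      have := congrArg Matrix.transpose h1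
      simpa [Matrix.transpose_mul, mul_assoc] using this
    have h5 : Kᵀ * (S * K * S) = 1 := by
      have : S * (Kᵀ * (S * K * S)) * S = 1 := by
        calc _ = S * Kᵀ * S * K * (S * S) := by noncomm_ring
          _ = 1 := by rw [hS, h1, mul_one]
      calc _ = (S * S) * (Kᵀ * (S * K * S)) * (S * S) := by rw [hS]; simp
        _ = S * (S * (Kᵀ * (S * K * S)) * S) * S := by noncomm_ring
        _ = 1 := by rw [this, mul_one, hS]
    -- No symmetry of `S` is available. The two sides agree because both are inverses of `Kᵀ`.
    have h6 : Sᵀ * K * Sᵀ = S * K * S := by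
      have h7 := mul_eq_one_comm.mp h4
      calc Sᵀ * K * Sᵀ = Sᵀ * K * Sᵀ * (Kᵀ * (S * K * S)) := by rw [h5, mul_one]
        _ = (Sᵀ * K * Sᵀ * Kᵀ) * (S * K * S) := by noncomm_ring
        _ = _ := by rw [h7, one_mul]
    calc _ = Sᵀ * K * Sᵀ * S := by noncomm_ring
      _ = S * K * (S * S) := by rw [h6]; noncomm_ring
      _ = _ := by rw [hS, mul_one]
  calc _ = -(S * Kᵀ * (Xᵀ * (Sᵀ * (K * Sᵀ) * S))) := by noncomm_ring
    _ = -(S * Kᵀ * 1 * Xᵀ * S * K) := by rw [h3]; noncomm_ring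
    _ = _ := by rw [← hS]; noncomm_ring

/-- Differentiating the relation `K S Kᵀ = S` shows that `K⁻¹ dK` lies in the fixed subalgebra. -/
lemma mc_fixed_transpose {D : Set ℂ} (hD : IsOpen D) {K : ℂ → M3} (hK : MSmooth D K)
    (hS : S * S = 1) (h : ∀ z ∈ D, K z * S * (K z)ᵀ = S) {z : ℂ} (hz : z ∈ D) (θ : ℂ) :
    -(S * ((K z)⁻¹ * mwd θ K z)ᵀ * S) = (K z)⁻¹ * mwd θ K z := by
  obtain ⟨h1, h2⟩ := inv_transpose_mul hS (h z hz)
  have hi : (K z)⁻¹ = S * (K z)ᵀ * S := Matrix.inv_eq_left_inv h1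
  have hd : mwd θ K z * S * (K z)ᵀ + K z * S * (mwd θ K z)ᵀ = 0 := by
    have e : mwd θ (fun y => K y * S * (K y)ᵀ) z = 0 := by
      rw [mwd_congr_on hD (B := fun _ => S) h hz, mwd_const]
    rw [mwd_mul hD (hK.mul (MSmooth.const S)) hK.transpose hz, mwd_mul_const hD S hK hz] at e
    exact e
  have h3 : S * (mwd θ K z)ᵀ = -((K z)⁻¹ * mwd θ K z * S * (K z)ᵀ) := by
    have : (K z)⁻¹ * (mwd θ K z * S * (K z)ᵀ + K z * S * (mwd θ K z)ᵀ) = 0 := by rw [hd, mul_zero]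
    have hKi : (K z)⁻¹ * K z = 1 := by rw [hi, h1]
    rw [mul_add, ← mul_assoc, ← mul_assoc, ← mul_assoc, ← mul_assoc, hKi,
      one_mul] at this
    rw [eq_neg_iff_add_eq_zero, add_comm]; exact this
  have h4 : (K z)ᵀ * ((K z)⁻¹)ᵀ = 1 := by
    rw [← Matrix.transpose_mul, hi, h1, Matrix.transpose_one]
  rw [Matrix.transpose_mul, ← mul_assoc, h3]
  calc _ = (K z)⁻¹ * mwd θ K z * S * ((K z)ᵀ * ((K z)⁻¹)ᵀ) * S := by noncomm_ring
    _ = (K z)⁻¹ * mwd θ K z * (S * S) := by rw [h4]; noncomm_ring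
    _ = _ := by rw [hS, mul_one]

end transpose

section commute
variable {Q Q' K : M3}

lemma commute_inv (hu : IsUnit K.det) (hk : K * Q = Q * K) : Q * K⁻¹ = K⁻¹ * Q := by
  have hKi : K⁻¹ * K = 1 := Matrix.nonsing_inv_mul _ hu
  have hKi' : K * K⁻¹ = 1 := Matrix.mul_nonsing_inv _ hu
  calc Q * K⁻¹ = (K⁻¹ * K) * Q * K⁻¹ := by rw [hKi, one_mul]
    _ = K⁻¹ * (K * Q) * K⁻¹ := by simp only [mul_assoc]
    _ = K⁻¹ * Q * (K * K⁻¹) := by rw [hk]; simp only [mul_assoc]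
    _ = _ := by rw [hKi', mul_one]

lemma conj_fixed_commute (hQ : Q * Q' = 1) (hu : IsUnit K.det) (hk : K * Q = Q * K) (X : M3) :
    Q * (K⁻¹ * X * K) * Q' = K⁻¹ * (Q * X * Q') * K := by
  have hQ' := mul_eq_one_comm.mp hQ
  have e2 : K * Q' = Q' * K := by
    calc K * Q' = (Q' * Q) * K * Q' := by rw [hQ', one_mul]
      _ = Q' * (Q * K) * Q' := by simp only [mul_assoc]
      _ = Q' * K * (Q * Q') := by rw [← hk]; simp only [mul_assoc]
      _ = _ := by rw [hQ, mul_one]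
  calc Q * (K⁻¹ * X * K) * Q' = (Q * K⁻¹) * X * (K * Q') := by simp only [mul_assoc]
    _ = _ := by rw [commute_inv hu hk, e2]; simp only [mul_assoc]

lemma mc_fixed_commute {D : Set ℂ} (hD : IsOpen D) {K : ℂ → M3} (hK : MSmooth D K)
    (hQ : Q * Q' = 1) (hu : ∀ z ∈ D, IsUnit (K z).det) (hk : ∀ z ∈ D, K z * Q = Q * K z) {z : ℂ}
    (hz : z ∈ D) (θ : ℂ) :
    Q * ((K z)⁻¹ * mwd θ K z) * Q' = (K z)⁻¹ * mwd θ K z := by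
  have hd : mwd θ K z * Q = Q * mwd θ K z := by
    rw [← mwd_mul_const hD Q hK hz, ← mwd_const_mul hD Q hK hz]
    exact mwd_congr_on hD hk hz
  calc _ = (Q * (K z)⁻¹) * mwd θ K z * Q' := by simp only [mul_assoc]
    _ = (K z)⁻¹ * (mwd θ K z * Q) * Q' := by
      rw [commute_inv (hu z hz) (hk z hz), hd]; simp only [mul_assoc]
    _ = (K z)⁻¹ * mwd θ K z * (Q * Q') := by simp only [mul_assoc]
    _ = _ := by rw [hQ, mul_one]

end commute

lemma PP_mul_inv {H : ℝ} (hH : (H : ℂ) * H = 1) : P H * (P H)ᵀ * ((P H)ᵀ * P H) = 1 := by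
  calc _ = P H * ((P H)ᵀ * (P H)ᵀ) * P H := by noncomm_ring
    _ = 1 := by rw [transpose_P_mul_self hH, mul_one, P_mul_P hH]

/-- The change of frame `G⁻¹ F` satisfies the two hypotheses of gauge invariance because it has
values in the fixed points: in the transpose form for odd powers of `σ_H`, as a commutation relation
for the square. -/
lemma IsPrimitiveHarmonicSigma.gauge {H : ℝ} (hH : (H : ℂ) * H = 1) {n : ℕ} {D : Set ℂ}
    (hD : IsOpen D) {G F : ℂ → M3} (hG : IsFrame D G) (hF : IsFrame D F)
    (hn : n = 1 ∨ n = 2 ∨ n = 3)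
    (hK : ∀ z ∈ D, IsFixed H n ((G z)⁻¹ * F z))
    (h : IsPrimitiveHarmonicSigma H n D G) : IsPrimitiveHarmonicSigma H n D F := by
  have hG1 : ∀ z ∈ D, (G z).det ≠ 0 := fun z hz => by rw [(hG.2 z hz).1]; exact one_ne_zero
  have hGs : MSmooth D G := hG.1
  have hKs : MSmooth D (fun z => (G z)⁻¹ * F z) := (hGs.inv hG1).mul hF.1
  have hK1 : ∀ z ∈ D, ((G z)⁻¹ * F z).det = 1 := fun z hz => by
    rw [Matrix.det_mul, Matrix.det_nonsing_inv, (hG.2 z hz).1, (hF.2 z hz).1]; simp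
  rw [isPrimitiveHarmonicSigma_iff] at h ⊢
  have hζ : eps ^ n ≠ 1 := by
    rcases hn with rfl | rfl | rfl
    · intro h; exact eps_sq_ne_one (by rw [pow_one] at h; rw [h]; norm_num)
    · exact eps_sq_ne_one
    · rw [eps_pow_three]; norm_num
  refine IsPrimitiveHarmonic.congr hD (h.gauge hD hζ hGs hG1 hKs hK1 ?_ ?_) fun z hz => ?_
  · intro z hz X
    rcases hK z hz with ⟨rfl, hk⟩ | ⟨rfl, hk⟩ | ⟨rfl, hk⟩
    · rw [sigma_one_apply, sigma_one_apply]
      exact conj_fixed_transpose (P_mul_P hH) hk X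
    · rw [sigma_two_apply, sigma_two_apply]
      exact conj_fixed_commute (PP_mul_inv hH) (isUnit_iff_ne_zero.mpr (by
        rw [hK1 z hz]; exact one_ne_zero)) hk X
    · rw [sigma_three_apply, sigma_three_apply]
      exact conj_fixed_transpose (PPP_mul_self hH) hk X
  · intro z hz θ
    rcases hn with rfl | rfl | rfl
    · rw [sigma_one_apply]
      refine mc_fixed_transpose hD hKs (P_mul_P hH) (fun z hz => ?_) hz θ
      rcases hK z hz with ⟨_, hk⟩ | ⟨h, _⟩ | ⟨h, _⟩
      · exact hk
      · omega
      · omega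
    · rw [sigma_two_apply]
      refine mc_fixed_commute hD hKs (PP_mul_inv hH) (fun z hz => isUnit_iff_ne_zero.mpr (by
        rw [hK1 z hz]; exact one_ne_zero)) (fun z hz => ?_) hz θ
      rcases hK z hz with ⟨h, _⟩ | ⟨_, hk⟩ | ⟨h, _⟩
      · omega
      · exact hk
      · omega
    · rw [sigma_three_apply]
      refine mc_fixed_transpose hD hKs (PPP_mul_self hH) (fun z hz => ?_) hz θ
      rcases hK z hz with ⟨h, _⟩ | ⟨h, _⟩ | ⟨_, hk⟩
      · omega
      · omega
      · exact hk
  · rw [← mul_assoc, Matrix.mul_nonsing_inv _ (isUnit_iff_ne_zero.mpr (hG1 z hz)), one_mul]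

/-- Frames of the same map differ by a gauge with values in the stabilizer of the base point. So it
is enough that stabilizers are fixed by `σ_H ^ n`, and the existence of some primitive harmonic
frame carries over to the given one. -/
lemma isPrimitiveHarmonicMap_iff {α : Type} {H : ℝ} (hH : (H : ℂ) * H = 1) {n : ℕ} {D : Set ℂ}
    (hD : IsOpen D) {F : ℂ → M3} (hF : IsFrame D F) (hn : n = 1 ∨ n = 2 ∨ n = 3) {N : Set α}
    {π : M3 → α} {h : ℂ → α} (hh : ∀ z ∈ D, h z = π (F z)) (hN : ∀ A ∈ SLR, π A ∈ N)
    (hπ : ∀ A ∈ SLR, ∀ B ∈ SLR, π A = π B → IsFixed H n (A⁻¹ * B)) :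
    IsPrimitiveHarmonicMap H n N π D h ↔ IsPrimitiveHarmonicSigma H n D F := by
  constructor
  · rintro ⟨-, G, hG, hGh, hp⟩
    exact hp.gauge hH hD hG hF hn fun z hz =>
      hπ _ (hG.2 z hz) _ (hF.2 z hz) ((hGh z hz).trans (hh z hz))
  · intro hp
    exact ⟨fun z hz => by rw [hh z hz]; exact hN _ (hF.2 z hz), F, hF,
      fun z hz => (hh z hz).symm, hp⟩

/-! ### Stabilizers of the base points -/

lemma realMat_map {A : M3} (hA : A ∈ SLR) : (realMat A).map Complex.ofReal = R * A * R⁻¹ := by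
  ext i j
  simp only [realMat, Matrix.map_apply, Matrix.of_apply]
  exact Complex.ext rfl (by simp [hA.2 i j])

lemma mem_SLR_iff {A : M3} :
    A ∈ SLR ↔ A.det = 1 ∧ ∃ C : Matrix (Fin 3) (Fin 3) ℝ, C.map Complex.ofReal = R * A * R⁻¹ := by
  refine ⟨fun h => ⟨h.1, _, realMat_map h⟩, fun ⟨h, C, hC⟩ => ⟨h, fun i j => ?_⟩⟩
  rw [← hC]; simp

lemma map_ofReal_mul (A B : Matrix (Fin 3) (Fin 3) ℝ) :
    (A * B).map Complex.ofReal = A.map Complex.ofReal * B.map Complex.ofReal :=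
  Matrix.map_mul (f := Complex.ofRealHom)

lemma map_ofReal_inj {A B : Matrix (Fin 3) (Fin 3) ℝ}
    (h : A.map Complex.ofReal = B.map Complex.ofReal) : A = B := by
  ext i j
  exact Complex.ofReal_injective (congrFun (congrFun h i) j)

lemma det_map_ofReal (A : Matrix (Fin 3) (Fin 3) ℝ) :
    (A.map Complex.ofReal).det = (A.det : ℂ) := (Complex.ofRealHom.map_det A).symm

lemma det_realMat {A : M3} (hA : A ∈ SLR) : (realMat A).det = 1 := by
  have h := det_map_ofReal (realMat A)
  rw [realMat_map hA, Matrix.det_mul, Matrix.det_mul, hA.1, mul_one, ← Matrix.det_mul, R_mul_inv,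
    Matrix.det_one] at h
  exact_mod_cast h.symm

lemma conj_R_mul (A B : M3) : R * (A * B) * R⁻¹ = R * A * R⁻¹ * (R * B * R⁻¹) := by
  calc _ = R * A * 1 * B * R⁻¹ := by simp only [mul_assoc, one_mul]
    _ = _ := by rw [← inv_mul_R]; simp only [mul_assoc]

lemma mul_mem_SLR {A B : M3} (hA : A ∈ SLR) (hB : B ∈ SLR) : A * B ∈ SLR := by
  refine mem_SLR_iff.mpr ⟨by rw [Matrix.det_mul, hA.1, hB.1, one_mul], realMat A * realMat B, ?_⟩
  rw [map_ofReal_mul, realMat_map hA, realMat_map hB, conj_R_mul]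

lemma isUnit_det {A : M3} (hA : A ∈ SLR) : IsUnit A.det := by rw [hA.1]; exact isUnit_one

lemma inv_mem_SLR {A : M3} (hA : A ∈ SLR) : A⁻¹ ∈ SLR := by
  refine mem_SLR_iff.mpr ⟨by rw [Matrix.det_nonsing_inv, hA.1, Ring.inverse_one],
    (realMat A)⁻¹, ?_⟩
  have h1 : (realMat A)⁻¹.map Complex.ofReal * (R * A * R⁻¹) = 1 := by
    rw [← realMat_map hA, ← map_ofReal_mul, Matrix.nonsing_inv_mul _ (by
      rw [det_realMat hA]; exact isUnit_one)]
    simp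
  have h2 : R * A * R⁻¹ * (R * A⁻¹ * R⁻¹) = 1 := by
    rw [← conj_R_mul, Matrix.mul_nonsing_inv _ (isUnit_det hA), mul_one, R_mul_inv]
  calc _ = (realMat A)⁻¹.map Complex.ofReal * (R * A * R⁻¹ * (R * A⁻¹ * R⁻¹)) := by
        rw [h2, mul_one]
    _ = _ := by rw [← mul_assoc, h1, one_mul]

lemma realMat_mul {A B : M3} (hA : A ∈ SLR) (hB : B ∈ SLR) :
    realMat (A * B) = realMat A * realMat B := by
  apply map_ofReal_inj
  rw [map_ofReal_mul, realMat_map hA, realMat_map hB, realMat_map (mul_mem_SLR hA hB), conj_R_mul]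

lemma actR_mul {A B : M3} (hA : A ∈ SLR) (hB : B ∈ SLR) : actR (A * B) = actR A ∘ₗ actR B := by
  apply LinearMap.ext
  rintro ⟨a, b⟩
  simp [actR, realMat_mul hA hB, Matrix.mul_inv_rev, Matrix.transpose_mul]

lemma actC_mul (A B : M3) : actC (A * B) = actC A ∘ₗ actC B := by
  apply LinearMap.ext
  rintro ⟨a, b⟩
  have h := conj_R_mul A B
  simp only [actC, h, Matrix.mul_inv_rev (R * A * R⁻¹), Matrix.transpose_mul (R * B * R⁻¹)⁻¹]
  simp only [LinearMap.prodMap_apply, LinearMap.comp_apply, Matrix.mulVecLin_apply,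
    Matrix.mulVec_mulVec]

lemma actR_one : actR 1 = LinearMap.id := by
  apply LinearMap.ext
  rintro ⟨a, b⟩
  have : realMat 1 = 1 := by
    ext i j
    rw [realMat, mul_one, R_mul_inv]
    simp [Matrix.one_apply, apply_ite]
  simp [actR, this]

lemma actC_one : actC 1 = LinearMap.id := by
  apply LinearMap.ext
  rintro ⟨a, b⟩
  simp [actC, R_mul_inv]

lemma actR_inv_comp {A : M3} (hA : A ∈ SLR) : actR A⁻¹ ∘ₗ actR A = LinearMap.id := by
  rw [← actR_mul (inv_mem_SLR hA) hA, Matrix.nonsing_inv_mul _ (isUnit_det hA), actR_one]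

lemma actC_inv_comp {A : M3} (hA : A ∈ SLR) : actC A⁻¹ ∘ₗ actC A = LinearMap.id := by
  rw [← actC_mul, Matrix.nonsing_inv_mul _ (isUnit_det hA), actC_one]

section base
variable {H : ℝ} {K : M3}

lemma actR_eq_of_eq {A B : M3} (hA : A ∈ SLR) (hB : B ∈ SLR) {p : V3 × V3}
    (h : actR A p = actR B p) : actR (A⁻¹ * B) p = p := by
  rw [actR_mul (inv_mem_SLR hA) hB, LinearMap.comp_apply, ← h, ← LinearMap.comp_apply,
    actR_inv_comp hA, LinearMap.id_apply]

lemma map_actR_eq_of_eq {A B : M3} (hA : A ∈ SLR) (hB : B ∈ SLR) {V : Submodule ℝ (V3 × V3)}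
    (h : V.map (actR A) = V.map (actR B)) : V.map (actR (A⁻¹ * B)) = V := by
  rw [actR_mul (inv_mem_SLR hA) hB, Submodule.map_comp, ← h, ← Submodule.map_comp,
    actR_inv_comp hA, Submodule.map_id]

lemma map_actC_eq_of_eq {A B : M3} (hA : A ∈ SLR)
    {V : Submodule ℂ ((Fin 3 → ℂ) × (Fin 3 → ℂ))}
    (h : V.map (actC A) = V.map (actC B)) : V.map (actC (A⁻¹ * B)) = V := by
  rw [actC_mul, Submodule.map_comp, ← h, ← Submodule.map_comp,
    actC_inv_comp hA, Submodule.map_id]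

lemma PP_eq (hH : (H : ℂ) * H = 1) :
    P H * (P H)ᵀ = (!![eps ^ 4, 0, 0; 0, eps ^ 2, 0; 0, 0, 1] : M3) := by
  have h6 : eps ^ 6 = 1 := by
    rw [show eps ^ 6 = (eps ^ 3) ^ 2 by ring, eps_pow_three]; norm_num
  ext i j
  fin_cases i <;> fin_cases j <;> simp [P, Matrix.mul_apply, Fin.sum_univ_three]
  · ring
  · linear_combination eps ^ 2 * h6
  · linear_combination hH

lemma PPP_eq (hH : (H : ℂ) * H = 1) :
    P H * (P H)ᵀ * P H = (!![0, 1, 0; 1, 0, 0; 0, 0, -(H : ℂ)] : M3) := by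
  have h6 : eps ^ 6 = 1 := by
    rw [show eps ^ 6 = (eps ^ 3) ^ 2 by ring, eps_pow_three]; norm_num
  rw [PP_eq hH]
  ext i j
  fin_cases i <;> fin_cases j <;> simp [P, Matrix.mul_apply, Fin.sum_univ_three]
  · linear_combination h6
  · linear_combination h6

lemma map_conj_R : R.map conj = R * J := by
  ext i j
  fin_cases i <;> fin_cases j <;>
    simp [R, J, Matrix.mul_apply, Fin.sum_univ_three]

lemma map_conj_mul (A B : M3) : (A * B).map conj = A.map conj * B.map conj :=
  Matrix.map_mul (f := starRingEnd ℂ)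

/-- Reality of `R K R⁻¹`, combined with the fact that conjugation swaps the first two columns of
`R`. -/
lemma map_conj_SLR (hK : K ∈ SLR) : K.map conj = J * K * J := by
  have h1 : (R * K * R⁻¹).map conj = R * K * R⁻¹ := by
    ext i j
    exact Complex.conj_eq_iff_im.mpr (hK.2 i j)
  have h2 : (R * K).map conj = R * K * J := by
    have : R * K = R * K * R⁻¹ * R := by rw [mul_assoc _ R⁻¹, inv_mul_R, mul_one]
    rw [this, map_conj_mul, h1, map_conj_R, ← mul_assoc]
  rw [map_conj_mul, map_conj_R] at h2
  calc _ = J * (R⁻¹ * R) * (J * K.map conj) := by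
        rw [inv_mul_R, mul_one, ← mul_assoc, J_mul_J, one_mul]
    _ = J * R⁻¹ * (R * J * K.map conj) := by simp only [mul_assoc]
    _ = J * (R⁻¹ * R) * K * J := by rw [h2]; simp only [mul_assoc]
    _ = _ := by rw [inv_mul_R, mul_one]

lemma SLR_entry_one_zero (hK : K ∈ SLR) : conj (K 0 1) = K 1 0 := by
  have h := congrFun (congrFun (map_conj_SLR hK) 0) 1
  simpa [J, Matrix.mul_apply, Fin.sum_univ_three, Matrix.vecMul_eq_sum] using h

lemma R_mulVec_inj {a b : Fin 3 → ℂ} (hab : R *ᵥ a = R *ᵥ b) : a = b := by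
  have := congrArg (fun v => R⁻¹ *ᵥ v) hab
  simpa [Matrix.mulVec_mulVec, inv_mul_R] using this

lemma R_mulVec_single_two : R *ᵥ Pi.single 2 1 = Pi.single 2 1 := by
  ext i
  fin_cases i <;> simp [R]

/-- A group element which fixes the base point of the quadric is block diagonal. -/
lemma block_of_actR (hK : K ∈ SLR) (h : actR K basePt = basePt) :
    K 0 2 = 0 ∧ K 1 2 = 0 ∧ K 2 0 = 0 ∧ K 2 1 = 0 ∧ K 2 2 = 1 := by
  have hu : IsUnit (realMat K).det := by rw [det_realMat hK]; exact isUnit_one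
  have h1 : realMat K *ᵥ Pi.single 2 1 = Pi.single 2 1 := congrArg Prod.fst h
  have h2 : ((realMat K)⁻¹)ᵀ *ᵥ Pi.single 2 1 = Pi.single 2 1 := congrArg Prod.snd h
  have h3 : (realMat K)ᵀ *ᵥ Pi.single 2 1 = Pi.single 2 1 := by
    conv_lhs => rw [← h2]
    rw [Matrix.mulVec_mulVec, ← Matrix.transpose_mul, Matrix.nonsing_inv_mul _ hu,
      Matrix.transpose_one, Matrix.one_mulVec]
  have e1 : R * K = (realMat K).map Complex.ofReal * R := by
    rw [realMat_map hK, mul_assoc _ R⁻¹, inv_mul_R, mul_one]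
  have c : ∀ i, K i 2 = (1 : M3) i 2 := by
    have h4 : K *ᵥ Pi.single 2 1 = Pi.single 2 1 := by
      apply R_mulVec_inj
      rw [Matrix.mulVec_mulVec, e1, ← Matrix.mulVec_mulVec, R_mulVec_single_two]
      ext i
      have := congrFun h1 i
      simp only [Matrix.mulVec_single_one, Matrix.col_apply] at this
      simp [this, Pi.single_apply, apply_ite]
    intro i
    have := congrFun h4 i
    simpa [Matrix.one_apply, Pi.single_apply] using this
  have r : ∀ j, K 2 j = (1 : M3) 2 j := by
    intro j
    have h4 : (R * K) 2 j = ((realMat K).map Complex.ofReal * R) 2 j := by rw [e1]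
    have h5 := fun k => congrFun h3 k
    simp at h5
    simp only [Matrix.mul_apply, Fin.sum_univ_three, Matrix.map_apply, h5] at h4
    fin_cases j <;> simp [R] at h4 ⊢ <;> exact h4
  exact ⟨by simpa using c 0, by simpa using c 1, by simpa using r 0, by simpa using r 1,
    by simpa using r 2⟩

lemma transpose_R_mul : Rᵀ * Matrix.diagonal ![-(H : ℂ), -(H : ℂ), 1] * R =
    (!![0, -(H : ℂ), 0; -(H : ℂ), 0, 0; 0, 0, 1] : M3) := by
  have h2 := sqrtTwo_ne_zero
  have h3 := sqrtTwo_sq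
  ext i j
  fin_cases i <;> fin_cases j <;>
    simp [R, Matrix.mul_apply, Fin.sum_univ_three, Matrix.diagonal_apply] <;> field_simp <;>
    simp [Complex.I_sq] <;> linear_combination (H : ℂ) * h3

/-- A real matrix preserves the graph of a symmetric matrix `S` under this action exactly when it
preserves the bilinear form of `S`. In the basis given by `R`, that form is a multiple of `P Pᵀ P`.
-/
lemma fixed_of_map_baseLagr (hH : (H : ℂ) * H = 1) (hK : K ∈ SLR)
    (h : (baseLagr H).map (actR K) = baseLagr H) :
    K * (P H * (P H)ᵀ * P H) * Kᵀ = P H * (P H)ᵀ * P H := by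
  have hu : IsUnit (realMat K).det := by rw [det_realMat hK]; exact isUnit_one
  have h1 : (realMat K)ᵀ * Matrix.diagonal ![-H, -H, 1] * realMat K =
      Matrix.diagonal ![-H, -H, 1] := by
    have : ∀ y : V3, ((realMat K)ᵀ * Matrix.diagonal ![-H, -H, 1] * realMat K) *ᵥ y =
        Matrix.diagonal ![-H, -H, 1] *ᵥ y := by
      intro y
      have h2 : actR K (y, Matrix.diagonal ![-H, -H, 1] *ᵥ y) ∈ baseLagr H := by
        rw [← h]
        exact Submodule.mem_map_of_mem (by rw [baseLagr, LinearMap.mem_graph_iff]; rfl)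
      rw [baseLagr, LinearMap.mem_graph_iff] at h2
      have h3 : ((realMat K)⁻¹)ᵀ *ᵥ Matrix.diagonal ![-H, -H, 1] *ᵥ y =
        Matrix.diagonal ![-H, -H, 1] *ᵥ realMat K *ᵥ y := h2
      rw [← Matrix.mulVec_mulVec, ← Matrix.mulVec_mulVec, ← h3, Matrix.mulVec_mulVec,
        ← Matrix.transpose_mul, Matrix.nonsing_inv_mul _ hu, Matrix.transpose_one,
        Matrix.one_mulVec]
    exact Matrix.ext_of_mulVec_single fun i => this _
  have h2 : (R * K * R⁻¹)ᵀ * Matrix.diagonal ![-(H : ℂ), -(H : ℂ), 1] * (R * K * R⁻¹) =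
      Matrix.diagonal ![-(H : ℂ), -(H : ℂ), 1] := by
    have h3 := congrArg (fun X => X.map Complex.ofReal) h1
    simp only [map_ofReal_mul] at h3
    have h4 : (Matrix.diagonal ![-H, -H, 1]).map Complex.ofReal =
        Matrix.diagonal ![-(H : ℂ), -(H : ℂ), 1] := by
      ext i j
      fin_cases i <;> fin_cases j <;> simp
    rw [h4, Matrix.transpose_map, realMat_map hK] at h3
    exact h3
  set T := P H * (P H)ᵀ * P H with hT
  set S := Matrix.diagonal ![-(H : ℂ), -(H : ℂ), 1] with hS
  -- The constant is `-H` because the last entry of `P Pᵀ P` is `-H`, while that of the form is `1 =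
  -- -H · (-H)`.
  have h5 : Rᵀ * S * R = -(H : ℂ) • T := by
    rw [hS, hT, transpose_R_mul, PPP_eq hH]
    ext i j
    fin_cases i <;> fin_cases j <;> simp [hH]
  have h6 : Kᵀ * T * K = T := by
    have h7 : Kᵀ * (Rᵀ * S * R) * K = Rᵀ * S * R := by
      have hR : R⁻¹ * R = 1 := inv_mul_R
      have hRT : Rᵀ * R⁻¹ᵀ = 1 := by rw [← Matrix.transpose_mul, hR, Matrix.transpose_one]
      calc _ = (Rᵀ * R⁻¹ᵀ) * Kᵀ * (Rᵀ * S * R) * K * (R⁻¹ * R) := by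
            rw [hR, hRT, one_mul, mul_one]
        _ = Rᵀ * ((R * K * R⁻¹)ᵀ * S * (R * K * R⁻¹)) * R := by
            simp only [Matrix.transpose_mul, mul_assoc]
        _ = _ := by rw [h2]
    rw [h5, Matrix.mul_smul, Matrix.smul_mul] at h7
    have hH0 : -(H : ℂ) ≠ 0 := neg_ne_zero.mpr (left_ne_zero_of_mul_eq_one hH)
    exact smul_right_injective _ hH0 h7
  have hTT : T * T = 1 := PPP_mul_self hH
  have h8 : T * Kᵀ * T * K = 1 := by
    calc _ = T * (Kᵀ * T * K) := by simp only [mul_assoc]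
      _ = 1 := by rw [h6, hTT]
  have h9 : K * (T * Kᵀ * T) = 1 := mul_eq_one_comm.mp h8
  calc K * T * Kᵀ = K * (T * Kᵀ * T) * T := by
        simp only [mul_assoc, hTT, mul_one]
    _ = T := by rw [h9, one_mul]

/-- A diagonal matrix of determinant one with last entry one fixes `P`. -/
lemma fixed_of_diagonal (h : K = !![K 0 0, 0, 0; 0, K 1 1, 0; 0, 0, 1])
    (hd : K 0 0 * K 1 1 = 1) : K * P H * Kᵀ = P H := by
  rw [h]
  ext i j
  fin_cases i <;> fin_cases j <;> simp [P, Matrix.mul_apply, Fin.sum_univ_three]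
  · linear_combination eps ^ 2 * hd
  · linear_combination eps ^ 4 * hd

/-- Fixing the base point makes `K` block diagonal with last entry one. The determinant and the
invariance of the form then give `K₀₀ K₁₁ = 1` and kill the off-diagonal products, so `K` is
diagonal. -/
lemma fixed_of_pi1 (hH : (H : ℂ) * H = 1) (hK : K ∈ SLR) (h0 : actR K basePt = basePt)
    (h : (baseLagr H).map (actR K) = baseLagr H) : K * P H * Kᵀ = P H := by
  obtain ⟨h02, h12, h20, h21, h22⟩ := block_of_actR hK h0
  have hT := fixed_of_map_baseLagr hH hK h
  rw [PPP_eq hH] at hT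
  have hd := hK.1
  rw [Matrix.det_fin_three, h02, h12, h20, h21, h22] at hd
  have t := fun i j => congrFun (congrFun hT i) j
  have t00 := t 0 0
  have t11 := t 1 1
  have t01 := t 0 1
  simp [Matrix.mul_apply, Fin.sum_univ_three, h02, h12] at t00 t11 t01
  have e1 : K 0 0 * K 1 1 = 1 := by linear_combination (1 / 2 : ℂ) * hd + (1 / 2 : ℂ) * t01
  have n0 := left_ne_zero_of_mul_eq_one e1
  have n1 := right_ne_zero_of_mul_eq_one e1
  have e2 : K 0 1 = 0 := by
    refine (mul_eq_zero.mp ?_).resolve_left n0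
    linear_combination (1 / 2 : ℂ) * t00
  have e3 : K 1 0 = 0 := by
    refine (mul_eq_zero.mp ?_).resolve_left n1
    linear_combination (1 / 2 : ℂ) * t11
  refine fixed_of_diagonal ?_ e1
  ext i j
  fin_cases i <;> fin_cases j <;> simp [h02, h12, h20, h21, h22, e2, e3]

lemma adapted_two : adapted 2 = Pi.single 2 1 := R_mulVec_single_two

lemma mem_pcLine {v a b : Fin 3 → ℂ} :
    (a, b) ∈ pcLine v ↔ ∃ s t : ℂ, a = s • v ∧ b = t • v := by
  rw [pcLine, Submodule.mem_span_pair]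
  constructor
  · rintro ⟨s, t, h⟩
    refine ⟨s, t, ?_, ?_⟩
    · simpa using (congrArg Prod.fst h).symm
    · simpa using (congrArg Prod.snd h).symm
  · rintro ⟨s, t, rfl, rfl⟩
    exact ⟨s, t, by simp⟩

/-- The first component of the line determines the last column up to a factor, the second component
the last row. The plane gives `K₀₁ = 0`, and the remaining entry `K₁₀` is the conjugate of `K₀₁` in
the real form. -/
lemma diagonal_of_pi2 (hK : K ∈ SLR) (h1 : (baseFlag 1).map (actC K) = baseFlag 1)
    (h2 : (baseFlag 2).map (actC K) = baseFlag 2) :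
    K = !![K 0 0, 0, 0; 0, K 1 1, 0; 0, 0, K 2 2] := by
  have e : ∀ j, (R * K * R⁻¹) *ᵥ adapted j = R *ᵥ fun i => K i j := by
    intro j
    rw [adapted, Matrix.mulVec_mulVec, mul_assoc, inv_mul_R, mul_one, ← Matrix.mulVec_mulVec]
    congr 1
    ext i; simp
  have hu : IsUnit (R * K * R⁻¹).det := by
    rw [← realMat_map hK, det_map_ofReal, det_realMat hK]; simp
  obtain ⟨s, -, hs, -⟩ := mem_pcLine.mp (show actC K (adapted 2, 0) ∈ pcLine (adapted 2) by
    change _ ∈ baseFlag 1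
    rw [← h1]
    exact Submodule.mem_map_of_mem (mem_pcLine.mpr ⟨1, 0, by simp, by simp⟩))
  obtain ⟨-, t, -, ht⟩ := mem_pcLine.mp (show actC K (0, adapted 2) ∈ pcLine (adapted 2) by
    change _ ∈ baseFlag 1
    rw [← h1]
    exact Submodule.mem_map_of_mem (mem_pcLine.mpr ⟨0, 1, by simp, by simp⟩))
  have hm : actC K (adapted 1, 0) ∈ pcLine (adapted 2) ⊔ pcLine (adapted 1) := by
    change _ ∈ baseFlag 2
    rw [← h2]
    exact Submodule.mem_map_of_mem (Submodule.mem_sup_right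
      (mem_pcLine.mpr ⟨1, 0, by simp, by simp⟩))
  obtain ⟨⟨a, b⟩, hab, ⟨a', b'⟩, hab', hm⟩ := Submodule.mem_sup.mp hm
  obtain ⟨q, -, rfl, -⟩ := mem_pcLine.mp hab
  obtain ⟨r, -, rfl, -⟩ := mem_pcLine.mp hab'
  have hc2 : (fun i => K i 2) = s • Pi.single 2 1 := by
    apply R_mulVec_inj
    rw [← e, Matrix.mulVec_smul]; exact hs
  have hc1 : (fun i => K i 1) = q • Pi.single 2 1 + r • Pi.single 1 1 := by
    apply R_mulVec_inj
    rw [← e, Matrix.mulVec_add, Matrix.mulVec_smul, Matrix.mulVec_smul]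
    exact (congrArg Prod.fst hm).symm
  have ht' : ((R * K * R⁻¹)⁻¹)ᵀ *ᵥ adapted 2 = t • adapted 2 := ht
  have ht2 : adapted 2 = t • ((R * K * R⁻¹)ᵀ *ᵥ adapted 2) := by
    rw [← Matrix.mulVec_smul, ← ht', Matrix.mulVec_mulVec, ← Matrix.transpose_mul,
      Matrix.nonsing_inv_mul _ hu, Matrix.transpose_one, Matrix.one_mulVec]
  have ht3 : Rᵀ *ᵥ adapted 2 = t • ((R * K)ᵀ *ᵥ adapted 2) := by
    conv_lhs => rw [ht2]
    rw [Matrix.mulVec_smul, Matrix.mulVec_mulVec, ← Matrix.transpose_mul, mul_assoc, inv_mul_R,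
      mul_one]
  rw [adapted_two] at ht3
  have r0 := congrFun ht3 0
  have r1 := congrFun ht3 1
  have r2 := congrFun ht3 2
  have c0 := congrFun hc2 0
  have c1 := congrFun hc2 1
  have d0 := congrFun hc1 0
  simp [R, Matrix.vecMul_eq_sum, Fin.sum_univ_three] at r0 r1 r2 c0 c1 d0
  have t0 : t ≠ 0 := left_ne_zero_of_mul_eq_one r2.symm
  have k10 : K 1 0 = 0 := by rw [← SLR_entry_one_zero hK, d0, map_zero]
  ext i j
  fin_cases i <;> fin_cases j <;>
    simp [c0, c1, d0, k10, r0.resolve_left t0, r1.resolve_left t0]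

lemma commute_of_diagonal (hH : (H : ℂ) * H = 1)
    (h : K = !![K 0 0, 0, 0; 0, K 1 1, 0; 0, 0, K 2 2]) :
    K * (P H * (P H)ᵀ) = P H * (P H)ᵀ * K := by
  rw [PP_eq hH, h]
  ext i j
  fin_cases i <;> fin_cases j <;> simp [Matrix.mul_apply, Fin.sum_univ_three] <;> ring

lemma fixed_of_pi2 (hK : K ∈ SLR) (h0 : actR K basePt = basePt)
    (h1 : (baseFlag 1).map (actC K) = baseFlag 1) (h2 : (baseFlag 2).map (actC K) = baseFlag 2) :
    K * P H * Kᵀ = P H := by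
  have h := diagonal_of_pi2 hK h1 h2
  obtain ⟨-, -, -, -, h22⟩ := block_of_actR hK h0
  have hd := hK.1
  rw [h22] at h
  rw [h, Matrix.det_fin_three] at hd
  simp at hd
  exact fixed_of_diagonal h hd

end base

lemma pi1_mem {H : ℝ} {A : M3} (hA : A ∈ SLR) : pi1 H A ∈ FL1 H := by
  have hu : IsUnit (realMat A).det := by rw [det_realMat hA]; exact isUnit_one
  refine ⟨?_, Submodule.mem_map_of_mem ?_, A, hA, rfl⟩
  · change (realMat A *ᵥ Pi.single 2 1) ⬝ᵥ (((realMat A)⁻¹)ᵀ *ᵥ Pi.single 2 1) = 1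
    rw [Matrix.dotProduct_mulVec, Matrix.vecMul_transpose, Matrix.mulVec_mulVec,
      Matrix.nonsing_inv_mul _ hu, Matrix.one_mulVec]
    simp
  · rw [baseLagr, LinearMap.mem_graph_iff]
    ext i
    fin_cases i <;> simp [basePt, Matrix.mulVec_diagonal]

section gaussMaps
variable {H : ℝ} {D : Set ℂ} {F : ℂ → M3}

lemma inv_mul_pi3 {S A B : M3} (hA : A ∈ SLR) (h : A * S * Aᵀ = B * S * Bᵀ) :
    A⁻¹ * B * S * (A⁻¹ * B)ᵀ = S := by
  have h1 : A⁻¹ * A = 1 := Matrix.nonsing_inv_mul _ (isUnit_det hA)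
  have h2 : Aᵀ * A⁻¹ᵀ = 1 := by rw [← Matrix.transpose_mul, h1, Matrix.transpose_one]
  calc _ = A⁻¹ * (B * S * Bᵀ) * A⁻¹ᵀ := by simp only [Matrix.transpose_mul, mul_assoc]
    _ = (A⁻¹ * A) * S * (Aᵀ * A⁻¹ᵀ) := by rw [← h]; simp only [mul_assoc]
    _ = S := by rw [h1, h2, one_mul, mul_one]

lemma inv_mul_piFlagT {Q A B : M3} (hA : A ∈ SLR) (hB : B ∈ SLR)
    (h : A * Q * A⁻¹ = B * Q * B⁻¹) : A⁻¹ * B * Q = Q * (A⁻¹ * B) := by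
  have h1 : A⁻¹ * A = 1 := Matrix.nonsing_inv_mul _ (isUnit_det hA)
  have h2 : B⁻¹ * B = 1 := Matrix.nonsing_inv_mul _ (isUnit_det hB)
  calc _ = A⁻¹ * (B * Q * B⁻¹) * B := by simp only [mul_assoc, h2, mul_one]
    _ = (A⁻¹ * A) * Q * (A⁻¹ * B) := by rw [← h]; simp only [mul_assoc]
    _ = _ := by rw [h1, one_mul]

/-- Because `P` is an involution, so is `Pᵀ`. Inverting the transpose of `A P Aᵀ` therefore
reproduces `Pᵀ`, and the inner factors `Aᵀ` cancel. -/
lemma projFlag_pi3 (hH : (H : ℂ) * H = 1) {A : M3} (hA : A ∈ SLR) :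
    projFlag (pi3 H A) = piFlagT H A := by
  have hT := transpose_P_mul_self hH
  have h1 : Aᵀ * A⁻¹ᵀ = 1 := by
    rw [← Matrix.transpose_mul, Matrix.nonsing_inv_mul _ (isUnit_det hA), Matrix.transpose_one]
  have h2 : A * A⁻¹ = 1 := Matrix.mul_nonsing_inv _ (isUnit_det hA)
  have h3 : (A * P H * Aᵀ)ᵀ⁻¹ = A⁻¹ᵀ * (P H)ᵀ * A⁻¹ := by
    apply Matrix.inv_eq_right_inv
    simp only [Matrix.transpose_mul, Matrix.transpose_transpose]
    calc _ = A * ((P H)ᵀ * (Aᵀ * A⁻¹ᵀ) * (P H)ᵀ) * A⁻¹ := by simp only [mul_assoc]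
      _ = 1 := by rw [h1, mul_one, hT, mul_one, h2]
  rw [projFlag, pi3, h3, piFlagT]
  calc _ = A * P H * (Aᵀ * A⁻¹ᵀ) * (P H)ᵀ * A⁻¹ := by simp only [mul_assoc]
    _ = _ := by rw [h1]; simp only [mul_assoc, mul_one]

lemma projLagr_pi3 (hH : (H : ℂ) * H = 1) {A : M3} (hA : A ∈ SLR) :
    projLagr (pi3 H A) = piLagrT H A := by
  have h1 : A⁻¹ * A = 1 := Matrix.nonsing_inv_mul _ (isUnit_det hA)
  have h := projFlag_pi3 hH hA
  rw [projFlag] at h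
  rw [projLagr, h, piFlagT, pi3, piLagrT]
  calc _ = A * (P H * (P H)ᵀ) * (A⁻¹ * A) * P H * Aᵀ := by simp only [mul_assoc]
    _ = _ := by rw [h1]; simp only [mul_assoc, mul_one]

lemma gaussMap_FL1_iff (hH : (H : ℂ) * H = 1) (hD : IsOpen D) (hF : IsFrame D F) :
    IsPrimitiveHarmonicMap H 1 (FL1 H) (pi1 H) D (fun z => pi1 H (F z)) ↔
      IsPrimitiveHarmonicSigma H 1 D F :=
  isPrimitiveHarmonicMap_iff hH hD hF (.inl rfl) (fun _ _ => rfl) (fun _ hA => pi1_mem hA)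
    fun _ hA _ hB h => .inl ⟨rfl, fixed_of_pi1 hH (mul_mem_SLR (inv_mem_SLR hA) hB)
      (actR_eq_of_eq hA hB (congrArg Prod.fst h))
      (map_actR_eq_of_eq hA hB (congrArg Prod.snd h))⟩

lemma gaussMap_FL2_iff (hH : (H : ℂ) * H = 1) (hD : IsOpen D) (hF : IsFrame D F) :
    IsPrimitiveHarmonicMap H 1 FL2 pi2 D (fun z => pi2 (F z)) ↔
      IsPrimitiveHarmonicSigma H 1 D F :=
  isPrimitiveHarmonicMap_iff hH hD hF (.inl rfl) (fun _ _ => rfl) (fun _ hA => ⟨_, hA, rfl⟩)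
    fun _ hA _ hB h => .inl ⟨rfl, fixed_of_pi2 (mul_mem_SLR (inv_mem_SLR hA) hB)
      (actR_eq_of_eq hA hB (congrArg Prod.fst h))
      (map_actC_eq_of_eq hA (congrFun (congrArg Prod.snd h) 1))
      (map_actC_eq_of_eq hA (congrFun (congrArg Prod.snd h) 2))⟩

lemma gaussMap_FL3_iff (hH : (H : ℂ) * H = 1) (hD : IsOpen D) (hF : IsFrame D F) :
    IsPrimitiveHarmonicMap H 1 (FL3 H) (pi3 H) D (fun z => pi3 H (F z)) ↔
      IsPrimitiveHarmonicSigma H 1 D F :=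
  isPrimitiveHarmonicMap_iff hH hD hF (.inl rfl) (fun _ _ => rfl) (fun _ hA => ⟨_, hA, rfl⟩)
    fun _ hA _ _ h => .inl ⟨rfl, inv_mul_pi3 hA h⟩

lemma gaussMap_Fl2_iff (hH : (H : ℂ) * H = 1) (hD : IsOpen D) (hF : IsFrame D F) :
    IsPrimitiveHarmonicMap H 2 Fl2 (fun A => (pi2 A).2) D (fun z => (pi2 (F z)).2) ↔
      IsPrimitiveHarmonicSigma H 2 D F :=
  isPrimitiveHarmonicMap_iff hH hD hF (.inr (.inl rfl)) (fun _ _ => rfl)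
    (fun _ hA => ⟨_, hA, rfl⟩)
    fun _ hA _ hB h => .inr (.inl ⟨rfl, commute_of_diagonal hH
      (diagonal_of_pi2 (mul_mem_SLR (inv_mem_SLR hA) hB)
        (map_actC_eq_of_eq hA (congrFun h 1)) (map_actC_eq_of_eq hA (congrFun h 2)))⟩)

lemma gaussMap_Fl2T_iff (hH : (H : ℂ) * H = 1) (hD : IsOpen D) (hF : IsFrame D F) :
    IsPrimitiveHarmonicMap H 2 (Fl2T H) (piFlagT H) D (fun z => projFlag (pi3 H (F z))) ↔
      IsPrimitiveHarmonicSigma H 2 D F :=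
  isPrimitiveHarmonicMap_iff hH hD hF (.inr (.inl rfl)) (fun z hz => projFlag_pi3 hH (hF.2 z hz))
    (fun _ hA => ⟨_, hA, rfl⟩)
    fun _ hA _ hB h => .inr (.inl ⟨rfl, inv_mul_piFlagT hA hB h⟩)

lemma gaussMap_SLGr_iff (hH : (H : ℂ) * H = 1) (hD : IsOpen D) (hF : IsFrame D F) :
    IsPrimitiveHarmonicMap H 3 (SLGr H) (fun A => (pi1 H A).2) D (fun z => (pi1 H (F z)).2) ↔
      IsPrimitiveHarmonicSigma H 3 D F :=
  isPrimitiveHarmonicMap_iff hH hD hF (.inr (.inr rfl)) (fun _ _ => rfl)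
    (fun _ hA => ⟨_, hA, rfl⟩)
    fun _ hA _ hB h => .inr (.inr ⟨rfl, fixed_of_map_baseLagr hH
      (mul_mem_SLR (inv_mem_SLR hA) hB) (map_actR_eq_of_eq hA hB h)⟩)

lemma gaussMap_SLGrT_iff (hH : (H : ℂ) * H = 1) (hD : IsOpen D) (hF : IsFrame D F) :
    IsPrimitiveHarmonicMap H 3 (SLGrT H) (piLagrT H) D (fun z => projLagr (pi3 H (F z))) ↔
      IsPrimitiveHarmonicSigma H 3 D F :=
  isPrimitiveHarmonicMap_iff hH hD hF (.inr (.inr rfl)) (fun z hz => projLagr_pi3 hH (hF.2 z hz))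
    (fun _ hA => ⟨_, hA, rfl⟩)
    fun _ hA _ _ h => .inr (.inr ⟨rfl, inv_mul_pi3 hA h⟩)

end gaussMaps

/-! ### Coordinates with respect to the moving frame -/

/-- The real vector `a` has the complex coordinates `c₀, c₁, c₂` with respect to the columns
of `M`. -/
def Coords (M : M3) (a : V3) (c₀ c₁ c₂ : ℂ) : Prop :=
  ∀ k, (a k : ℂ) = c₀ * M k 0 + c₁ * M k 1 + c₂ * M k 2

section coords
variable {M N : M3} {a a' b x χ : V3} {c₀ c₁ c₂ d₀ d₁ d₂ : ℂ}

lemma Coords.congr (h : Coords M a c₀ c₁ c₂) (h₀ : c₀ = d₀) (h₁ : c₁ = d₁) (h₂ : c₂ = d₂) :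
    Coords M a d₀ d₁ d₂ := by
  rw [← h₀, ← h₁, ← h₂]; exact h

lemma Coords.smul (r : ℝ) (h : Coords M a c₀ c₁ c₂) :
    Coords M (r • a) (r * c₀) (r * c₁) (r * c₂) := fun k => by
  rw [Pi.smul_apply, smul_eq_mul, Complex.ofReal_mul, h k]; ring

lemma Coords.sub (h : Coords M a c₀ c₁ c₂) (h' : Coords M a' d₀ d₁ d₂) :
    Coords M (a - a') (c₀ - d₀) (c₁ - d₁) (c₂ - d₂) := fun k => by
  rw [Pi.sub_apply, Complex.ofReal_sub, h k, h' k]; ring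

lemma Coords.ext (h : Coords M a c₀ c₁ c₂) (h' : Coords M a' c₀ c₁ c₂) : a = a' := by
  ext k
  exact Complex.ofReal_injective ((h k).trans (h' k).symm)

lemma entry_inv (hNM : N * M = 1) (i j : Fin 3) :
    N i 0 * M 0 j + N i 1 * M 1 j + N i 2 * M 2 j = (1 : M3) i j := by
  rw [← hNM, Matrix.mul_apply, Fin.sum_univ_three]

lemma Coords.coord (hNM : N * M = 1) (h : Coords M a c₀ c₁ c₂) (i : Fin 3) :
    ![c₀, c₁, c₂] i = N i 0 * a 0 + N i 1 * a 1 + N i 2 * a 2 := by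
  have e0 := entry_inv hNM i 0
  have e1 := entry_inv hNM i 1
  have e2 := entry_inv hNM i 2
  rw [h 0, h 1, h 2]
  have : ![c₀, c₁, c₂] i = c₀ * (1 : M3) i 0 + c₁ * (1 : M3) i 1 + c₂ * (1 : M3) i 2 := by
    match i with
    | 0 => simp
    | 1 => simp
    | 2 => simp
  rw [this]
  linear_combination -c₀ * e0 - c₁ * e1 - c₂ * e2

lemma Coords.unique (hNM : N * M = 1) (h : Coords M a c₀ c₁ c₂) (h' : Coords M a d₀ d₁ d₂) :
    c₀ = d₀ ∧ c₁ = d₁ ∧ c₂ = d₂ :=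
  ⟨(h.coord hNM 0).trans (h'.coord hNM 0).symm, (h.coord hNM 1).trans (h'.coord hNM 1).symm,
    (h.coord hNM 2).trans (h'.coord hNM 2).symm⟩

/-- Coordinates of vectors in the frame and of covectors in the dual coframe pair without cross
terms. -/
lemma Coords.dot (hNM : N * M = 1) (h : Coords M a c₀ c₁ c₂) (h' : Coords Nᵀ b d₀ d₁ d₂) :
    ((a ⬝ᵥ b : ℝ) : ℂ) = c₀ * d₀ + c₁ * d₁ + c₂ * d₂ := by
  have e0 : c₀ = _ := h.coord hNM 0
  have e1 : c₁ = _ := h.coord hNM 1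
  have e2 : c₂ = _ := h.coord hNM 2
  rw [dotProduct, Fin.sum_univ_three]
  push_cast
  rw [h' 0, h' 1, h' 2, e0, e1, e2]
  simp only [Matrix.transpose_apply]
  ring

/-- As `x` is the last frame vector and `χ` the last coframe vector, horizontal projection simply
deletes the last coordinate. -/
lemma Coords.hor_fst (hNM : N * M = 1) (hx : Coords M x 0 0 1) (hχ : Coords Nᵀ χ 0 0 1)
    {p : V3 × V3} (h : Coords M p.1 c₀ c₁ c₂) : Coords M (hor x χ p).1 c₀ c₁ 0 := by
  refine (h.sub (hx.smul _)).congr (by simp) (by simp) ?_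
  rw [h.dot hNM hχ]; ring

lemma Coords.hor_snd (hNM : N * M = 1) (hx : Coords M x 0 0 1) (hχ : Coords Nᵀ χ 0 0 1)
    {p : V3 × V3} (h : Coords Nᵀ p.2 c₀ c₁ c₂) : Coords Nᵀ (hor x χ p).2 c₀ c₁ 0 := by
  refine (h.sub (hχ.smul _)).congr (by simp) (by simp) ?_
  rw [hx.dot hNM h]; ring

end coords

section conformal
variable {H : ℝ} {D : Set ℂ} {x χ : ℂ → V3} {z : ℂ}

lemma df_eq_re_add_im (x χ : ℂ → V3) (v z : ℂ) :
    df x χ v z = v.re • df x χ 1 z + v.im • df x χ Complex.I z := by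
  have e : ∀ y : ℂ → V3, fderiv ℝ y z v
      = v.re • fderiv ℝ y z 1 + v.im • fderiv ℝ y z Complex.I := fun y => by
    rw [← map_smul, ← map_smul, ← map_add]
    congr 1
    simp [Complex.re_add_im]
  unfold df hor
  simp only [e, add_dotProduct, dotProduct_add, smul_dotProduct, dotProduct_smul, smul_eq_mul]
  ext k <;> simp <;> ring

lemma re_mul_add_im_mul (a b : ℝ) (v : ℂ) : ((v.re * a + v.im * b : ℝ) : ℂ) =
    ((a : ℂ) - Complex.I * b) / 2 * v + conj (((a : ℂ) - Complex.I * b) / 2 * v) := by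
  rw [Complex.add_conj]
  norm_cast
  rw [show ((a : ℂ) - Complex.I * b) / 2 * v = (((a : ℂ) - Complex.I * b) * v) / (2 : ℝ) by
    push_cast; ring, Complex.div_ofReal_re]
  simp
  ring

lemma df_fst_eq (x χ : ℂ → V3) (v z : ℂ) (k : Fin 3) :
    ((df x χ v z).1 k : ℂ) = xiC x χ z k * v + conj (xiC x χ z k * v) := by
  rw [df_eq_re_add_im]
  exact re_mul_add_im_mul _ _ v

lemma df_snd_eq (x χ : ℂ → V3) (v z : ℂ) (k : Fin 3) :
    ((df x χ v z).2 k : ℂ) = etaC x χ z k * v + conj (etaC x χ z k * v) := by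
  rw [df_eq_re_add_im]
  exact re_mul_add_im_mul _ _ v

lemma psi_mul_add (p q a b : ℝ) : ((p * a + q * b : ℝ) : ℂ) =
    2 * (conj (((p : ℂ) - Complex.I * q) / 2) * (((a : ℂ) - Complex.I * b) / 2) +
      conj (conj (((p : ℂ) - Complex.I * q) / 2) * (((a : ℂ) - Complex.I * b) / 2))) := by
  simp only [map_mul, map_sub, map_div₀, Complex.conj_ofReal, Complex.conj_I, map_neg, map_ofNat]
  push_cast
  linear_combination (q : ℂ) * b * Complex.I_sq

lemma IsConformal.xiC_eq (hc : IsConformal H D x χ) (hz : z ∈ D) (k : Fin 3) :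
    xiC x χ z k = tFun H x χ z * frameM H x χ z k 0 := by
  simp [frameM, frameVec_eq, hc.tFun_ne_zero hz]

lemma IsConformal.etaC_eq (hc : IsConformal H D x χ) (hz : z ∈ D) (k : Fin 3) :
    etaC x χ z k = H * conj (tFun H x χ z) * coframe H x χ z 1 k := by
  have hH : (H : ℂ) * H = 1 := by exact_mod_cast hc.sq_eq_one
  have htc : conj (tFun H x χ z) ≠ 0 := (map_ne_zero _).mpr (hc.tFun_ne_zero hz)
  simp only [coframe, Matrix.of_apply, Matrix.cons_val_one, Matrix.cons_val_zero, map_inv₀]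
  field_simp
  linear_combination -(etaC x χ z k) * hH

lemma conj_coframe (k : Fin 3) : conj (coframe H x χ z 1 k) = coframe H x χ z 0 k := by
  simp [coframe]

lemma conj_frameM (k : Fin 3) : conj (frameM H x χ z k 0) = frameM H x χ z k 1 := rfl

lemma IsConformal.coords_df_fst (hc : IsConformal H D x χ) (hz : z ∈ D) (v : ℂ) :
    Coords (frameM H x χ z) (df x χ v z).1 (tFun H x χ z * v) (conj (tFun H x χ z * v)) 0 := by
  intro k
  rw [df_fst_eq, hc.xiC_eq hz, ← conj_frameM]
  simp only [map_mul]
  ring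

lemma IsConformal.coords_df_snd (hc : IsConformal H D x χ) (hz : z ∈ D) (v : ℂ) :
    Coords (coframe H x χ z)ᵀ (df x χ v z).2 (H * tFun H x χ z * conj v)
      (H * conj (tFun H x χ z) * v) 0 := by
  intro k
  rw [df_snd_eq, hc.etaC_eq hz]
  simp only [map_mul, Matrix.transpose_apply, ← conj_coframe (H := H) (x := x) (χ := χ) (z := z) k,
    Complex.conj_conj, Complex.conj_ofReal]
  ring

lemma coords_fst : Coords (frameM H x χ z) (x z) 0 0 1 := fun k => by simp [frameM]

lemma coords_snd : Coords (coframe H x χ z)ᵀ (χ z) 0 0 1 := fun k => by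
  simp [coframe]

/-! ### Lagrangian immersions -/

/-- The pulled back symplectic form is governed by the imaginary part of `t²`. -/
lemma IsConformal.omega_df (hc : IsConformal H D x χ) (hz : z ∈ D) (v w : ℂ) :
    ((omegaDP (df x χ v z) (df x χ w z) : ℝ) : ℂ) =
      H * (tFun H x χ z ^ 2 - conj (tFun H x χ z) ^ 2) * (v * conj w - w * conj v) / 2 := by
  have hNM := hc.coframe_mul_frameM hz
  rw [omegaDP]
  push_cast
  rw [(hc.coords_df_fst hz v).dot hNM (hc.coords_df_snd hz w),
    (hc.coords_df_fst hz w).dot hNM (hc.coords_df_snd hz v)]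
  simp only [map_mul]
  ring

lemma conj_eq_self_of_sq {t : ℂ} (hr : 0 < t.re) (h : conj t ^ 2 = t ^ 2) : conj t = t := by
  have h1 : (conj t - t) * (conj t + t) = 0 := by linear_combination h
  rcases mul_eq_zero.mp h1 with h1 | h1
  · exact sub_eq_zero.mp h1
  · have := congrArg Complex.re h1
    simp at this
    linarith

lemma IsConformal.lagrangian_iff (hc : IsConformal H D x χ) :
    (∀ z ∈ D, ∀ v w : ℂ, omegaDP (df x χ v z) (df x χ w z) = 0) ↔
      ∀ z ∈ D, conj (tFun H x χ z) = tFun H x χ z := by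
  have hH : (H : ℂ) * H = 1 := by exact_mod_cast hc.sq_eq_one
  refine forall₂_congr fun z hz => ⟨fun h => ?_, fun h v w => ?_⟩
  · refine conj_eq_self_of_sq (hc.tFun_re_pos hz) ?_
    have h1 := hc.omega_df hz 1 Complex.I
    rw [h] at h1
    have h1 := h1.symm
    simp at h1
    have h2 : (H : ℂ) ≠ 0 := left_ne_zero_of_mul_eq_one hH
    have h3 : (-Complex.I - Complex.I : ℂ) ≠ 0 := by
      rw [show -Complex.I - Complex.I = (-2) * Complex.I by ring]
      exact mul_ne_zero (by norm_num) Complex.I_ne_zero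
    have h4 := (h1.resolve_right h3).resolve_left (by exact_mod_cast h2)
    linear_combination -h4
  · have h1 := hc.omega_df hz v w
    rw [h] at h1
    simp only [sub_self, mul_zero, zero_mul, zero_div] at h1
    exact_mod_cast h1

/-! ### Minimal immersions -/

/-- The real divergence of `(a, b)` is four times the real part of the `z̄`-derivative of `(a - i b)
/ 2`. With it both the trace of the second fundamental form and the Laplacian become Wirtinger
derivatives. -/
lemma wd_I_eq_of_xiC {a b : ℂ → ℝ} {z : ℂ} (ha : DifferentiableAt ℝ a z)
    (hb : DifferentiableAt ℝ b z) :
    ((fderiv ℝ a z 1 + fderiv ℝ b z Complex.I : ℝ) : ℂ) =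
      2 * (wd Complex.I (fun y => ((a y : ℂ) - Complex.I * (b y : ℂ)) / 2) z +
        conj (wd Complex.I (fun y => ((a y : ℂ) - Complex.I * (b y : ℂ)) / 2) z)) := by
  have hac : DifferentiableAt ℝ (fun y => (a y : ℂ)) z :=
    Complex.ofRealCLM.differentiableAt.comp z ha
  have hbc : DifferentiableAt ℝ (fun y => (b y : ℂ)) z :=
    Complex.ofRealCLM.differentiableAt.comp z hb
  have e : (fun y => ((a y : ℂ) - Complex.I * (b y : ℂ)) / 2)
      = fun y => (1 / 2 : ℂ) * ((a y : ℂ) - Complex.I * (b y : ℂ)) := by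
    ext y; ring
  have hw : HasWd Complex.I (fun y => (1 / 2 : ℂ) * ((a y : ℂ) - Complex.I * (b y : ℂ))) _ z :=
    ((hasWd hac).sub ((hasWd hbc).const_mul _)).const_mul _
  rw [e, hw.2]
  unfold wd
  simp only [fderiv_ofReal_apply ha, fderiv_ofReal_apply hb, map_mul, map_sub, map_div₀, map_add,
    Complex.conj_ofReal, Complex.conj_I, map_ofNat, map_one]
  push_cast
  ring_nf
  simp only [Complex.I_sq]
  ring

section adapted

/-- The trace is built from `∂_z̄ ξ_z` minus the conjugate of `ψ_z` times `ξ_z`, and `ξ_z` is `t`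
times the first frame column. The formula for `t_z̄` and `ψ_z = -(p + q)` cancel all terms in `p`
and `q`, leaving `A t̄` and its conjugate along the first two columns. -/
lemma IsConformal.coords_nabla_fst (hD : IsOpen D) (hc : IsConformal H D x χ)
    (hdet : ∀ z ∈ D, (frameM H x χ z).det = R.det) (hz : z ∈ D) :
    Coords (frameM H x χ z) (nablaDP x χ 1 1 z + nablaDP x χ Complex.I Complex.I z).1
      (4 * (coeff (frameM H x χ) 0 1 z * conj (tFun H x χ z)))
      (4 * conj (coeff (frameM H x χ) 0 1 z * conj (tFun H x χ z))) 0 := by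
  have hA := hc.adaptedFrame hD hdet
  have hS := hA.structureEqs
  have hNM := hc.coframe_mul_frameM hz
  set t := tFun H x χ z with ht
  set M := frameM H x χ with hM
  have hMN : M z * (M z)⁻¹ = 1 :=
    Matrix.mul_nonsing_inv _ (isUnit_iff_ne_zero.mpr (hA.det_ne_zero z hz))
  have hb : mwd Complex.I M z = M z * mcZbar H (coeff M 0 0 z) (coeff M 1 1 z) (coeff M 0 1 z)
      (coeff M 1 0 z) t := by
    rw [← hA.mc_zbar hz, ← mul_assoc, hMN, one_mul]
  have hψ : psiC x χ z = -(coeff M 0 0 z + coeff M 1 1 z) := by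
    have h1 := congrFun (congrFun (hA.mc_z hz) 2) 2
    rw [hM, hc.inv_frameM hz, hc.entry_col hD hz] at h1
    exact h1
  have hw : ∀ k, wd Complex.I (fun y => xiC x χ y k) z =
      wd Complex.I (tFun H x χ) z * M z k 0 + t * mwd Complex.I M z k 0 := by
    intro k
    rw [wd_congr_on hD (fun y hy => hc.xiC_eq hy k) hz,
      wd_mul (diffAt_of_smooth hD hA.smooth_t hz) (hA.smooth.diffAt hD hz k 0)]
    rfl
  have hS1 : Coords (M z) (fderiv ℝ (fun y => (df x χ 1 y).1) z 1 - psi x χ 1 z • (df x χ 1 z).1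
      + (fderiv ℝ (fun y => (df x χ Complex.I y).1) z Complex.I
        - psi x χ Complex.I z • (df x χ Complex.I z).1))
      (4 * (coeff M 0 1 z * conj t)) (4 * conj (coeff M 0 1 z * conj t))
      -- The coordinate along `x` before projection; it drops out in the horizontal part.
      (-2 * H * (t ^ 2 + conj t ^ 2)) := by
    intro k
    have d1 := diffAt_of_smooth hD (hc.smooth_df_fst hD 1) hz
    have dI := diffAt_of_smooth hD (hc.smooth_df_fst hD Complex.I) hz
    have d1k := diffAt_of_smooth hD (contDiffOn_pi.mp (hc.smooth_df_fst hD 1) k) hz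
    have dIk := diffAt_of_smooth hD (contDiffOn_pi.mp (hc.smooth_df_fst hD Complex.I) k) hz
    have e1 := wd_I_eq_of_xiC d1k dIk
    rw [fderiv_component d1, fderiv_component dI] at e1
    have e2 : ((psi x χ 1 z * (df x χ 1 z).1 k + psi x χ Complex.I z * (df x χ Complex.I z).1 k
        : ℝ) : ℂ) = 2 * (conj (psiC x χ z) * xiC x χ z k + conj (conj (psiC x χ z) * xiC x χ z k)) :=
      psi_mul_add _ _ _ _
    have e3 := hw k
    rw [show (fun y => xiC x χ y k) = fun y => (((df x χ 1 y).1 k : ℂ)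
      - Complex.I * ((df x χ Complex.I y).1 k : ℂ)) / 2 from rfl] at e3
    rw [e3] at e1
    have e4 : mwd Complex.I M z k 0 = M z k 0 * conj (coeff M 1 1 z)
        + M z k 1 * conj (coeff M 0 1 z) - H * t * M z k 2 := by
      rw [hb, Matrix.mul_apply, Fin.sum_univ_three]
      simp [mcZbar]
      ring
    have e5 : conj (M z k 1) = M z k 0 := by rw [← hA.conj_zero z hz, Complex.conj_conj]
    rw [e4, hS.tbar z hz] at e1
    rw [hc.xiC_eq hz, hψ] at e2
    simp only [map_mul, map_add, map_sub, map_neg, Complex.conj_conj, Complex.conj_ofReal, e5,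
      map_ofNat, hA.conj_zero z hz, hA.conj_two z hz] at e1 e2 ⊢
    simp only [Pi.add_apply, Pi.sub_apply, Pi.smul_apply, smul_eq_mul]
    rw [← hM, ← ht, hA.conj_zero z hz] at e2
    rw [← ht] at e1
    push_cast at e1 e2 ⊢
    linear_combination e1 - e2
  have e := Coords.hor_fst hNM coords_fst coords_snd (p := (_, fderiv ℝ (fun y => (df x χ 1 y).2) z 1 + psi x χ 1 z • (df x χ 1 z).2
      + (fderiv ℝ (fun y => (df x χ Complex.I y).2) z Complex.I
        + psi x χ Complex.I z • (df x χ Complex.I z).2))) hS1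
  convert e using 1
  simp only [nablaDP, hor, Prod.fst_add, add_dotProduct, add_smul]
  abel

/-- The same computation in the coframe, where `η_z` is `H t̄` times the middle row, so that the
formula for `t_z` enters through its conjugate. -/
lemma IsConformal.coords_nabla_snd (hD : IsOpen D) (hc : IsConformal H D x χ)
    (hdet : ∀ z ∈ D, (frameM H x χ z).det = R.det) (hz : z ∈ D) :
    Coords (coframe H x χ z)ᵀ (nablaDP x χ 1 1 z + nablaDP x χ Complex.I Complex.I z).2
      (-4 * (H * conj (tFun H x χ z * coeff (frameM H x χ) 0 1 z)))
      (-4 * (H * (tFun H x χ z * coeff (frameM H x χ) 0 1 z))) 0 := by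
  have hA := hc.adaptedFrame hD hdet
  have hS := hA.structureEqs
  have hNM := hc.coframe_mul_frameM hz
  set t := tFun H x χ z with ht
  set M := frameM H x χ with hM
  have hMN : M z * (M z)⁻¹ = 1 :=
    Matrix.mul_nonsing_inv _ (isUnit_iff_ne_zero.mpr (hA.det_ne_zero z hz))
  have hb : mwd Complex.I (coframe H x χ) z = -(mcZbar H (coeff M 0 0 z) (coeff M 1 1 z)
      (coeff M 0 1 z) (coeff M 1 0 z) t * coframe H x χ z) := by
    rw [mwd_congr_on hD (fun y hy => (hc.inv_frameM hy).symm) hz,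
      mwd_inv hD hA.smooth hA.det_ne_zero hz, ← hA.mc_zbar hz, hc.inv_frameM hz]
  have hNs : MSmooth D (coframe H x χ) :=
    (hA.smooth.inv hA.det_ne_zero).congr fun y hy => (hc.inv_frameM hy).symm
  have hψ : psiC x χ z = -(coeff M 0 0 z + coeff M 1 1 z) := by
    have h1 := congrFun (congrFun (hA.mc_z hz) 2) 2
    rw [hM, hc.inv_frameM hz, hc.entry_col hD hz] at h1
    exact h1
  have dt := diffAt_of_smooth hD hA.smooth_t hz
  have hw : ∀ k, wd Complex.I (fun y => etaC x χ y k) z =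
      H * (conj (wd (-Complex.I) (tFun H x χ) z) * coframe H x χ z 1 k
        + conj t * mwd Complex.I (coframe H x χ) z 1 k) := by
    intro k
    have h1 : HasWd Complex.I (fun y => conj (tFun H x χ y))
        (conj (wd (-Complex.I) (tFun H x χ) z)) z :=
      HasWd.conj (by rw [Complex.conj_I]; exact hasWd dt)
    have h2 := (h1.mul (hasWd (θ := Complex.I) (hNs.diffAt hD hz 1 k))).const_mul (H : ℂ)
    rw [wd_congr_on hD (fun y hy => (hc.etaC_eq hy k).trans (mul_assoc _ _ _)) hz, h2.2]
    rfl
  have hS1 : Coords (coframe H x χ z)ᵀ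
      (fderiv ℝ (fun y => (df x χ 1 y).2) z 1 + psi x χ 1 z • (df x χ 1 z).2
        + (fderiv ℝ (fun y => (df x χ Complex.I y).2) z Complex.I
        + psi x χ Complex.I z • (df x χ Complex.I z).2))
      (-4 * (H * conj (t * coeff M 0 1 z))) (-4 * (H * (t * coeff M 0 1 z)))
      (-2 * H * (t ^ 2 + conj t ^ 2)) := by
    intro k
    have d1 := diffAt_of_smooth hD (hc.smooth_df_snd hD 1) hz
    have dI := diffAt_of_smooth hD (hc.smooth_df_snd hD Complex.I) hz
    have d1k := diffAt_of_smooth hD (contDiffOn_pi.mp (hc.smooth_df_snd hD 1) k) hz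
    have dIk := diffAt_of_smooth hD (contDiffOn_pi.mp (hc.smooth_df_snd hD Complex.I) k) hz
    have e1 := wd_I_eq_of_xiC d1k dIk
    rw [fderiv_component d1, fderiv_component dI] at e1
    have e2 : ((psi x χ 1 z * (df x χ 1 z).2 k + psi x χ Complex.I z * (df x χ Complex.I z).2 k
        : ℝ) : ℂ) = 2 * (conj (psiC x χ z) * etaC x χ z k
          + conj (conj (psiC x χ z) * etaC x χ z k)) := psi_mul_add _ _ _ _
    have e3 := hw k
    rw [show (fun y => etaC x χ y k) = fun y => (((df x χ 1 y).2 k : ℂ)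
      - Complex.I * ((df x χ Complex.I y).2 k : ℂ)) / 2 from rfl] at e3
    rw [e3] at e1
    have e4 : mwd Complex.I (coframe H x χ) z 1 k = -(conj (coeff M 0 1 z) * coframe H x χ z 0 k
        + conj (coeff M 0 0 z) * coframe H x χ z 1 k + conj t * coframe H x χ z 2 k) := by
      rw [hb, Matrix.neg_apply, Matrix.mul_apply, Fin.sum_univ_three]
      simp [mcZbar]
    have e5 : conj (coframe H x χ z 0 k) = coframe H x χ z 1 k := by
      rw [← conj_coframe, Complex.conj_conj]
    have e6 : conj (coframe H x χ z 2 k) = coframe H x χ z 2 k := Complex.conj_ofReal _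
    rw [e4, hS.tz z hz] at e1
    rw [hc.etaC_eq hz, hψ] at e2
    simp only [map_mul, map_add, map_sub, map_neg, Complex.conj_conj, Complex.conj_ofReal, e5, e6,
      map_ofNat, conj_coframe] at e1 e2 ⊢
    simp only [Pi.add_apply, Pi.smul_apply, smul_eq_mul, Matrix.transpose_apply]
    rw [← ht] at e1 e2
    push_cast at e1 e2 ⊢
    linear_combination e1 + e2
  have e := Coords.hor_snd hNM coords_fst coords_snd (p := (fderiv ℝ (fun y => (df x χ 1 y).1) z 1,
    _)) hS1
  convert e using 1
  simp only [nablaDP, hor, Prod.snd_add, dotProduct_add, add_smul]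
  abel

lemma IsConformal.minimal_iff (hD : IsOpen D) (hc : IsConformal H D x χ)
    (hdet : ∀ z ∈ D, (frameM H x χ z).det = R.det) :
    (∀ z ∈ D, ∀ n : V3 × V3, IsHorizontal (x z) (χ z) n → (∀ v : ℂ, gDP n (df x χ v z) = 0) →
      gDP n (nablaDP x χ 1 1 z + nablaDP x χ Complex.I Complex.I z) = 0) ↔
      ∀ z ∈ D, coeff (frameM H x χ) 0 1 z = 0 := by
  have hH : (H : ℂ) * H = 1 := by exact_mod_cast hc.sq_eq_one
  refine forall₂_congr fun z hz => ?_
  have hNM := hc.coframe_mul_frameM hz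
  have h1 := hc.coords_nabla_fst hD hdet hz
  have h2 := hc.coords_nabla_snd hD hdet hz
  set m := nablaDP x χ 1 1 z + nablaDP x χ Complex.I Complex.I z
  constructor
  · intro h
    -- The trace vector `m` is itself horizontal and normal, so it may be used as the test vector.
    -- Its square is `-16 H |A|² (t² + t̄²)`, and `t² + t̄²` is twice the conformal factor.
    have hn : gDP m m = 0 := by
      refine h m ⟨?_, ?_⟩ fun v => ?_
      · have := h1.dot hNM coords_snd
        simp only [mul_zero, add_zero, zero_mul] at this
        exact_mod_cast this
      · have := coords_fst.dot hNM h2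
        simp only [mul_zero, add_zero, zero_mul] at this
        exact_mod_cast this
      · have e1 := h1.dot hNM (hc.coords_df_snd hz v)
        have e2 := (hc.coords_df_fst hz v).dot hNM h2
        have e3 : ((gDP m (df x χ v z) : ℝ) : ℂ) = 0 := by
          rw [gDP]
          push_cast
          rw [e1, e2]
          simp only [map_mul, Complex.conj_conj]
          ring
        exact_mod_cast e3
    have e1 := h1.dot hNM h2
    have e2 : ((gDP m m : ℝ) : ℂ) = 0 := by rw [hn]; simp
    rw [gDP] at e2
    push_cast at e2
    rw [e1] at e2
    have hre : tFun H x χ z ^ 2 + conj (tFun H x χ z) ^ 2 ≠ 0 := by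
      rw [← map_pow, Complex.add_conj, hc.tFun_sq_re hz]
      exact_mod_cast (mul_pos two_pos (hc.expU_pos z hz)).ne'
    have e3 : coeff (frameM H x χ) 0 1 z * conj (coeff (frameM H x χ) 0 1 z) *
        (tFun H x χ z ^ 2 + conj (tFun H x χ z) ^ 2) = 0 := by
      simp only [map_mul, Complex.conj_conj] at e2
      linear_combination (-(H : ℂ) / 16) * e2 - (coeff (frameM H x χ) 0 1 z
        * conj (coeff (frameM H x χ) 0 1 z) *
        (tFun H x χ z ^ 2 + conj (tFun H x χ z) ^ 2)) * hH
    have e4 := (mul_eq_zero.mp e3).resolve_right hre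
    rcases mul_eq_zero.mp e4 with e5 | e5
    · exact e5
    · exact (map_eq_zero _).mp e5
  · intro h n _ _
    rw [h] at h1 h2
    have z1 : m.1 = 0 := h1.ext fun k => by simp
    have z2 : m.2 = 0 := h2.ext fun k => by simp
    simp [gDP, z1, z2]

/-! ### Flatness -/

/-- The function `u` of the induced metric `2 H e^u |dz|²`, as a complex function. -/
def logFactor (t : ℂ → ℂ) (z : ℂ) : ℂ := (Real.log (t z ^ 2).re : ℝ)

/-- The Laplacian is four times the mixed Wirtinger derivative, which is real for a real function
since the two operators commute. -/
lemma laplacian_eq {g : ℂ → ℝ} (hD : IsOpen D) (hg : ContDiffOn ℝ ∞ g D) (hz : z ∈ D) :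
    ((fderiv ℝ (fun y => fderiv ℝ g y 1) z 1
      + fderiv ℝ (fun y => fderiv ℝ g y Complex.I) z Complex.I : ℝ) : ℂ)
      = 4 * wd Complex.I (wd (-Complex.I) (fun y => (g y : ℂ))) z := by
  have d1 := diffAt_of_smooth hD (smooth_fderiv hD hg 1) hz
  have dI := diffAt_of_smooth hD (smooth_fderiv hD hg Complex.I) hz
  have e := wd_I_eq_of_xiC d1 dI
  have e1 : wd Complex.I (wd (-Complex.I) (fun y => (g y : ℂ))) z = wd Complex.I (fun y =>
      ((fderiv ℝ g y 1 : ℂ) - Complex.I * (fderiv ℝ g y Complex.I : ℂ)) / 2) z := by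
    refine wd_congr_on hD (fun y hy => ?_) hz
    rw [wd, fderiv_ofReal_apply (diffAt_of_smooth hD hg hy),
      fderiv_ofReal_apply (diffAt_of_smooth hD hg hy)]
    ring
  have e2 : conj (wd Complex.I (wd (-Complex.I) (fun y => (g y : ℂ))) z)
      = wd Complex.I (wd (-Complex.I) (fun y => (g y : ℂ))) z := by
    have hgc := smooth_ofReal hg
    have s := smooth_wd hD hgc (-Complex.I)
    have h1 := wd_conj (θ := -Complex.I) (diffAt_of_smooth hD s hz)
    rw [map_neg, Complex.conj_I, neg_neg] at h1
    rw [← h1, wd_comm hD hgc hz Complex.I]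
    refine wd_congr_on hD (fun y hy => ?_) hz
    have h2 := wd_conj (θ := Complex.I) (diffAt_of_smooth hD hgc hy)
    simp only [Complex.conj_ofReal, Complex.conj_I] at h2
    exact h2.symm
  rw [e, ← e1, e2]
  ring

lemma IsConformal.flat_iff (hD : IsOpen D) (hc : IsConformal H D x χ) :
    (∀ z ∈ D, fderiv ℝ (fun y => fderiv ℝ (fun w => Real.log (expU H x χ w)) y 1) z 1 +
      fderiv ℝ (fun y => fderiv ℝ (fun w => Real.log (expU H x χ w)) y Complex.I) z Complex.I = 0)
      ↔ ∀ z ∈ D, wd Complex.I (wd (-Complex.I) (logFactor (tFun H x χ))) z = 0 := by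
  have hs : ContDiffOn ℝ ∞ (fun w => Real.log (expU H x χ w)) D :=
    (hc.smooth_expU hD).log fun z hz => (hc.expU_pos z hz).ne'
  refine forall₂_congr fun z hz => ?_
  have h := laplacian_eq hD hs hz
  have e : wd Complex.I (wd (-Complex.I) (logFactor (tFun H x χ))) z
      = wd Complex.I (wd (-Complex.I) (fun y => ((Real.log (expU H x χ y) : ℝ) : ℂ))) z := by
    refine wd_congr_on hD (fun y hy => wd_congr_on hD (fun w hw => ?_) hy) hz
    rw [logFactor, hc.tFun_sq_re hw]
  rw [e, ← Complex.ofReal_eq_zero, h]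
  simp

end adapted
end conformal

/-! ### Infinitesimal isometries in the moving frame -/

/-- The real matrix `X` in the moving frame `M`. -/
def frameField (M : ℂ → M3) (X : Matrix (Fin 3) (Fin 3) ℝ) (z : ℂ) : M3 :=
  (M z)⁻¹ * X.map Complex.ofReal * M z

section frameField
variable {H : ℝ} {D : Set ℂ} {M : ℂ → M3} {t : ℂ → ℂ} {z : ℂ} {X Y : Matrix (Fin 3) (Fin 3) ℝ}

lemma AdaptedFrame.inv_mul (h : AdaptedFrame H D M t) (hz : z ∈ D) : (M z)⁻¹ * M z = 1 :=
  Matrix.nonsing_inv_mul _ (isUnit_iff_ne_zero.mpr (h.det_ne_zero z hz))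

lemma AdaptedFrame.mul_inv (h : AdaptedFrame H D M t) (hz : z ∈ D) : M z * (M z)⁻¹ = 1 :=
  Matrix.mul_nonsing_inv _ (isUnit_iff_ne_zero.mpr (h.det_ne_zero z hz))

lemma map_ofReal_sub (X Y : Matrix (Fin 3) (Fin 3) ℝ) :
    (X - Y).map Complex.ofReal = X.map Complex.ofReal - Y.map Complex.ofReal := by
  ext; simp

lemma frameField_sub : frameField M (X - Y) z = frameField M X z - frameField M Y z := by
  rw [frameField, map_ofReal_sub, mul_sub, sub_mul]; rfl

lemma frameField_add : frameField M (X + Y) z = frameField M X z + frameField M Y z := by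
  have : (X + Y).map Complex.ofReal = X.map Complex.ofReal + Y.map Complex.ofReal := by
    ext; simp
  rw [frameField, this, mul_add, add_mul]; rfl

lemma frameField_smul (r : ℝ) : frameField M (r • X) z = (r : ℂ) • frameField M X z := by
  have : (r • X).map Complex.ofReal = (r : ℂ) • X.map Complex.ofReal := by
    ext; simp
  rw [frameField, this, Matrix.mul_smul, Matrix.smul_mul]; rfl

lemma AdaptedFrame.frameField_bracket (h : AdaptedFrame H D M t) (hz : z ∈ D) :
    frameField M (X * Y - Y * X) z =
      frameField M X z * frameField M Y z - frameField M Y z * frameField M X z := by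
  have e := h.mul_inv hz
  have key : ∀ X Y : Matrix (Fin 3) (Fin 3) ℝ,
      frameField M (X * Y) z = frameField M X z * frameField M Y z := fun X Y => by
    unfold frameField
    calc _ = (M z)⁻¹ * (X.map Complex.ofReal * 1 * Y.map Complex.ofReal) * M z := by
          rw [map_ofReal_mul, mul_one]
      _ = _ := by rw [← e]; simp only [mul_assoc]
  rw [frameField_sub, key, key]

lemma AdaptedFrame.trace_frameField (h : AdaptedFrame H D M t) (hz : z ∈ D) :
    (frameField M X z).trace = (X.trace : ℝ) := by
  rw [frameField, Matrix.trace_mul_comm, ← mul_assoc, h.mul_inv hz, one_mul]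
  simp [Matrix.trace]

lemma AdaptedFrame.smooth_frameField (h : AdaptedFrame H D M t) : MSmooth D (frameField M X) :=
  ((h.smooth.inv h.det_ne_zero).mul (MSmooth.const _)).mul h.smooth

/-- A constant matrix seen in a moving frame satisfies the Lax equation with the Maurer–Cartan form.
-/
lemma AdaptedFrame.mwd_frameField (h : AdaptedFrame H D M t) (hz : z ∈ D) (θ : ℂ) :
    mwd θ (frameField M X) z = frameField M X z * ((M z)⁻¹ * mwd θ M z)
      - (M z)⁻¹ * mwd θ M z * frameField M X z := by
  have hi := h.smooth.inv h.det_ne_zero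
  have e := h.mul_inv hz
  have h1 := mwd_mul (θ := θ) h.isOpen (hi.mul (MSmooth.const (X.map Complex.ofReal))) h.smooth hz
  rw [mwd_mul_const h.isOpen _ hi hz, mwd_inv h.isOpen h.smooth h.det_ne_zero hz] at h1
  change mwd θ (frameField M X) z = _ at h1
  rw [h1]
  unfold frameField
  calc _ = (M z)⁻¹ * X.map Complex.ofReal * 1 * mwd θ M z
        - (M z)⁻¹ * mwd θ M z * (M z)⁻¹ * X.map Complex.ofReal * M z := by noncomm_ring
    _ = _ := by rw [← e]; simp only [mul_assoc]

lemma AdaptedFrame.inv_map_conj (h : AdaptedFrame H D M t) (hz : z ∈ D) :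
    (M z)⁻¹.map conj = J * (M z)⁻¹ := by
  have h1 : (M z)⁻¹.map conj * (M z).map conj = 1 := by
    rw [← map_conj_mul, h.inv_mul hz]
    ext i j
    simp [Matrix.one_apply, apply_ite]
  rw [h.map_conj hz, ← mul_assoc] at h1
  have h2 : J * ((M z)⁻¹.map conj * M z) = 1 := mul_eq_one_comm.mp h1
  rw [← mul_assoc] at h2
  have h3 : (M z)⁻¹ = J * (M z)⁻¹.map conj := Matrix.inv_eq_left_inv h2
  conv_rhs => rw [h3, ← mul_assoc, J_mul_J, one_mul]

lemma AdaptedFrame.frameField_map_conj (h : AdaptedFrame H D M t) (hz : z ∈ D) :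
    (frameField M X z).map conj = J * frameField M X z * J := by
  unfold frameField
  have e : (X.map Complex.ofReal).map conj = X.map Complex.ofReal := by
    ext i j; simp
  rw [map_conj_mul, map_conj_mul, e, h.inv_map_conj hz, h.map_conj hz]
  simp only [mul_assoc]

lemma AdaptedFrame.conj_frameField (h : AdaptedFrame H D M t) (hz : z ∈ D) :
    conj (frameField M X z 0 0) = frameField M X z 1 1 ∧
    conj (frameField M X z 0 1) = frameField M X z 1 0 ∧
    conj (frameField M X z 0 2) = frameField M X z 1 2 ∧
    conj (frameField M X z 2 0) = frameField M X z 2 1 ∧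
    conj (frameField M X z 2 2) = frameField M X z 2 2 := by
  have e := fun i j => congrFun (congrFun (h.frameField_map_conj (X := X) hz) i) j
  have e00 := e 0 0
  have e01 := e 0 1
  have e02 := e 0 2
  have e20 := e 2 0
  have e22 := e 2 2
  simp [J, Matrix.mul_apply, Fin.sum_univ_three, Matrix.vecMul_eq_sum] at e00 e01 e02 e20 e22
  exact ⟨e00, e01, e02, e20, e22⟩

end frameField

section conformal
variable {H : ℝ} {D : Set ℂ} {x χ : ℂ → V3} {z : ℂ} {X : Matrix (Fin 3) (Fin 3) ℝ}

/-- Since `x` is the last frame column, the last column of `M⁻¹ X M` lists the frame coordinates of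
`X x`; dually, the last row governs `Xᵀ χ`. -/
lemma IsConformal.coords_mulVec (hc : IsConformal H D x χ) (hz : z ∈ D) :
    Coords (frameM H x χ z) (X *ᵥ x z) (frameField (frameM H x χ) X z 0 2)
      (frameField (frameM H x χ) X z 1 2) (frameField (frameM H x χ) X z 2 2) := by
  intro k
  have h1 : frameM H x χ z * (frameM H x χ z)⁻¹ = 1 := by
    rw [hc.inv_frameM hz]; exact mul_eq_one_comm.mp (hc.coframe_mul_frameM hz)
  have h2 : X.map Complex.ofReal * frameM H x χ z
      = frameM H x χ z * frameField (frameM H x χ) X z := by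
    rw [frameField, ← mul_assoc, ← mul_assoc, h1, one_mul]
  have h3 := congrFun (congrFun h2 k) 2
  have e : ∀ l, frameM H x χ z l 2 = x z l := fun l => rfl
  simp only [Matrix.mul_apply, Fin.sum_univ_three, Matrix.map_apply, e] at h3
  simp only [Matrix.mulVec, dotProduct, Fin.sum_univ_three]
  push_cast
  linear_combination h3 + frameField (frameM H x χ) X z 2 2 * (e k).symm

lemma IsConformal.coords_transpose_mulVec (hc : IsConformal H D x χ) (hz : z ∈ D) :
    Coords (coframe H x χ z)ᵀ (-(Xᵀ *ᵥ χ z)) (-frameField (frameM H x χ) X z 2 0)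
      (-frameField (frameM H x χ) X z 2 1) (-frameField (frameM H x χ) X z 2 2) := by
  intro k
  have h1 : frameM H x χ z * (frameM H x χ z)⁻¹ = 1 := by
    rw [hc.inv_frameM hz]; exact mul_eq_one_comm.mp (hc.coframe_mul_frameM hz)
  have h2 : coframe H x χ z * X.map Complex.ofReal
      = frameField (frameM H x χ) X z * coframe H x χ z := by
    rw [frameField, ← hc.inv_frameM hz, mul_assoc, h1, mul_one]
  have h3 := congrFun (congrFun h2 2) k
  have e : ∀ l, coframe H x χ z 2 l = χ z l := fun l => rfl
  simp only [Matrix.mul_apply, Fin.sum_univ_three, Matrix.map_apply, e] at h3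
  simp only [Matrix.mulVec, dotProduct, Fin.sum_univ_three, Matrix.transpose_apply, Pi.neg_apply]
  push_cast
  linear_combination -h3 + frameField (frameM H x χ) X z 2 2 * (e k)

/-- The differential of `f` in the direction `v` is the value of the fundamental vector field
of `X`, in terms of the entries of `X` in the moving frame. -/
lemma IsConformal.df_eq_iff (hc : IsConformal H D x χ) (hz : z ∈ D) (v : ℂ) :
    hor (x z) (χ z) (X *ᵥ x z, -(Xᵀ *ᵥ χ z)) = df x χ v z ↔
      frameField (frameM H x χ) X z 0 2 = tFun H x χ z * v ∧
      frameField (frameM H x χ) X z 1 2 = conj (tFun H x χ z * v) ∧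
      frameField (frameM H x χ) X z 2 0 = -(H * tFun H x χ z * conj v) ∧
      frameField (frameM H x χ) X z 2 1 = -(H * conj (tFun H x χ z) * v) := by
  have hNM := hc.coframe_mul_frameM hz
  have hMN : (frameM H x χ z)ᵀ * (coframe H x χ z)ᵀ = 1 := by
    rw [← Matrix.transpose_mul, hNM, Matrix.transpose_one]
  have h1 := Coords.hor_fst hNM coords_fst coords_snd
    (p := (X *ᵥ x z, -(Xᵀ *ᵥ χ z))) (hc.coords_mulVec hz)
  have h2 := Coords.hor_snd hNM coords_fst coords_snd
    (p := (X *ᵥ x z, -(Xᵀ *ᵥ χ z))) (hc.coords_transpose_mulVec hz)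
  have d1 := hc.coords_df_fst hz v
  have d2 := hc.coords_df_snd hz v
  constructor
  · intro h
    rw [h] at h1 h2
    obtain ⟨a, b, -⟩ := h1.unique hNM d1
    obtain ⟨c, d, -⟩ := h2.unique hMN d2
    exact ⟨a, b, by rw [← c, neg_neg], by rw [← d, neg_neg]⟩
  · rintro ⟨a, b, c, d⟩
    rw [a, b] at h1
    rw [c, d, neg_neg, neg_neg] at h2
    exact Prod.ext (h1.ext d1) (h2.ext d2)

end conformal

/-! ### Symmetric solutions of the structure equations -/

section scalar
variable {D : Set ℂ} {z : ℂ}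

lemma eq_of_wd_eq_zero (hD : IsOpen D) (hc : IsPreconnected D) {g : ℂ → ℂ}
    (hg : ContDiffOn ℝ ∞ g D) (h1 : ∀ z ∈ D, wd (-Complex.I) g z = 0)
    (h2 : ∀ z ∈ D, wd Complex.I g z = 0) {y z : ℂ} (hy : y ∈ D) (hz : z ∈ D) : g y = g z :=
  hD.is_const_of_fderiv_eq_zero hc (fun _ hw => (diffAt_of_smooth hD hg hw).differentiableWithinAt)
    (fun w hw => fderiv_eq_zero_of_wd (h1 w hw) (h2 w hw)) hy hz

lemma smooth_logFactor {t : ℂ → ℂ} (ht : ContDiffOn ℝ ∞ t D)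
    (h0 : ∀ z ∈ D, 0 < (t z ^ 2).re) : ContDiffOn ℝ ∞ (logFactor t) D :=
  smooth_ofReal ((Complex.reCLM.contDiff.comp_contDiffOn (ht.pow 2)).log fun z hz => (h0 z hz).ne')

/-- The logarithmic derivative of `Re t²`, multiplied out so that no division is needed where it is
applied. -/
lemma wd_logFactor (hD : IsOpen D) {t : ℂ → ℂ} (ht : ContDiffOn ℝ ∞ t D)
    (h0 : ∀ z ∈ D, 0 < (t z ^ 2).re) (hz : z ∈ D) (θ : ℂ) :
    (t z ^ 2 + conj (t z) ^ 2) * wd θ (logFactor t) z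
      = 2 * (t z * wd θ t z + conj (t z) * conj (wd (conj θ) t z)) := by
  have hs : ContDiffOn ℝ ∞ (fun y => (t y ^ 2).re) D :=
    Complex.reCLM.contDiff.comp_contDiffOn (ht.pow 2)
  have hd := diffAt_of_smooth hD hs hz
  have hdt := diffAt_of_smooth hD ht hz
  have e1 : wd θ (logFactor t) z = ((t z ^ 2).re : ℂ)⁻¹ * wd θ (fun y => ((t y ^ 2).re : ℂ)) z := by
    have hl : DifferentiableAt ℝ (fun y => Real.log (t y ^ 2).re) z := hd.log (h0 z hz).ne'
    unfold wd logFactor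
    rw [fderiv_ofReal_apply hl, fderiv_ofReal_apply hl, fderiv_ofReal_apply hd,
      fderiv_ofReal_apply hd, fderiv.log hd (h0 z hz).ne']
    simp
    ring
  have h2 : HasWd θ (fun y => (1 / 2 : ℂ) * (t y * t y + conj (t y) * conj (t y))) _ z :=
    (((hasWd hdt).mul (hasWd hdt)).add
      ((hasWd (θ := conj θ) hdt).conj.mul (hasWd (θ := conj θ) hdt).conj)).const_mul _
  have e2 : (fun y => ((t y ^ 2).re : ℂ))
      = fun y => (1 / 2 : ℂ) * (t y * t y + conj (t y) * conj (t y)) := by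
    ext y
    have := Complex.add_conj (t y ^ 2)
    rw [map_pow] at this
    push_cast at this
    linear_combination (-1 / 2 : ℂ) * this
  have e3 : t z ^ 2 + conj (t z) ^ 2 = 2 * ((t z ^ 2).re : ℂ) := by
    rw [← map_pow, Complex.add_conj]; push_cast; rfl
  have h3 : ((t z ^ 2).re : ℂ) ≠ 0 := by exact_mod_cast (h0 z hz).ne'
  rw [e1, e3, e2, h2.2]
  field_simp
  ring

end scalar

section symmetric
variable {H : ℝ} {D : Set ℂ} {p q A B t : ℂ → ℂ} {z : ℂ}

lemma StructureEqs.t_ne_zero (h : StructureEqs H D p q A B t) (hz : z ∈ D) : t z ≠ 0 := by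
  intro e
  have := h.re_pos z hz
  rw [e] at this
  simp at this

lemma StructureEqs.diff (h : StructureEqs H D p q A B t) (hz : z ∈ D) :
    DifferentiableAt ℝ p z ∧ DifferentiableAt ℝ q z ∧ DifferentiableAt ℝ A z ∧
      DifferentiableAt ℝ B z ∧ DifferentiableAt ℝ t z :=
  ⟨diffAt_of_smooth h.isOpen h.smooth_p hz, diffAt_of_smooth h.isOpen h.smooth_q hz,
    diffAt_of_smooth h.isOpen h.smooth_A hz, diffAt_of_smooth h.isOpen h.smooth_B hz,
    diffAt_of_smooth h.isOpen h.smooth_t hz⟩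

/-- For real `t` the formula for `t_z̄` must be the conjugate of that for `t_z`, and this comparison
determines `A`. In the Lagrangian case `A` and `p + q` thus vanish together. -/
lemma StructureEqs.A_eq_of_real (h : StructureEqs H D p q A B t) (ht : ∀ z ∈ D, conj (t z) = t z)
    (hz : z ∈ D) : A z = 3 / 2 * (conj (p z) + conj (q z)) := by
  have h1 := h.dt_real ht hz
  rw [h.tbar z hz, h.tz z hz] at h1
  simp only [map_sub, map_mul, map_add, Complex.conj_conj, map_ofNat, ht z hz] at h1
  apply mul_left_cancel₀ (h.t_ne_zero hz)
  linear_combination h1 / 2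

lemma StructureEqs.A_eq_of_real' (h : StructureEqs H D p q A B t)
    (ht : ∀ z ∈ D, conj (t z) = t z) (hz : z ∈ D) : A z = 3 / 2 * conj (p z + q z) := by
  rw [h.A_eq_of_real ht hz, map_add]

lemma StructureEqs.tz_of_real (h : StructureEqs H D p q A B t) (ht : ∀ z ∈ D, conj (t z) = t z)
    (hz : z ∈ D) : wd (-Complex.I) t z = t z * (p z - q z) / 2 := by
  rw [h.tz z hz, h.A_eq_of_real ht hz, ht z hz]
  simp only [map_mul, map_div₀, map_add, Complex.conj_conj, map_ofNat]
  ring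

lemma StructureEqs.tbar_of_real (h : StructureEqs H D p q A B t)
    (ht : ∀ z ∈ D, conj (t z) = t z) (hz : z ∈ D) :
    wd Complex.I t z = t z * (conj (p z) - conj (q z)) / 2 := by
  rw [h.tbar z hz, h.A_eq_of_real ht hz, ht z hz]
  ring

/-- For real `t` one has `u = 2 log t`, so this is the formula for `t_z`. It gives `p - q` the
meaning of the connection coefficient `u_z`. -/
lemma StructureEqs.logFactor_of_real (h : StructureEqs H D p q A B t)
    (ht : ∀ z ∈ D, conj (t z) = t z) (hz : z ∈ D) :
    wd (-Complex.I) (logFactor t) z = p z - q z := by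
  have h1 := wd_logFactor h.isOpen h.smooth_t h.re_sq_pos hz (-Complex.I)
  rw [map_neg, Complex.conj_I, neg_neg, h.dt_real ht hz, Complex.conj_conj,
    h.tz_of_real ht hz, ht z hz] at h1
  have h0 := h.t_ne_zero hz
  have h2 : t z ^ 2 + t z ^ 2 ≠ 0 := by
    rw [← two_mul]; exact mul_ne_zero two_ne_zero (pow_ne_zero _ h0)
  apply mul_left_cancel₀ h2
  rw [h1]; ring

/-- The equation for `A_z̄`, rewritten with `A` as a multiple of the conjugate of `p + q` and
conjugated, gives the `z`-derivative; holomorphy is one of the symmetric equations. -/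
lemma SymmetricEqs.wd_sum (h : StructureEqs H D p q A B t) (hs : SymmetricEqs D p q A B t)
    (hz : z ∈ D) : HasWd Complex.I (fun y => p y + q y) 0 z ∧
      HasWd (-Complex.I) (fun y => p y + q y) ((p z - q z) * (p z + q z)) z := by
  obtain ⟨dp, dq, dA, dB, dt⟩ := h.diff hz
  have h1 : HasWd Complex.I (fun y => p y + q y) 0 z :=
    ⟨dp.add dq, by rw [wd_add dp dq, hs.psi_bar z hz]⟩
  refine ⟨h1, dp.add dq, ?_⟩
  have h2 : HasWd Complex.I (fun y => (3 / 2 : ℂ) * conj (p y + q y)) _ z :=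
    (HasWd.conj (by rw [Complex.conj_I]; exact hasWd (dp.add dq))).const_mul _
  have h3 := hs.A_bar z hz
  rw [wd_congr_on h.isOpen (fun y hy => h.A_eq_of_real' hs.real_t hy) hz, h2.2, h.A_eq_of_real hs.real_t hz] at h3
  have h4 : conj (wd (-Complex.I) (fun y => p y + q y) z)
      = (conj (p z) - conj (q z)) * (conj (p z) + conj (q z)) := by
    linear_combination (2 / 3 : ℂ) * h3
  have h5 := congrArg conj h4
  simpa using h5

/-- The norm of `ψ` with respect to the induced metric is constant. -/
lemma SymmetricEqs.exists_const (h : StructureEqs H D p q A B t) (hs : SymmetricEqs D p q A B t)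
    (hD : IsPreconnected D) : ∃ k : ℂ, ∀ z ∈ D,
      (p z + q z) * conj (p z + q z) = k * t z ^ 2 := by
  rcases D.eq_empty_or_nonempty with rfl | ⟨z₀, hz₀⟩
  · exact ⟨0, fun z hz => hz.elim⟩
  -- Logarithmically, `p + q` contributes `p - q` under `∂_z`, its conjugate contributes nothing,
  -- and `t⁻²` contributes `-(p - q)`. As the quotient is real, both Wirtinger derivatives vanish.
  set g : ℂ → ℂ := fun y => (p y + q y) * conj (p y + q y) * ((t y)⁻¹ * (t y)⁻¹) with hg
  have ss := h.smooth_p.add h.smooth_q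
  have st : ContDiffOn ℝ ∞ (fun y => (t y)⁻¹) D := h.smooth_t.inv fun z hz => h.t_ne_zero hz
  have sg : ContDiffOn ℝ ∞ g D := (ss.mul (smooth_conj ss)).mul (st.mul st)
  have key : ∀ y ∈ D, wd (-Complex.I) g y = 0 := by
    intro y hy
    obtain ⟨h1, h2⟩ := hs.wd_sum h hy
    have h0 := h.t_ne_zero hy
    have hi := hasWd (θ := -Complex.I) (diffAt_of_smooth h.isOpen st hy)
    have hi1 : wd (-Complex.I) (fun y => (t y)⁻¹ * t y) y = 0 := by
      rw [wd_congr_on h.isOpen (k := fun _ => 1)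
        (fun w hw => inv_mul_cancel₀ (h.t_ne_zero hw)) hy, wd_const]
    rw [wd_mul hi.1 (h.diff hy).2.2.2.2, h.tz_of_real hs.real_t hy] at hi1
    have hi2 : wd (-Complex.I) (fun y => (t y)⁻¹) y = -(p y - q y) / 2 * (t y)⁻¹ := by
      apply mul_right_cancel₀ h0
      field_simp at hi1 ⊢
      linear_combination hi1
    have hc : HasWd (-Complex.I) (fun y => conj (p y + q y)) (conj 0) y :=
      HasWd.conj (by simpa using h1)
    have := ((h2.mul hc).mul (hi.mul hi)).2
    rw [hg, this]
    simp only [map_zero, mul_zero, add_zero]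
    linear_combination (2 * (p y + q y) * conj (p y + q y) * (t y)⁻¹) * hi2
  have key2 : ∀ y ∈ D, wd Complex.I g y = 0 := by
    intro y hy
    have hr : ∀ w ∈ D, conj (g w) = g w := fun w hw => by
      simp only [hg, map_mul, map_inv₀, hs.real_t w hw, Complex.conj_conj]
      ring
    rw [← wd_congr_on h.isOpen hr hy, wd_conj (diffAt_of_smooth h.isOpen sg hy), Complex.conj_I,
      key y hy, map_zero]
  refine ⟨g z₀, fun z hz => ?_⟩
  rw [eq_of_wd_eq_zero h.isOpen hD sg key key2 hz₀ hz]
  have h0 := h.t_ne_zero hz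
  simp only [hg]
  field_simp

/-- The constant in `|p + q|² = k t²` is either zero, and then `A` vanishes with `p + q`, or it
forbids any zero because `t` has none. -/
lemma SymmetricEqs.dichotomy (h : StructureEqs H D p q A B t) (hs : SymmetricEqs D p q A B t)
    (hD : IsPreconnected D) :
    (∀ z ∈ D, A z = 0) ∨ ∀ z ∈ D, p z + q z ≠ 0 := by
  obtain ⟨k, hk⟩ := hs.exists_const h hD
  by_cases k0 : k = 0
  · left
    intro z hz
    have h1 := hk z hz
    rw [k0, zero_mul, mul_eq_zero] at h1
    have h2 : p z + q z = 0 := h1.elim id fun h1 => (map_eq_zero _).mp h1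
    rw [h.A_eq_of_real hs.real_t hz, ← map_add, h2]
    simp
  · right
    intro z hz h1
    have h2 := hk z hz
    rw [h1, zero_mul] at h2
    exact mul_ne_zero k0 (pow_ne_zero 2 (h.t_ne_zero hz)) h2.symm

section nonvanishing
-- Apply `∂_z̄` to `(p + q)_z = (p - q)(p + q)`: the left side vanishes because `p + q` is
-- holomorphic, and the factor `p + q` can be cancelled.
lemma SymmetricEqs.wd_sub (h : StructureEqs H D p q A B t) (hs : SymmetricEqs D p q A B t)
    (h0 : ∀ z ∈ D, p z + q z ≠ 0) (hz : z ∈ D) : wd Complex.I p z - wd Complex.I q z = 0 := by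
  have ss := h.smooth_p.add h.smooth_q
  have h1 : wd Complex.I (wd (-Complex.I) (fun y => p y + q y)) z = 0 := by
    rw [wd_comm h.isOpen ss hz, wd_congr_on h.isOpen (k := fun _ => 0)
      (fun y hy => (hs.wd_sum h hy).1.2) hz, wd_const]
  obtain ⟨dp, dq, -⟩ := h.diff hz
  have h2 : HasWd Complex.I (fun y => (p y - q y) * (p y + q y)) _ z :=
    ((hasWd dp).sub (hasWd dq)).mul (hs.wd_sum h hz).1
  rw [wd_congr_on h.isOpen (fun y hy => (hs.wd_sum h hy).2.2) hz, h2.2, mul_zero, add_zero] at h1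
  exact (mul_eq_zero.mp h1).resolve_right (h0 z hz)

lemma SymmetricEqs.flat (h : StructureEqs H D p q A B t) (hs : SymmetricEqs D p q A B t)
    (h0 : ∀ z ∈ D, p z + q z ≠ 0) (hz : z ∈ D) :
    wd Complex.I (wd (-Complex.I) (logFactor t)) z = 0 := by
  obtain ⟨dp, dq, -⟩ := h.diff hz
  rw [wd_congr_on h.isOpen (fun y hy => h.logFactor_of_real hs.real_t hy) hz,
    RuhVilms.wd_sub dp dq, hs.wd_sub h h0 hz]

/-- Sum and difference of `p` and `q` are holomorphic, hence so is each, and the derivatives drop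
out of the Gauss equation. -/
lemma SymmetricEqs.gauss (h : StructureEqs H D p q A B t) (hs : SymmetricEqs D p q A B t)
    (h0 : ∀ z ∈ D, p z + q z ≠ 0) (hz : z ∈ D) :
    A z * conj (A z) - B z * conj (B z) = H * t z ^ 2 := by
  have h1 := hs.wd_sub h h0 hz
  have h2 := hs.psi_bar z hz
  have h3 : wd Complex.I p z = 0 := by linear_combination h1 / 2 + h2 / 2
  have h4 : wd Complex.I q z = 0 := by linear_combination h2 / 2 - h1 / 2
  have h5 := h.gauss z hz
  rw [h3, h4, map_zero] at h5
  linear_combination h5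

/-- By the Gauss equation `|B|²` is a constant multiple of `t²`. Differentiating and inserting the
known `B_z̄` leaves `B_z` multiplied by the conjugate of `B`. If `B` has a zero, the constant is
zero and `B` vanishes identically. -/
lemma SymmetricEqs.B_z (h : StructureEqs H D p q A B t) (hs : SymmetricEqs D p q A B t)
    (h0 : ∀ z ∈ D, p z + q z ≠ 0) (hD : IsPreconnected D) (hz : z ∈ D) :
    wd (-Complex.I) B z = 2 * (p z - q z) * B z := by
  obtain ⟨k, hk⟩ := hs.exists_const h hD
  have hB : ∀ y ∈ D, B y * conj (B y) = (9 / 4 * k - H) * t y ^ 2 := fun y hy => by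
    have h1 := hs.gauss h h0 hy
    rw [h.A_eq_of_real hs.real_t hy] at h1
    have h2 := hk y hy
    simp only [map_mul, map_add, map_div₀, map_ofNat, Complex.conj_conj] at h1 h2
    linear_combination -h1 + 9 / 4 * h2
  obtain ⟨-, -, -, dB, dt⟩ := h.diff hz
  by_cases hb : B z = 0
  · have h1 := hB z hz
    rw [hb, zero_mul] at h1
    have h2 := (mul_eq_zero.mp h1.symm).resolve_right (pow_ne_zero 2 (h.t_ne_zero hz))
    have h3 : ∀ y ∈ D, B y = 0 := fun y hy => by
      have h4 := hB y hy
      rw [h2, zero_mul, mul_eq_zero] at h4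
      exact h4.elim id fun h4 => (map_eq_zero _).mp h4
    rw [hb, mul_zero, wd_congr_on h.isOpen h3 hz, wd_const]
  · have h1 : HasWd (-Complex.I) (fun y => B y * conj (B y)) _ z :=
      (hasWd dB).mul (HasWd.conj (by simpa using hasWd dB))
    have h2 : HasWd (-Complex.I) (fun y => (9 / 4 * k - H) * (t y * t y)) _ z :=
      ((hasWd dt).mul (hasWd dt)).const_mul _
    have h3 := wd_congr_on (θ := -Complex.I) h.isOpen
      (fun y hy => (hB y hy).trans (by rw [sq])) hz
    rw [h1.2, h2.2, h.tz_of_real hs.real_t hz, hs.B_bar z hz] at h3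
    have hb' : conj (B z) ≠ 0 := (map_ne_zero _).mpr hb
    apply mul_right_cancel₀ hb'
    simp only [map_mul, map_neg, map_sub, Complex.conj_conj] at h3
    linear_combination h3 - (p z - q z) * hB z hz

/-- The infinitesimal isometries that preserve a symmetric solution, in the moving frame. -/
def symField (H : ℝ) (A B t v w : ℂ) : M3 :=
  !![(w + conj w) / 2, A * v + conj (B * v), t * v;
    conj (A * v) + B * v, (w + conj w) / 2, t * conj v;
    -H * (t * conj v), -H * (t * v), -(w + conj w)]

lemma symField_bracket {p q A B t v w : ℂ} (ht : conj t = t) (hw : w = v * (p + q))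
    (hA : A = 3 / 2 * (conj p + conj q)) (hA' : conj A = 3 / 2 * (p + q))
    (hg : A * conj A - B * conj B = H * t ^ 2) :
    symField H A B t v w * mcZbar H p q A B t - mcZbar H p q A B t * symField H A B t v w =
      !![0, (conj p - conj q) * (A * v + conj (B * v)), t * (conj p - conj q) / 2 * v;
        -(conj p - conj q) * (conj (A * v) + B * v), 0,
          -(t * (conj p - conj q) / 2 * conj v);
        H * (t * (conj p - conj q) / 2 * conj v), -H * (t * (conj p - conj q) / 2 * v), 0] := by
  subst hw
  ext i j
  rw [Matrix.sub_apply, Matrix.mul_apply, Matrix.mul_apply, Fin.sum_univ_three,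
    Fin.sum_univ_three]
  fin_cases i <;> fin_cases j <;> simp [symField, mcZbar, ht]
  · linear_combination v * hg
  · ring
  · linear_combination t * v * hA
  · ring
  · linear_combination -v * hg
  · linear_combination -t * v * hA'
  · linear_combination -H * t * v * hA'
  · linear_combination H * t * v * hA
  · ring

/-- With `w` constant, `v = w / (p + q)` is holomorphic and `v_z = -(p - q) v`. Together with the
derivatives of `A`, `B` and `t` this yields the `z̄`-half of the Lax equation; the other half will
come from reality. -/
lemma SymmetricEqs.mwd_symField (h : StructureEqs H D p q A B t) (hs : SymmetricEqs D p q A B t)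
    (h0 : ∀ z ∈ D, p z + q z ≠ 0) (hD : IsPreconnected D) (hz : z ∈ D) (w : ℂ) :
    MSmooth D (fun y => symField H (A y) (B y) (t y) (w / (p y + q y)) w) ∧
    mwd Complex.I (fun y => symField H (A y) (B y) (t y) (w / (p y + q y)) w) z =
      symField H (A z) (B z) (t z) (w / (p z + q z)) w
        * mcZbar H (p z) (q z) (A z) (B z) (t z)
      - mcZbar H (p z) (q z) (A z) (B z) (t z)
        * symField H (A z) (B z) (t z) (w / (p z + q z)) w := by
  have sv : ContDiffOn ℝ ∞ (fun y => w / (p y + q y)) D :=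
    (contDiffOn_const.mul ((h.smooth_p.add h.smooth_q).inv h0)).congr
      fun y _ => div_eq_mul_inv w _
  set v : ℂ → ℂ := fun y => w / (p y + q y) with hv
  have hvw : ∀ y ∈ D, v y * (p y + q y) = w := fun y hy => div_mul_cancel₀ _ (h0 y hy)
  have dv := diffAt_of_smooth h.isOpen sv hz
  obtain ⟨dp, dq, dA, dB, dt⟩ := h.diff hz
  obtain ⟨ds1, ds2⟩ := hs.wd_sum h hz
  have v1 : HasWd Complex.I v 0 z := by
    refine ⟨dv, ?_⟩
    have h1 := ((hasWd (θ := Complex.I) dv).mul ds1).2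
    rw [wd_congr_on h.isOpen hvw hz, wd_const, mul_zero, add_zero] at h1
    exact (mul_eq_zero.mp h1.symm).resolve_right (h0 z hz)
  have v2 : HasWd (-Complex.I) v (-v z * (p z - q z)) z := by
    refine ⟨dv, ?_⟩
    have h1 := ((hasWd (θ := -Complex.I) dv).mul ds2).2
    rw [wd_congr_on h.isOpen hvw hz, wd_const] at h1
    apply mul_right_cancel₀ (h0 z hz)
    linear_combination -h1
  have v3 : HasWd Complex.I (fun y => conj (v y)) (conj (-v z * (p z - q z))) z :=
    HasWd.conj (by simpa using v2)
  have A1 : HasWd Complex.I A ((conj (p z) - conj (q z)) * A z) z := ⟨dA, hs.A_bar z hz⟩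
  have A2 : HasWd (-Complex.I) A 0 z := by
    refine ⟨dA, ?_⟩
    have h2 : HasWd (-Complex.I) (fun y => (3 / 2 : ℂ) * conj (p y + q y)) _ z :=
      (HasWd.conj (by simpa using ds1)).const_mul _
    rw [wd_congr_on h.isOpen (fun y hy => h.A_eq_of_real' hs.real_t hy) hz, h2.2]
    simp
  have B1 : HasWd Complex.I B (-(conj (p z) - conj (q z)) * B z) z := ⟨dB, hs.B_bar z hz⟩
  have B2 : HasWd (-Complex.I) B (2 * (p z - q z) * B z) z := ⟨dB, hs.B_z h h0 hD hz⟩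
  have t1 : HasWd Complex.I t (t z * (conj (p z) - conj (q z)) / 2) z :=
    ⟨dt, h.tbar_of_real hs.real_t hz⟩
  have Av := A1.mul v1
  have Bv := B1.mul v1
  have Avc : HasWd Complex.I (fun y => conj (A y * v y)) _ z :=
    HasWd.conj (by simpa using A2.mul v2)
  have Bvc : HasWd Complex.I (fun y => conj (B y * v y)) _ z :=
    HasWd.conj (by simpa using B2.mul v2)
  have E := Av.add Bvc
  have F := Avc.add Bv
  have tv := t1.mul v1
  have tvc := t1.mul v3
  have tv' := tv.const_mul (-H : ℂ)
  have tvc' := tvc.const_mul (-H : ℂ)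
  have ht := hs.real_t z hz
  have hA := h.A_eq_of_real hs.real_t hz
  have hg := hs.gauss h h0 hz
  have hw : w = v z * (p z + q z) := (hvw z hz).symm
  constructor
  · have sA := h.smooth_A.mul sv
    have sB := h.smooth_B.mul sv
    have st := h.smooth_t
    intro i j
    fin_cases i <;> fin_cases j
    · exact contDiffOn_const
    · exact sA.add (smooth_conj sB)
    · exact st.mul sv
    · exact (smooth_conj sA).add sB
    · exact contDiffOn_const
    · exact st.mul (smooth_conj sv)
    · exact contDiffOn_const.mul (st.mul (smooth_conj sv))
    · exact contDiffOn_const.mul (st.mul sv)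
    · exact contDiffOn_const
  · have e : mwd Complex.I (fun y => symField H (A y) (B y) (t y) (v y) w) z =
        !![0, wd Complex.I (fun y => A y * v y + conj (B y * v y)) z,
            wd Complex.I (fun y => t y * v y) z;
          wd Complex.I (fun y => conj (A y * v y) + B y * v y) z, 0,
            wd Complex.I (fun y => t y * conj (v y)) z;
          wd Complex.I (fun y => -(H : ℂ) * (t y * conj (v y))) z,
            wd Complex.I (fun y => -(H : ℂ) * (t y * v y)) z, 0] := by
      ext i j
      fin_cases i <;> fin_cases j <;> first | rfl | exact wd_const _
    have hA' : conj (A z) = 3 / 2 * (p z + q z) := by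
      rw [hA]; simp only [map_mul, map_div₀, map_add, Complex.conj_conj, map_ofNat]
    rw [e, E.2, F.2, tv.2, tvc.2, tv'.2, tvc'.2, symField_bracket ht hw hA hA' hg]
    simp only [map_mul, map_neg, map_sub, map_add, map_ofNat]
    ext i j
    fin_cases i <;> fin_cases j <;> simp <;> ring

end nonvanishing
end symmetric

/-! ### The abelian algebra of infinitesimal isometries. -/

section exists_field
variable {H : ℝ} {D : Set ℂ} {M : ℂ → M3} {t : ℂ → ℂ} {z : ℂ}

/-- The Lax equation makes `M β M⁻¹` annihilated by `∂_z̄`, the symmetry under `J` makes it real. A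
real matrix function with vanishing `z̄`-derivative is constant on a connected domain. -/
lemma AdaptedFrame.exists_frameField (h : AdaptedFrame H D M t) (hD : IsPreconnected D)
    {β : ℂ → M3} (hβ : MSmooth D β)
    (hd : ∀ z ∈ D, mwd Complex.I β z =
      β z * ((M z)⁻¹ * mwd Complex.I M z) - (M z)⁻¹ * mwd Complex.I M z * β z)
    (hc : ∀ z ∈ D, (β z).map conj = J * β z * J) :
    ∃ X : Matrix (Fin 3) (Fin 3) ℝ, ∀ z ∈ D, frameField M X z = β z := by
  rcases D.eq_empty_or_nonempty with rfl | ⟨z₀, hz₀⟩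
  · exact ⟨0, fun z hz => hz.elim⟩
  have hi := h.smooth.inv h.det_ne_zero
  set Y : ℂ → M3 := fun z => M z * β z * (M z)⁻¹ with hY
  have sY : MSmooth D Y := (h.smooth.mul hβ).mul hi
  have dY : ∀ z ∈ D, mwd Complex.I Y z = 0 := fun z hz => by
    have e := h.mul_inv hz
    rw [hY, mwd_mul h.isOpen (h.smooth.mul hβ) hi hz, mwd_mul h.isOpen h.smooth hβ hz,
      mwd_inv h.isOpen h.smooth h.det_ne_zero hz, hd z hz]
    have e1 : M z * (β z * ((M z)⁻¹ * mwd Complex.I M z) - (M z)⁻¹ * mwd Complex.I M z * β z)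
        = M z * β z * (M z)⁻¹ * mwd Complex.I M z - mwd Complex.I M z * β z := by
      rw [mul_sub]
      congr 1
      · simp only [mul_assoc]
      · rw [← mul_assoc, ← mul_assoc, e, one_mul]
    rw [e1]
    noncomm_ring
  have cY : ∀ z ∈ D, (Y z).map conj = Y z := fun z hz => by
    rw [hY, map_conj_mul, map_conj_mul, hc z hz, h.map_conj hz, h.inv_map_conj hz]
    calc _ = M z * (J * J) * β z * (J * J) * (M z)⁻¹ := by simp only [mul_assoc]
      _ = _ := by rw [J_mul_J, mul_one, mul_one]
  have const : ∀ z ∈ D, Y z₀ = Y z := fun z hz => by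
    ext i j
    have h2 : ∀ y ∈ D, wd Complex.I (fun w => Y w i j) y = 0 := fun y hy =>
      congrFun (congrFun (dY y hy) i) j
    refine eq_of_wd_eq_zero h.isOpen hD (sY i j) (fun y hy => ?_) h2 hz₀ hz
    have h3 : ∀ w ∈ D, conj (Y w i j) = Y w i j := fun w hw => congrFun (congrFun (cY w hw) i) j
    rw [← wd_congr_on h.isOpen h3 hy, wd_conj (sY.diffAt h.isOpen hy i j), map_neg,
      Complex.conj_I, neg_neg, h2 y hy, map_zero]
  refine ⟨(Y z₀).map Complex.re, fun z hz => ?_⟩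
  have e : ((Y z₀).map Complex.re).map Complex.ofReal = Y z := by
    rw [← const z hz]
    ext i j
    exact Complex.conj_eq_iff_re.mp (congrFun (congrFun (cY z₀ hz₀) i) j)
  rw [frameField, e, hY]
  have e1 := h.inv_mul hz
  calc _ = (M z)⁻¹ * M z * β z * ((M z)⁻¹ * M z) := by simp only [mul_assoc]
    _ = _ := by rw [e1, one_mul, mul_one]

end exists_field

section symField
variable {H : ℝ} {p q A B t v w v' w' : ℂ}

lemma symField_conj (ht : conj t = t) :
    (symField H A B t v w).map conj = J * symField H A B t v w * J := by
  have h2 : conj (2 : ℂ) = 2 := map_ofNat _ 2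
  ext i j
  rw [Matrix.mul_apply, Fin.sum_univ_three, Matrix.mul_apply, Matrix.mul_apply, Matrix.mul_apply,
    Fin.sum_univ_three, Fin.sum_univ_three, Fin.sum_univ_three]
  fin_cases i <;> fin_cases j <;> simp [symField, J, ht, h2] <;> ring

lemma symField_zero : symField H A B t 0 0 = 0 := by
  ext i j
  fin_cases i <;> fin_cases j <;> simp [symField]

lemma symField_add : symField H A B t (v + v') (w + w') =
    symField H A B t v w + symField H A B t v' w' := by
  ext i j
  fin_cases i <;> fin_cases j <;> simp [symField] <;> ring

lemma symField_smul (r : ℝ) : symField H A B t (r * v) (r * w) =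
    (r : ℂ) • symField H A B t v w := by
  ext i j
  fin_cases i <;> fin_cases j <;> simp [symField] <;> ring

lemma trace_symField : (symField H A B t v w).trace = 0 := by
  rw [Matrix.trace_fin_three]
  simp [symField]

/-- The Gauss relation `|A|² - |B|² = H t²` and the expression of `A` by `p + q` are just what makes
these fields commute. -/
lemma symField_commute (hw : w = v * (p + q)) (hw' : w' = v' * (p + q))
    (hA : A = 3 / 2 * (conj p + conj q)) (hA' : conj A = 3 / 2 * (p + q))
    (hg : A * conj A - B * conj B = H * t ^ 2) :
    symField H A B t v w * symField H A B t v' w'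
      - symField H A B t v' w' * symField H A B t v w = 0 := by
  subst hw hw'
  ext i j
  rw [Matrix.sub_apply, Matrix.mul_apply, Matrix.mul_apply, Fin.sum_univ_three,
    Fin.sum_univ_three]
  fin_cases i <;> fin_cases j <;> simp [symField]
  · linear_combination (v * conj v' - v' * conj v) * hg
  · ring
  · linear_combination t * (v * conj v' - v' * conj v) * hA
  · ring
  · linear_combination -(v * conj v' - v' * conj v) * hg
  · linear_combination t * (v' * conj v - v * conj v') * hA'
  · linear_combination H * t * (v' * conj v - v * conj v') * hA'
  · linear_combination H * t * (v * conj v' - v' * conj v) * hA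
  · ring

end symField

section conformal
variable {H : ℝ} {D : Set ℂ} {x χ : ℂ → V3} {z : ℂ}

lemma IsConformal.homogeneous_of_symmetric (hD : IsOpen D) (hDc : IsPreconnected D)
    (hne : D.Nonempty) (hc : IsConformal H D x χ)
    (hdet : ∀ z ∈ D, (frameM H x χ z).det = R.det)
    (hs : SymmetricEqs D (coeff (frameM H x χ) 0 0) (coeff (frameM H x χ) 1 1)
      (coeff (frameM H x χ) 0 1) (coeff (frameM H x χ) 1 0) (tFun H x χ))
    (h0 : ∀ z ∈ D, coeff (frameM H x χ) 0 0 z + coeff (frameM H x χ) 1 1 z ≠ 0) :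
    ∃ 𝔞 : Submodule ℝ (Matrix (Fin 3) (Fin 3) ℝ), (∀ X ∈ 𝔞, X.trace = 0) ∧
      (∀ X ∈ 𝔞, ∀ Y ∈ 𝔞, X * Y - Y * X ∈ 𝔞) ∧
      ∀ z ∈ D, Set.range (fun v : ℂ => df x χ v z) =
        (fun X : Matrix (Fin 3) (Fin 3) ℝ => hor (x z) (χ z) (X *ᵥ x z, -(Xᵀ *ᵥ χ z))) ''
          {X | X ∈ 𝔞} := by
  have hA := hc.adaptedFrame hD hdet
  have hS := hA.structureEqs
  set M := frameM H x χ with hM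
  set t := tFun H x χ with ht
  set p := coeff M 0 0
  set q := coeff M 1 1
  set A := coeff M 0 1
  set B := coeff M 1 0
  let S : ℂ → ℂ → M3 := fun w z => symField H (A z) (B z) (t z) (w / (p z + q z)) w
  have hex : ∀ w, ∃ X : Matrix (Fin 3) (Fin 3) ℝ, ∀ z ∈ D, frameField M X z = S w z := fun w =>
    hA.exists_frameField hDc (β := S w) (by
      obtain ⟨z₀, hz₀⟩ := hne
      exact (hs.mwd_symField hS h0 hDc hz₀ w).1)
      (fun z hz => by rw [hA.mc_zbar hz]; exact (hs.mwd_symField hS h0 hDc hz w).2)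
      fun z hz => symField_conj (hs.real_t z hz)
  -- The algebra consists of the matrices whose field in the frame is given by one constant `w`; the
  -- direction at `z` is `w / (p + q)`, so every tangent direction occurs.
  let 𝔞 : Submodule ℝ (Matrix (Fin 3) (Fin 3) ℝ) :=
    { carrier := {X | ∃ w, ∀ z ∈ D, frameField M X z = S w z}
      add_mem' := by
        rintro X Y ⟨w, hw⟩ ⟨w', hw'⟩
        refine ⟨w + w', fun z hz => ?_⟩
        rw [frameField_add, hw z hz, hw' z hz]
        simp only [S]
        rw [← symField_add, add_div]
      zero_mem' := ⟨0, fun z hz => by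
        simp only [S, zero_div]
        rw [symField_zero]
        have : (0 : Matrix (Fin 3) (Fin 3) ℝ).map Complex.ofReal = 0 := by ext; simp
        rw [frameField, this, mul_zero, zero_mul]⟩
      smul_mem' := by
        rintro r X ⟨w, hw⟩
        refine ⟨r * w, fun z hz => ?_⟩
        rw [frameField_smul, hw z hz]
        simp only [S]
        rw [← symField_smul, mul_div_assoc] }
  refine ⟨𝔞, ?_, ?_, ?_⟩
  · rintro X ⟨w, hw⟩
    obtain ⟨z₀, hz₀⟩ := hne
    have h1 := hA.trace_frameField (X := X) hz₀
    rw [hw z₀ hz₀, trace_symField] at h1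
    exact_mod_cast h1.symm
  · rintro X ⟨w, hw⟩ Y ⟨w', hw'⟩
    refine ⟨0, fun z hz => ?_⟩
    rw [hA.frameField_bracket hz, hw z hz, hw' z hz]
    have e := hS.A_eq_of_real hs.real_t hz
    have e' : conj (A z) = 3 / 2 * (p z + q z) := by
      rw [e]; simp only [map_mul, map_div₀, map_add, Complex.conj_conj, map_ofNat]
    simp only [S, zero_div]
    rw [symField_zero]
    exact symField_commute (div_mul_cancel₀ _ (h0 z hz)).symm (div_mul_cancel₀ _ (h0 z hz)).symm
      e e' (hs.gauss hS h0 hz)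
  · intro z hz
    have hr := hs.real_t z hz
    have key : ∀ (X : Matrix (Fin 3) (Fin 3) ℝ) (w : ℂ), frameField M X z = S w z →
        hor (x z) (χ z) (X *ᵥ x z, -(Xᵀ *ᵥ χ z)) = df x χ (w / (p z + q z)) z := by
      intro X w hX
      rw [hc.df_eq_iff hz, ← hM, hX, ← ht]
      simp only [S, symField]
      simp [hr, mul_assoc]
    ext d
    constructor
    · rintro ⟨v, rfl⟩
      obtain ⟨X, hX⟩ := hex (v * (p z + q z))
      refine ⟨X, ⟨_, hX⟩, ?_⟩
      change hor (x z) (χ z) (X *ᵥ x z, -(Xᵀ *ᵥ χ z)) = _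
      rw [key X _ (hX z hz), mul_div_cancel_right₀ _ (h0 z hz)]
    · rintro ⟨X, ⟨w, hw⟩, rfl⟩
      exact ⟨_, (key X w (hw z hz)).symm⟩

end conformal

/-! ### Flat homogeneous immersions -/

/-- The direction in which the fundamental vector field of `X` is the differential of `f`. -/
def direction (M : ℂ → M3) (t : ℂ → ℂ) (X : Matrix (Fin 3) (Fin 3) ℝ) (z : ℂ) : ℂ :=
  frameField M X z 0 2 / t z

/-- The fundamental vector field of `X` is tangential to `f`. -/
structure Tangential (H : ℝ) (D : Set ℂ) (M : ℂ → M3) (t : ℂ → ℂ)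
    (X : Matrix (Fin 3) (Fin 3) ℝ) : Prop where
  trace_eq_zero : X.trace = 0
  entry20 : ∀ z ∈ D, frameField M X z 2 0 = -(H * t z * conj (direction M t X z))
  entry21 : ∀ z ∈ D, frameField M X z 2 1 = -(H * conj (t z) * direction M t X z)

/-- The covariant derivative of the direction field. -/
def rotation (M : ℂ → M3) (t : ℂ → ℂ) (X : Matrix (Fin 3) (Fin 3) ℝ) (z : ℂ) : ℂ :=
  wd (-Complex.I) (direction M t X) z + wd (-Complex.I) (logFactor t) z * direction M t X z

section tangential
variable {H : ℝ} {D : Set ℂ} {M : ℂ → M3} {t : ℂ → ℂ} {z : ℂ} {X Y : Matrix (Fin 3) (Fin 3) ℝ}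

lemma AdaptedFrame.t_ne_zero (h : AdaptedFrame H D M t) (hz : z ∈ D) : t z ≠ 0 :=
  h.structureEqs.t_ne_zero hz

lemma AdaptedFrame.smooth_direction (h : AdaptedFrame H D M t) :
    ContDiffOn ℝ ∞ (direction M t X) D :=
  ((h.smooth_frameField 0 2).mul (h.smooth_t.inv fun _ hz => h.t_ne_zero hz)).congr
    fun _ _ => div_eq_mul_inv _ _

lemma AdaptedFrame.entry02_eq (h : AdaptedFrame H D M t) (hz : z ∈ D) :
    frameField M X z 0 2 = t z * direction M t X z := by
  rw [direction, mul_div_cancel₀ _ (h.t_ne_zero hz)]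

lemma AdaptedFrame.entry12_eq (h : AdaptedFrame H D M t) (hz : z ∈ D) :
    frameField M X z 1 2 = conj (t z) * conj (direction M t X z) := by
  rw [← (h.conj_frameField hz).2.2.1, h.entry02_eq hz, map_mul]

lemma Tangential.entry22_eq (hX : Tangential H D M t X) (h : AdaptedFrame H D M t) (hz : z ∈ D) :
    frameField M X z 2 2 = -(frameField M X z 0 0 + conj (frameField M X z 0 0)) := by
  have h1 := h.trace_frameField (X := X) hz
  rw [hX.trace_eq_zero, Matrix.trace_fin_three] at h1
  rw [(h.conj_frameField hz).1]
  push_cast at h1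
  linear_combination h1

lemma AdaptedFrame.wd_frameField (h : AdaptedFrame H D M t) (hz : z ∈ D) (i j : Fin 3) :
    wd (-Complex.I) (fun y => frameField M X y i j) z =
      (frameField M X z * mcZ H (coeff M 0 0 z) (coeff M 1 1 z) (coeff M 0 1 z) (coeff M 1 0 z) (t z)
      - mcZ H (coeff M 0 0 z) (coeff M 1 1 z) (coeff M 0 1 z) (coeff M 1 0 z) (t z)
        * frameField M X z) i j := by
  rw [← h.mc_z hz, ← h.mwd_frameField hz]; rfl

lemma AdaptedFrame.hasWd_direction (h : AdaptedFrame H D M t) (hz : z ∈ D) (θ : ℂ) :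
    HasWd θ (direction M t X) (wd θ (direction M t X) z) z :=
  hasWd (diffAt_of_smooth h.isOpen h.smooth_direction hz)

lemma AdaptedFrame.hasWd_conj_direction (h : AdaptedFrame H D M t) (hz : z ∈ D) :
    HasWd (-Complex.I) (fun y => conj (direction M t X y))
      (conj (wd Complex.I (direction M t X) z)) z :=
  HasWd.conj (by simpa using h.hasWd_direction hz Complex.I)

lemma AdaptedFrame.hasWd_t (h : AdaptedFrame H D M t) (hz : z ∈ D) (θ : ℂ) :
    HasWd θ t (wd θ t z) z :=
  hasWd (diffAt_of_smooth h.isOpen h.smooth_t hz)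

lemma AdaptedFrame.hasWd_conj_t (h : AdaptedFrame H D M t) (hz : z ∈ D) :
    HasWd (-Complex.I) (fun y => conj (t y)) (conj (wd Complex.I t z)) z :=
  HasWd.conj (by simpa using h.hasWd_t hz Complex.I)

lemma AdaptedFrame.sq_add_ne_zero (h : AdaptedFrame H D M t) (hz : z ∈ D) :
    t z ^ 2 + conj (t z) ^ 2 ≠ 0 := by
  rw [← map_pow, Complex.add_conj]
  exact_mod_cast (mul_pos two_pos (h.re_sq_pos z hz)).ne'

lemma AdaptedFrame.H_ne_zero (h : AdaptedFrame H D M t) : (H : ℂ) ≠ 0 :=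
  left_ne_zero_of_mul_eq_one h.sq_eq_one

/-- The direction field is holomorphic. -/
lemma Tangential.holomorphic (hX : Tangential H D M t X) (h : AdaptedFrame H D M t) (hz : z ∈ D) :
    wd Complex.I (direction M t X) z = 0 ∧ frameField M X z 1 0 =
      coeff M 1 0 z * direction M t X z + conj (coeff M 0 1 z * direction M t X z) := by
  have hS := h.structureEqs
  have e12 := h.wd_frameField (X := X) hz 1 2
  have e20 := h.wd_frameField (X := X) hz 2 0
  rw [wd_congr_on h.isOpen (fun y hy => h.entry12_eq hy) hz,
    ((h.hasWd_conj_t hz).mul (h.hasWd_conj_direction hz)).2, hS.tbar z hz,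
    Matrix.sub_apply, Matrix.mul_apply, Matrix.mul_apply, Fin.sum_univ_three,
    Fin.sum_univ_three] at e12
  rw [wd_congr_on (k := fun y => -(H * (t y * conj (direction M t X y)))) h.isOpen
      (fun y hy => (hX.entry20 y hy).trans (by ring)) hz,
    (((h.hasWd_t hz _).mul (h.hasWd_conj_direction hz)).const_mul (H : ℂ)).neg.2, hS.tz z hz,
    Matrix.sub_apply, Matrix.mul_apply, Matrix.mul_apply, Fin.sum_univ_three,
    Fin.sum_univ_three] at e20
  have c2 : conj (2 : ℂ) = 2 := map_ofNat _ 2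
  simp [mcZ, h.entry02_eq hz, h.entry12_eq hz, hX.entry20 z hz, hX.entry21 z hz, c2] at e12 e20
  set v := direction M t X z
  set d := conj (wd Complex.I (direction M t X) z)
  set Γ := frameField M X z 1 0 - coeff M 1 0 z * v - conj (coeff M 0 1 z * v) with hΓ
  -- The entries `(1,2)` and `(2,0)` are two linear equations in the conjugate of `v_z̄` and the
  -- discrepancy `Γ` of the entry `(1,0)`. Their determinant is, up to sign, `t² + t̄²`, twice the
  -- conformal factor.
  have h1 : conj (t z) * d = t z * Γ := by
    rw [hΓ, map_mul]; linear_combination e12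
  have h2 : t z * d = -conj (t z) * Γ := by
    apply mul_left_cancel₀ h.H_ne_zero
    rw [hΓ, map_mul]; linear_combination -e20
  have h3 : (t z ^ 2 + conj (t z) ^ 2) * d = 0 := by
    linear_combination t z * h2 + conj (t z) * h1
  have h4 := (mul_eq_zero.mp h3).resolve_left (h.sq_add_ne_zero hz)
  refine ⟨(map_eq_zero _).mp h4, ?_⟩
  rw [h4, mul_zero] at h1
  have h5 := (mul_eq_zero.mp h1.symm).resolve_left (h.t_ne_zero hz)
  rw [hΓ] at h5
  linear_combination h5

/-- The derivatives of the entries `(0,2)` and `(2,1)` combine to the invariance of `t² |dz|²` under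
the field, a complex form of the Killing equation, and to a formula for the diagonal entry. -/
lemma Tangential.diagonal (hX : Tangential H D M t X) (h : AdaptedFrame H D M t) (hz : z ∈ D) :
    2 * (wd (-Complex.I) t z * direction M t X z + wd Complex.I t z * conj (direction M t X z))
      = -t z * (wd (-Complex.I) (direction M t X) z
        + conj (wd (-Complex.I) (direction M t X) z)) ∧
    frameField M X z 0 0 = coeff M 0 0 z * direction M t X z
      + conj (coeff M 1 1 z) * conj (direction M t X z)
      + (wd (-Complex.I) (direction M t X) z - conj (wd (-Complex.I) (direction M t X) z)) / 2 := by
  have hS := h.structureEqs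
  have e02 := h.wd_frameField (X := X) hz 0 2
  have e21 := h.wd_frameField (X := X) hz 2 1
  have hb := hS.tbar z hz
  have hzt := hS.tz z hz
  have c11 := (h.conj_frameField (X := X) hz).1
  rw [wd_congr_on h.isOpen (fun y hy => h.entry02_eq hy) hz,
    ((h.hasWd_t hz _).mul (h.hasWd_direction hz _)).2,
    Matrix.sub_apply, Matrix.mul_apply, Matrix.mul_apply, Fin.sum_univ_three,
    Fin.sum_univ_three] at e02
  rw [wd_congr_on (k := fun y => -(H * (conj (t y) * direction M t X y))) h.isOpen
      (fun y hy => (hX.entry21 y hy).trans (by ring)) hz,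
    (((h.hasWd_conj_t hz).mul (h.hasWd_direction hz _)).const_mul (H : ℂ)).neg.2,
    Matrix.sub_apply, Matrix.mul_apply, Matrix.mul_apply, Fin.sum_univ_three,
    Fin.sum_univ_three] at e21
  simp [mcZ, h.entry02_eq hz, h.entry12_eq hz, hX.entry20 z hz, hX.entry21 z hz,
    hX.entry22_eq h hz, ← c11] at e02 e21
  set v := direction M t X z
  set w := wd (-Complex.I) (direction M t X) z
  set δ := frameField M X z 0 0 - coeff M 0 0 z * v - conj (coeff M 1 1 z) * conj v with hδ
  have t0 := h.t_ne_zero hz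
  have t0' : conj (t z) ≠ 0 := (map_ne_zero _).mpr t0
  obtain ⟨L, hL⟩ : ∃ L, wd (-Complex.I) t z * v + wd Complex.I t z * conj v = t z * L :=
    ⟨(wd (-Complex.I) t z * v + wd Complex.I t z * conj v) / t z, (mul_div_cancel₀ _ t0).symm⟩
  have hLc := congrArg conj hL
  have hbc := congrArg conj hb
  have hzc := congrArg conj hzt
  simp only [map_mul, map_add, map_sub, Complex.conj_conj, map_ofNat] at hLc hbc hzc
  have hδc := congrArg conj hδ
  simp only [map_mul, map_sub, Complex.conj_conj] at hδc
  -- Here `L` is the logarithmic derivative of `t` along the field and `δ` the unknown part of the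
  -- diagonal entry. The two relations and a conjugate force `L` to be real and `δ` to be the
  -- imaginary part of `v_z`, times `i`.
  have i1 : w + L = 2 * δ + conj δ := by
    apply mul_left_cancel₀ t0
    rw [hδc, hδ]
    linear_combination e02 - hL + conj v * hb
  have i2 : w + conj L = -(δ + 2 * conj δ) := by
    apply mul_left_cancel₀ t0'
    apply mul_left_cancel₀ h.H_ne_zero
    rw [hδc, hδ]
    linear_combination -e21 - H * hLc + H * conj v * hzc
  have i2c := congrArg conj i2
  simp only [map_mul, map_add, map_neg, Complex.conj_conj, map_ofNat] at i2c
  have hL1 : L = -(w + conj w) / 2 := by linear_combination (i1 + i2c) / 2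
  have hL2 : conj L = L := by
    rw [hL1]; simp only [map_div₀, map_neg, map_add, Complex.conj_conj, map_ofNat]; ring
  have hd : δ = (w - conj w) / 2 := by
    linear_combination -(2 / 3 : ℂ) * i1 - (1 / 3 : ℂ) * i2 + hL1 + (1 / 3 : ℂ) * hL2
  constructor
  · rw [hL, hL1]; ring
  · linear_combination hd - hδ

end tangential

/-- A real linear map of `ℂ` determines its complex linear and antilinear parts; the directions `1`
and `i` suffice. -/
lemma eq_zero_of_forall_conj {c d : ℂ} (h : ∀ v : ℂ, c * v + d * conj v = 0) :
    c = 0 ∧ d = 0 := by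
  have h1 := h 1
  have h2 := h Complex.I
  rw [map_one] at h1
  rw [Complex.conj_I] at h2
  have h3 : c - d = 0 := by
    apply mul_right_cancel₀ Complex.I_ne_zero
    linear_combination h2
  exact ⟨by linear_combination (h1 + h3) / 2, by linear_combination (h1 - h3) / 2⟩

/-! ### Infinitesimal rotations and the converse for flat homogeneous immersions. -/

section tangential
variable {H : ℝ} {D : Set ℂ} {M : ℂ → M3} {t : ℂ → ℂ} {z : ℂ} {X Y : Matrix (Fin 3) (Fin 3) ℝ}

lemma Tangential.entry01_eq (hX : Tangential H D M t X) (h : AdaptedFrame H D M t) (hz : z ∈ D) :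
    frameField M X z 0 1 = coeff M 0 1 z * direction M t X z
      + conj (coeff M 1 0 z * direction M t X z) := by
  have h1 := (h.conj_frameField (X := X) hz).2.1
  rw [(hX.holomorphic h hz).2] at h1
  have h2 := congrArg conj h1
  simp only [Complex.conj_conj, map_add] at h2
  rw [h2, add_comm]

lemma Tangential.entry22_eq_sum (hX : Tangential H D M t X) (h : AdaptedFrame H D M t)
    (hz : z ∈ D) : frameField M X z 2 2 =
      -((coeff M 0 0 z + coeff M 1 1 z) * direction M t X z
        + conj (coeff M 0 0 z + coeff M 1 1 z) * conj (direction M t X z)) := by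
  rw [hX.entry22_eq h hz, (hX.diagonal h hz).2]
  simp only [map_add, map_mul, map_div₀, map_sub, Complex.conj_conj, map_ofNat]
  ring

lemma AdaptedFrame.smooth_wd_logFactor (h : AdaptedFrame H D M t) (θ : ℂ) :
    ContDiffOn ℝ ∞ (wd θ (logFactor t)) D :=
  smooth_wd h.isOpen (smooth_logFactor h.smooth_t h.re_sq_pos) θ

/-- The covariant derivative of a Killing field is skew, which in complex dimension one means purely
imaginary. -/
lemma Tangential.conj_rotation (hX : Tangential H D M t X) (h : AdaptedFrame H D M t)
    (hz : z ∈ D) : conj (rotation M t X z) = -rotation M t X z := by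
  have h1 := wd_logFactor h.isOpen h.smooth_t h.re_sq_pos hz (-Complex.I)
  rw [map_neg, Complex.conj_I, neg_neg] at h1
  have h2 := congrArg conj h1
  have h3 := (hX.diagonal h hz).1
  have h4 := congrArg conj h3
  unfold rotation
  set v := direction M t X z
  set w := wd (-Complex.I) (direction M t X) z
  set U := wd (-Complex.I) (logFactor t) z
  simp only [map_add, map_mul, map_pow, map_neg, Complex.conj_conj, map_ofNat] at h2 h4 ⊢
  apply mul_left_cancel₀ (h.sq_add_ne_zero hz)
  linear_combination v * h1 + conj v * h2 + t z * h3 + conj (t z) * h4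

/-- Flatness makes `u_z` holomorphic, hence also the rotation. A holomorphic function with imaginary
values has vanishing `z`-derivative. -/
lemma Tangential.wd_rotation (hX : Tangential H D M t X) (h : AdaptedFrame H D M t)
    (hf : ∀ z ∈ D, wd Complex.I (wd (-Complex.I) (logFactor t)) z = 0) (hz : z ∈ D) :
    HasWd (-Complex.I) (rotation M t X) 0 z := by
  have sw := smooth_wd h.isOpen (h.smooth_direction (X := X)) (-Complex.I)
  have sU := h.smooth_wd_logFactor (-Complex.I)
  have sR : ContDiffOn ℝ ∞ (rotation M t X) D := sw.add (sU.mul h.smooth_direction)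
  have hR := diffAt_of_smooth h.isOpen sR hz
  refine ⟨hR, ?_⟩
  have e : wd Complex.I (rotation M t X) z = 0 := by
    have h1 : HasWd Complex.I (wd (-Complex.I) (direction M t X)) 0 z := by
      refine ⟨diffAt_of_smooth h.isOpen sw hz, ?_⟩
      rw [wd_comm h.isOpen h.smooth_direction hz,
        wd_congr_on h.isOpen (fun y hy => (hX.holomorphic h hy).1) hz, wd_const]
    have h2 : HasWd Complex.I (wd (-Complex.I) (logFactor t)) 0 z :=
      ⟨diffAt_of_smooth h.isOpen sU hz, hf z hz⟩
    have h3 : HasWd Complex.I (direction M t X) 0 z :=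
      ⟨diffAt_of_smooth h.isOpen h.smooth_direction hz, (hX.holomorphic h hz).1⟩
    have h4 := (h1.add (h2.mul h3)).2
    rw [zero_mul, mul_zero, add_zero, add_zero] at h4
    exact h4
  have h5 := wd_congr_on (θ := -Complex.I) h.isOpen
    (fun y hy => (neg_eq_iff_eq_neg.mpr (hX.conj_rotation h hy)).symm) hz
  rw [h5, wd_neg, wd_conj hR, map_neg, Complex.conj_I, neg_neg, e, map_zero, neg_zero]

/-- This is the torsion-free formula for the bracket of two fields, with the opposite sign because
fundamental vector fields reverse brackets. The extra terms cancel by the Killing equations and the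
formula for `t_z̄`. -/
lemma Tangential.direction_bracket (hX : Tangential H D M t X) (hY : Tangential H D M t Y)
    (h : AdaptedFrame H D M t) (hz : z ∈ D) : direction M t (X * Y - Y * X) z =
      rotation M t X z * direction M t Y z - rotation M t Y z * direction M t X z := by
  have dX := hX.diagonal h hz
  have dY := hY.diagonal h hz
  have hb := h.structureEqs.tbar z hz
  apply mul_left_cancel₀ (h.t_ne_zero hz)
  rw [← h.entry02_eq hz, h.frameField_bracket hz, Matrix.sub_apply, Matrix.mul_apply,
    Matrix.mul_apply, Fin.sum_univ_three, Fin.sum_univ_three, hX.entry01_eq h hz,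
    hY.entry01_eq h hz, hX.entry22_eq_sum h hz, hY.entry22_eq_sum h hz, dX.2, dY.2,
    h.entry02_eq hz, h.entry02_eq hz, h.entry12_eq hz, h.entry12_eq hz]
  replace dX := dX.1
  replace dY := dY.1
  unfold rotation
  set v := direction M t X z
  set w := wd (-Complex.I) (direction M t X) z
  set v' := direction M t Y z
  set w' := wd (-Complex.I) (direction M t Y) z
  simp only [map_mul, map_add]
  linear_combination -(v * conj v' - v' * conj v) * hb + v / 2 * dY - v' / 2 * dX

/-- Rotations are constant, so the covariant derivative of the bracket formula is `ρ_X ρ_Y - ρ_Y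
ρ_X`: infinitesimal rotations of a plane commute. -/
lemma Tangential.rotation_bracket (hX : Tangential H D M t X) (hY : Tangential H D M t Y)
    (h : AdaptedFrame H D M t)
    (hf : ∀ z ∈ D, wd Complex.I (wd (-Complex.I) (logFactor t)) z = 0) (hz : z ∈ D) :
    rotation M t (X * Y - Y * X) z = 0 := by
  have h1 := (((hX.wd_rotation h hf hz).mul (h.hasWd_direction (X := Y) hz _)).sub
    ((hY.wd_rotation h hf hz).mul (h.hasWd_direction (X := X) hz _))).2
  rw [rotation, wd_congr_on h.isOpen (fun y hy => hX.direction_bracket hY h hy) hz, h1,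
    hX.direction_bracket hY h hz]
  simp only [rotation]
  ring

lemma direction_add_smul (r : ℝ) :
    direction M t (X + r • Y) z = direction M t X z + r * direction M t Y z := by
  rw [direction, frameField_add, frameField_smul, direction, direction, Matrix.add_apply,
    Matrix.smul_apply, smul_eq_mul]
  ring

lemma AdaptedFrame.rotation_add_smul (h : AdaptedFrame H D M t) (hz : z ∈ D) (r : ℝ) :
    rotation M t (X + r • Y) z = rotation M t X z + r * rotation M t Y z := by
  have h1 := ((h.hasWd_direction (X := X) hz (-Complex.I)).add
    ((h.hasWd_direction (X := Y) hz (-Complex.I)).const_mul (r : ℂ))).2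
  rw [rotation, direction_add_smul, wd_congr_on h.isOpen (fun y _ => direction_add_smul r) hz, h1,
    rotation, rotation]
  ring

/-- The fields without infinitesimal rotation at a point suffice for transitivity. -/
lemma AdaptedFrame.exists_direction (h : AdaptedFrame H D M t)
    (hf : ∀ z ∈ D, wd Complex.I (wd (-Complex.I) (logFactor t)) z = 0)
    {𝔞 : Submodule ℝ (Matrix (Fin 3) (Fin 3) ℝ)} (ht : ∀ X ∈ 𝔞, Tangential H D M t X)
    (hl : ∀ X ∈ 𝔞, ∀ Y ∈ 𝔞, X * Y - Y * X ∈ 𝔞) (hz : z ∈ D)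
    (hs : ∀ v, ∃ X ∈ 𝔞, direction M t X z = v) (v : ℂ) :
    ∃ X ∈ 𝔞, direction M t X z = v ∧ rotation M t X z = 0 := by
  by_cases h0 : ∀ X ∈ 𝔞, rotation M t X z = 0
  · obtain ⟨X, hX, hv⟩ := hs v
    exact ⟨X, hX, hv, h0 X hX⟩
  push Not at h0
  obtain ⟨Y, hY, hy⟩ := h0
  have im : ∀ X ∈ 𝔞, rotation M t X z = (rotation M t X z).im * Complex.I := fun X hX => by
    have h1 := (ht X hX).conj_rotation h hz
    have h2 := congrArg Complex.re h1
    simp only [Complex.conj_re, Complex.neg_re] at h2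
    apply Complex.ext
    · simp; linarith
    · simp
  set y := (rotation M t Y z).im with hy'
  have hy0 : (y : ℂ) ≠ 0 := fun e => hy (by rw [im Y hY, ← hy', e, zero_mul])
  have hyr : y ≠ 0 := by exact_mod_cast hy0
  -- A real multiple of the rotating field `Y` removes the rotation of `X`. Starting from the
  -- direction `1`, or from `i` times that of `Y`, ensures that the corrected direction is nonzero.
  obtain ⟨X, hX, c, hXv, hne⟩ : ∃ X ∈ 𝔞, ∃ c : ℝ, rotation M t (X + c • Y) z = 0 ∧
      direction M t (X + c • Y) z ≠ 0 := by
    have key : ∀ X ∈ 𝔞, ∃ c : ℝ, rotation M t (X + c • Y) z = 0 := fun X hX => by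
      refine ⟨-((rotation M t X z).im / y), ?_⟩
      rw [h.rotation_add_smul hz, im X hX, im Y hY, ← hy']
      push_cast
      simp only [Complex.mul_im, Complex.ofReal_re, Complex.ofReal_im, Complex.I_re,
        Complex.I_im, mul_one, zero_mul, add_zero]
      field_simp
      ring
    by_cases hv0 : direction M t Y z = 0
    · obtain ⟨X, hX, hv⟩ := hs 1
      obtain ⟨c, hc⟩ := key X hX
      exact ⟨X, hX, c, hc, by rw [direction_add_smul, hv, hv0]; simp⟩
    · obtain ⟨X, hX, hv⟩ := hs (Complex.I * direction M t Y z)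
      obtain ⟨c, hc⟩ := key X hX
      refine ⟨X, hX, c, hc, ?_⟩
      rw [direction_add_smul, hv, ← add_mul]
      refine mul_ne_zero (fun e => ?_) hv0
      have := congrArg Complex.im e
      simp at this
  have hX' := 𝔞.add_mem hX (𝔞.smul_mem c hY)
  set X' := X + c • Y
  have hZ := hl X' hX' Y hY
  set d := direction M t X' z with hd
  have dZ := (ht X' hX').direction_bracket (ht Y hY) h hz
  have rZ := (ht X' hX').rotation_bracket (ht Y hY) h hf hz
  rw [hXv, zero_mul, zero_sub, im Y hY, ← hy', ← hd] at dZ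
  -- The bracket of `X'` with `Y` has rotation zero and direction `-i y d`. With the direction `d`
  -- of `X'` it spans the tangent plane, and the coefficients are the coordinates of `v / d`.
  refine ⟨(v / d).re • X' + (-((v / d).im / y)) • (X' * Y - Y * X'),
    𝔞.add_mem (𝔞.smul_mem _ hX') (𝔞.smul_mem _ hZ), ?_, ?_⟩
  · have e : (v / d).re • X' = 0 + (v / d).re • X' := (zero_add _).symm
    have z0 : direction M t 0 z = 0 := by
      have := direction_add_smul (M := M) (t := t) (z := z) (X := X') (Y := X') (-1)
      simpa using this
    rw [direction_add_smul, e, direction_add_smul, z0, ← hd, dZ]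
    have h1 := Complex.re_add_im (v / d)
    have h2 := div_mul_cancel₀ v hne
    push_cast
    field_simp
    linear_combination d * h1 + h2
  · have e : (v / d).re • X' = 0 + (v / d).re • X' := (zero_add _).symm
    have z0 : rotation M t 0 z = 0 := by
      have := h.rotation_add_smul (X := X') (Y := X') hz (-1)
      simpa using this
    rw [h.rotation_add_smul hz, e, h.rotation_add_smul hz, z0, hXv, rZ]
    simp

lemma AdaptedFrame.hasWd_coeff (h : AdaptedFrame H D M t) (hz : z ∈ D) (θ : ℂ) :
    HasWd θ (coeff M 0 0) (wd θ (coeff M 0 0) z) z ∧ HasWd θ (coeff M 1 1) (wd θ (coeff M 1 1) z) z ∧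
    HasWd θ (coeff M 0 1) (wd θ (coeff M 0 1) z) z ∧
    HasWd θ (coeff M 1 0) (wd θ (coeff M 1 0) z) z := by
  obtain ⟨dp, dq, dA, dB, -⟩ := h.structureEqs.diff hz
  exact ⟨hasWd dp, hasWd dq, hasWd dA, hasWd dB⟩

/-- The `(2,2)` entry of the Lax equation, with holomorphy of the direction used. -/
lemma Tangential.psi_eq (hX : Tangential H D M t X) (h : AdaptedFrame H D M t) (hz : z ∈ D) :
    (wd (-Complex.I) (coeff M 0 0) z + wd (-Complex.I) (coeff M 1 1) z) * direction M t X z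
      + (coeff M 0 0 z + coeff M 1 1 z) * wd (-Complex.I) (direction M t X) z
      + (conj (wd Complex.I (coeff M 0 0) z + wd Complex.I (coeff M 1 1) z)
        + H * (conj (t z) ^ 2 - t z ^ 2)) * conj (direction M t X z) = 0 := by
  obtain ⟨hp, hq, -, -⟩ := h.hasWd_coeff hz (-Complex.I)
  obtain ⟨hp', hq', -, -⟩ := h.hasWd_coeff hz Complex.I
  have hpc : HasWd (-Complex.I) (fun y => conj (coeff M 0 0 y + coeff M 1 1 y)) _ z :=
    HasWd.conj (by simpa using hp'.add hq')
  have e := h.wd_frameField (X := X) hz 2 2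
  rw [wd_congr_on h.isOpen (fun y hy => hX.entry22_eq_sum h hy) hz,
    (((hp.add hq).mul (h.hasWd_direction (X := X) hz _)).add
      (hpc.mul (h.hasWd_conj_direction (X := X) hz))).neg.2, (hX.holomorphic h hz).1,
    Matrix.sub_apply, Matrix.mul_apply, Matrix.mul_apply, Fin.sum_univ_three,
    Fin.sum_univ_three] at e
  simp [mcZ, h.entry02_eq hz, h.entry12_eq hz, hX.entry20 z hz, hX.entry21 z hz] at e
  simp only [map_add]
  linear_combination -e

/-- The `(0,1)` entry of the `z̄`-half of the Lax equation; it links the derivatives of `A` and `B`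
along the field. -/
lemma Tangential.A_bar_eq (hX : Tangential H D M t X) (h : AdaptedFrame H D M t) (hz : z ∈ D) :
    wd Complex.I (coeff M 0 1) z * direction M t X z
      + conj (wd (-Complex.I) (coeff M 1 0) z * direction M t X z
        + coeff M 1 0 z * wd (-Complex.I) (direction M t X) z)
      = conj (coeff M 1 0 z) * (frameField M X z 0 0 - conj (frameField M X z 0 0))
        + (conj (coeff M 0 0 z) - conj (coeff M 1 1 z)) *
          (coeff M 0 1 z * direction M t X z + conj (coeff M 1 0 z * direction M t X z)) := by
  obtain ⟨-, -, hA, -⟩ := h.hasWd_coeff hz Complex.I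
  obtain ⟨-, -, -, hB⟩ := h.hasWd_coeff hz (-Complex.I)
  have hBc : HasWd Complex.I (fun y => conj (coeff M 1 0 y * direction M t X y)) _ z :=
    HasWd.conj (by simpa using hB.mul (h.hasWd_direction (X := X) hz _))
  have e : wd Complex.I (fun y => frameField M X y 0 1) z = _ :=
    congrFun (congrFun (h.mwd_frameField (X := X) hz Complex.I) 0) 1
  rw [wd_congr_on h.isOpen (fun y hy => hX.entry01_eq h hy) hz,
    ((hA.mul (h.hasWd_direction (X := X) hz _)).add hBc).2, (hX.holomorphic h hz).1, h.mc_zbar hz,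
    Matrix.sub_apply, Matrix.mul_apply, Matrix.mul_apply, Fin.sum_univ_three,
    Fin.sum_univ_three, hX.entry01_eq h hz, ← (h.conj_frameField hz).1] at e
  simp [mcZbar] at e
  simp only [map_add, map_mul]
  linear_combination e

/-- The equations that characterize primitive harmonic frames of order two hold for flat
homogeneous immersions. -/
lemma AdaptedFrame.symmetric_of_homogeneous (h : AdaptedFrame H D M t)
    (hf : ∀ z ∈ D, wd Complex.I (wd (-Complex.I) (logFactor t)) z = 0)
    {𝔞 : Submodule ℝ (Matrix (Fin 3) (Fin 3) ℝ)} (ht : ∀ X ∈ 𝔞, Tangential H D M t X)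
    (hl : ∀ X ∈ 𝔞, ∀ Y ∈ 𝔞, X * Y - Y * X ∈ 𝔞)
    (hs : ∀ z ∈ D, ∀ v, ∃ X ∈ 𝔞, direction M t X z = v) :
    SymmetricEqs D (coeff M 0 0) (coeff M 1 1) (coeff M 0 1) (coeff M 1 0) t := by
  have hS := h.structureEqs
  -- For fields without rotation at `z`, the derivative of the direction at `z` is a fixed multiple
  -- of its value. The field equations then become linear identities in `v` and `v̄`.
  have hex : ∀ z ∈ D, ∀ v, ∃ X, Tangential H D M t X ∧ direction M t X z = v ∧
      wd (-Complex.I) (direction M t X) z = -(wd (-Complex.I) (logFactor t) z) * v :=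
    fun z hz v => by
      obtain ⟨X, hX, h1, h2⟩ := h.exists_direction hf ht hl hz (hs z hz) v
      refine ⟨X, ht X hX, h1, ?_⟩
      rw [rotation, h1] at h2
      linear_combination h2
  have hpsi : ∀ z ∈ D, wd Complex.I (coeff M 0 0) z + wd Complex.I (coeff M 1 1) z = 0 := by
    intro z hz
    have h1 := (eq_zero_of_forall_conj (c :=
      wd (-Complex.I) (coeff M 0 0) z + wd (-Complex.I) (coeff M 1 1) z
        - (coeff M 0 0 z + coeff M 1 1 z) * wd (-Complex.I) (logFactor t) z)
      (d := conj (wd Complex.I (coeff M 0 0) z + wd Complex.I (coeff M 1 1) z)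
        + H * (conj (t z) ^ 2 - t z ^ 2)) fun v => by
        obtain ⟨X, hX, hv, hw⟩ := hex z hz v
        have h2 := hX.psi_eq h hz
        rw [hv, hw] at h2
        linear_combination h2).2
    -- The `v̄`-coefficient says that the conjugate of `(p + q)_z̄` is `-H (t̄² - t²)`, and the
    -- structure equation says that `(p + q)_z̄` minus its conjugate is `H (t̄² - t²)`; adding them
    -- gives zero.
    linear_combination hS.psi z hz + h1
  have hreal : ∀ z ∈ D, conj (t z) = t z := by
    intro z hz
    have h1 := hS.psi z hz
    rw [hpsi z hz, map_zero, sub_zero] at h1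
    have h2 := (mul_eq_zero.mp h1.symm).resolve_left h.H_ne_zero
    exact conj_eq_self_of_sq (h.re_pos z hz) (sub_eq_zero.mp h2)
  have hA : ∀ z ∈ D, wd Complex.I (coeff M 0 1) z
      = (conj (coeff M 0 0 z) - conj (coeff M 1 1 z)) * coeff M 0 1 z := by
    intro z hz
    have hU := hS.logFactor_of_real hreal hz
    have h1 := (eq_zero_of_forall_conj (c := wd Complex.I (coeff M 0 1) z
        - (conj (coeff M 0 0 z) - conj (coeff M 1 1 z)) * coeff M 0 1 z)
      (d := conj (wd (-Complex.I) (coeff M 1 0) z - coeff M 1 0 z * (coeff M 0 0 z - coeff M 1 1 z))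
        - (conj (coeff M 0 0 z) - conj (coeff M 1 1 z)) * conj (coeff M 1 0 z)) fun v => by
        obtain ⟨X, hX, hv, hw⟩ := hex z hz v
        have h2 := hX.A_bar_eq h hz
        rw [(hX.diagonal h hz).2, hv, hw, hU] at h2
        simp only [map_add, map_sub, map_mul, map_neg, map_div₀, Complex.conj_conj, map_ofNat]
          at h2 ⊢
        linear_combination h2).1
    linear_combination h1
  refine ⟨hreal, hpsi, hA, fun z hz => ?_⟩
  have h1 := hS.codazzi z hz
  rw [hA z hz] at h1
  have h2 := congrArg conj h1
  simp only [map_add, map_sub, map_mul, Complex.conj_conj, map_zero] at h2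
  linear_combination h2

end tangential

/-! ### The primitive harmonicity of the normalized frame -/

lemma IsPrimitiveHarmonicSigma.congr_iff {H : ℝ} {n : ℕ} {D : Set ℂ} {F G : ℂ → M3}
    (hD : IsOpen D) (e : ∀ z ∈ D, F z = G z) :
    IsPrimitiveHarmonicSigma H n D F ↔ IsPrimitiveHarmonicSigma H n D G :=
  ⟨fun h => IsPrimitiveHarmonic.congr hD h fun z hz => (e z hz).symm,
    fun h => IsPrimitiveHarmonic.congr hD h e⟩

lemma IsFrame.congr {D : Set ℂ} {F G : ℂ → M3} (h : IsFrame D G) (e : ∀ z ∈ D, F z = G z) :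
    IsFrame D F :=
  ⟨fun i j => (h.1 i j).congr fun z hz => by rw [e z hz], fun z hz => by
    rw [e z hz]; exact h.2 z hz⟩

/-- With `A = 0` and real `t` also `p + q = 0`, so the equations for `p + q` and `A` are trivial,
and the one for `B` is the conjugate of the Codazzi equation. -/
lemma StructureEqs.symmetric_of_real {H : ℝ} {D : Set ℂ} {p q A B t : ℂ → ℂ}
    (h : StructureEqs H D p q A B t) (hA : ∀ z ∈ D, A z = 0)
    (ht : ∀ z ∈ D, conj (t z) = t z) : SymmetricEqs D p q A B t := by
  have hs : ∀ z ∈ D, p z + q z = 0 := fun z hz => by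
    have h1 := h.A_eq_of_real' ht hz
    rw [hA z hz] at h1
    have h2 := (mul_eq_zero.mp h1.symm).resolve_left (by norm_num)
    exact (map_eq_zero _).mp h2
  have dA : ∀ z ∈ D, wd Complex.I A z = 0 := fun z hz => by
    rw [wd_congr_on h.isOpen hA hz, wd_const]
  refine ⟨ht, fun z hz => ?_, fun z hz => ?_, fun z hz => ?_⟩
  · obtain ⟨dp, dq, -⟩ := h.diff hz
    rw [← wd_add dp dq, wd_congr_on h.isOpen hs hz, wd_const]
  · rw [dA z hz, hA z hz, mul_zero]
  · have h1 := h.codazzi z hz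
    rw [dA z hz, hA z hz] at h1
    have h2 := congrArg conj h1
    simp only [map_add, map_sub, map_mul, Complex.conj_conj, map_zero] at h2
    linear_combination h2

section conformal
variable {H : ℝ} {D : Set ℂ} {x χ : ℂ → V3} {z : ℂ}

lemma IsConformal.tangential (hc : IsConformal H D x χ) {X : Matrix (Fin 3) (Fin 3) ℝ}
    (h0 : X.trace = 0)
    (h : ∀ z ∈ D, ∃ v, hor (x z) (χ z) (X *ᵥ x z, -(Xᵀ *ᵥ χ z)) = df x χ v z) :
    Tangential H D (frameM H x χ) (tFun H x χ) X := by
  have key : ∀ z ∈ D, ∀ v, hor (x z) (χ z) (X *ᵥ x z, -(Xᵀ *ᵥ χ z)) = df x χ v z →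
      direction (frameM H x χ) (tFun H x χ) X z = v := fun z hz v hv => by
    rw [direction, ((hc.df_eq_iff hz v).mp hv).1, mul_div_cancel_left₀ _ (hc.tFun_ne_zero hz)]
  refine ⟨h0, fun z hz => ?_, fun z hz => ?_⟩ <;> obtain ⟨v, hv⟩ := h z hz <;>
    rw [key z hz v hv]
  · exact ((hc.df_eq_iff hz v).mp hv).2.2.1
  · exact ((hc.df_eq_iff hz v).mp hv).2.2.2

lemma IsConformal.symmetric_of_homogeneous (hD : IsOpen D) (hc : IsConformal H D x χ)
    (hdet : ∀ z ∈ D, (frameM H x χ z).det = R.det)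
    (hf : ∀ z ∈ D, wd Complex.I (wd (-Complex.I) (logFactor (tFun H x χ))) z = 0)
    {𝔞 : Submodule ℝ (Matrix (Fin 3) (Fin 3) ℝ)} (ht : ∀ X ∈ 𝔞, X.trace = 0)
    (hl : ∀ X ∈ 𝔞, ∀ Y ∈ 𝔞, X * Y - Y * X ∈ 𝔞)
    (hr : ∀ z ∈ D, Set.range (fun v : ℂ => df x χ v z) =
      (fun X : Matrix (Fin 3) (Fin 3) ℝ => hor (x z) (χ z) (X *ᵥ x z, -(Xᵀ *ᵥ χ z))) ''
        {X | X ∈ 𝔞}) :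
    SymmetricEqs D (coeff (frameM H x χ) 0 0) (coeff (frameM H x χ) 1 1)
      (coeff (frameM H x χ) 0 1) (coeff (frameM H x χ) 1 0) (tFun H x χ) := by
  refine (hc.adaptedFrame hD hdet).symmetric_of_homogeneous hf
    (fun X hX => hc.tangential (ht X hX) fun z hz => ?_) hl fun z hz v => ?_
  · have h1 : hor (x z) (χ z) (X *ᵥ x z, -(Xᵀ *ᵥ χ z)) ∈ Set.range fun v : ℂ => df x χ v z := by
      rw [hr z hz]; exact ⟨X, hX, rfl⟩
    obtain ⟨v, hv⟩ := h1
    exact ⟨v, hv.symm⟩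
  · have h1 : df x χ v z ∈ Set.range fun v : ℂ => df x χ v z := ⟨v, rfl⟩
    rw [hr z hz] at h1
    obtain ⟨X, hX, hv⟩ := h1
    exact ⟨X, hX, by
      rw [direction, ((hc.df_eq_iff hz v).mp hv).1, mul_div_cancel_left₀ _ (hc.tFun_ne_zero hz)]⟩

variable {f : ℂ → DP2}

lemma IsLift.primitive_one_iff (hD : IsOpen D) (hl : IsLift D f x χ) (hc : IsConformal H D x χ)
    (hdet : ∀ z ∈ D, (frameM H x χ z).det = R.det) :
    IsPrimitiveHarmonicSigma H 1 D (fun z => R⁻¹ * frameM H x χ z) ↔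
      IsMinimal D f ∧ IsLagrangian D f := by
  rw [(hc.adaptedFrame hD hdet).primitive_one_iff, isMinimal_iff hD hl, isLagrangian_iff hD hl,
    hc.minimal_iff hD hdet, hc.lagrangian_iff]
  exact ⟨fun h => ⟨fun z hz => (h z hz).1, fun z hz => (h z hz).2⟩,
    fun h z hz => ⟨h.1 z hz, h.2 z hz⟩⟩

lemma IsLift.primitive_two_iff (hD : IsOpen D) (hl : IsLift D f x χ) (hc : IsConformal H D x χ)
    (hdet : ∀ z ∈ D, (frameM H x χ z).det = R.det) :
    IsPrimitiveHarmonicSigma H 2 D (fun z => R⁻¹ * frameM H x χ z) ↔ IsMinimal D f := by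
  rw [(hc.adaptedFrame hD hdet).primitive_two_iff, isMinimal_iff hD hl, hc.minimal_iff hD hdet]

/-- The two alternatives correspond to the dichotomy for `p + q`: identically zero, or nowhere zero.
-/
lemma IsLift.primitive_three_iff (hD : IsOpen D) (hDc : IsPreconnected D) (hne : D.Nonempty)
    (hl : IsLift D f x χ) (hc : IsConformal H D x χ)
    (hdet : ∀ z ∈ D, (frameM H x χ z).det = R.det) :
    IsPrimitiveHarmonicSigma H 3 D (fun z => R⁻¹ * frameM H x χ z) ↔
      (IsMinimal D f ∧ IsLagrangian D f) ∨ (IsFlat H D f ∧ IsHomogeneous D f) := by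
  have hA := hc.adaptedFrame hD hdet
  have hS := hA.structureEqs
  rw [hA.primitive_three_iff, isMinimal_iff hD hl, isLagrangian_iff hD hl,
    hc.minimal_iff hD hdet, hc.lagrangian_iff, isFlat_iff hD hl, hc.flat_iff hD,
    isHomogeneous_iff hD hl]
  constructor
  · intro hs
    rcases hs.dichotomy hS hDc with h | h
    · exact .inl ⟨h, hs.real_t⟩
    · exact .inr ⟨fun z hz => hs.flat hS h hz, hc.homogeneous_of_symmetric hD hDc hne hdet hs h⟩
  · rintro (⟨h1, h2⟩ | ⟨h1, 𝔞, ht, hb, hr⟩)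
    · exact hS.symmetric_of_real h1 h2
    · exact hc.symmetric_of_homogeneous hD hdet h1 ht hb hr

end conformal

end RuhVilms

end

/-! ### The theorem, read off from the lift of determinant one. -/

theorem theorem6 (H : ℝ) (hH : H = 1 ∨ H = -1) (D : Set ℂ) (hD : IsOpen D)
    (hDs : SimplyConnectedSpace D) (f : ℂ → RuhVilms.DP2)
    (hf : RuhVilms.IsDefiniteImmersion H D f)
    (x χ : ℂ → RuhVilms.V3) (hl : RuhVilms.IsLift D f x χ)
    (F : ℂ → RuhVilms.M3) (hF : F = RuhVilms.normalizedFrame H x χ) :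
    -- the normalized frame is a smooth map into the real form
    RuhVilms.IsFrame D F ∧
    -- the Gauss maps into the three six-symmetric spaces
    (((RuhVilms.IsPrimitiveHarmonicMap H 1 (RuhVilms.FL1 H) (RuhVilms.pi1 H) D
          (fun z => RuhVilms.pi1 H (F z)) ↔ RuhVilms.IsPrimitiveHarmonicSigma H 1 D F) ∧
      (RuhVilms.IsPrimitiveHarmonicMap H 1 RuhVilms.FL2 RuhVilms.pi2 D
          (fun z => RuhVilms.pi2 (F z)) ↔ RuhVilms.IsPrimitiveHarmonicSigma H 1 D F) ∧
      (RuhVilms.IsPrimitiveHarmonicMap H 1 (RuhVilms.FL3 H) (RuhVilms.pi3 H) D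
          (fun z => RuhVilms.pi3 H (F z)) ↔ RuhVilms.IsPrimitiveHarmonicSigma H 1 D F)) ∧
      (RuhVilms.IsPrimitiveHarmonicSigma H 1 D F ↔
        RuhVilms.IsMinimal D f ∧ RuhVilms.IsLagrangian D f)) ∧
    -- the Gauss maps into the flag manifolds
    (((RuhVilms.IsPrimitiveHarmonicMap H 2 RuhVilms.Fl2 (fun A => (RuhVilms.pi2 A).2) D
          (fun z => (RuhVilms.pi2 (F z)).2) ↔ RuhVilms.IsPrimitiveHarmonicSigma H 2 D F) ∧
      (RuhVilms.IsPrimitiveHarmonicMap H 2 (RuhVilms.Fl2T H) (RuhVilms.piFlagT H) D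
          (fun z => RuhVilms.projFlag (RuhVilms.pi3 H (F z))) ↔
        RuhVilms.IsPrimitiveHarmonicSigma H 2 D F)) ∧
      (RuhVilms.IsPrimitiveHarmonicSigma H 2 D F ↔ RuhVilms.IsMinimal D f)) ∧
    -- the Gauss maps into the special Lagrangian Grassmannians
    (((RuhVilms.IsPrimitiveHarmonicMap H 3 (RuhVilms.SLGr H) (fun A => (RuhVilms.pi1 H A).2) D
          (fun z => (RuhVilms.pi1 H (F z)).2) ↔ RuhVilms.IsPrimitiveHarmonicSigma H 3 D F) ∧
      (RuhVilms.IsPrimitiveHarmonicMap H 3 (RuhVilms.SLGrT H) (RuhVilms.piLagrT H) D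
          (fun z => RuhVilms.projLagr (RuhVilms.pi3 H (F z))) ↔
        RuhVilms.IsPrimitiveHarmonicSigma H 3 D F)) ∧
      (RuhVilms.IsPrimitiveHarmonicSigma H 3 D F ↔
        (RuhVilms.IsMinimal D f ∧ RuhVilms.IsLagrangian D f) ∨
        (RuhVilms.IsFlat H D f ∧ RuhVilms.IsHomogeneous D f))) := by
  have hHH : H * H = 1 := by rcases hH with rfl | rfl <;> norm_num
  have hHC : (H : ℂ) * H = 1 := by exact_mod_cast hHH
  have hDc : IsPreconnected D := isPreconnected_iff_preconnectedSpace.mpr inferInstance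
  have hne : D.Nonempty := Set.nonempty_coe_sort.mp inferInstance
  have hc := RuhVilms.isConformal_of_isLift hD hHH hl hf
  obtain ⟨x', χ', hl', hc', e⟩ := RuhVilms.exists_normalized_lift hD hl hc
  rw [← hF] at e
  have hdet := fun z hz => (e z hz).2
  replace e := fun z hz => (e z hz).1
  have hFr : RuhVilms.IsFrame D F := (hc'.adaptedFrame hD hdet).isFrame.congr e
  refine ⟨hFr, ⟨⟨RuhVilms.gaussMap_FL1_iff hHC hD hFr, RuhVilms.gaussMap_FL2_iff hHC hD hFr,
    RuhVilms.gaussMap_FL3_iff hHC hD hFr⟩, ?_⟩, ⟨⟨RuhVilms.gaussMap_Fl2_iff hHC hD hFr,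
    RuhVilms.gaussMap_Fl2T_iff hHC hD hFr⟩, ?_⟩, ⟨RuhVilms.gaussMap_SLGr_iff hHC hD hFr,
    RuhVilms.gaussMap_SLGrT_iff hHC hD hFr⟩, ?_⟩
  · exact (RuhVilms.IsPrimitiveHarmonicSigma.congr_iff hD e).trans
      (hl'.primitive_one_iff hD hc' hdet)
  · exact (RuhVilms.IsPrimitiveHarmonicSigma.congr_iff hD e).trans
      (hl'.primitive_two_iff hD hc' hdet)
  · exact (RuhVilms.IsPrimitiveHarmonicSigma.congr_iff hD e).trans
      (hl'.primitive_three_iff hD hDc hne hc' hdet)
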